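/- Let $(M,g)$ be a smooth Lorentzian manifold (signature $(-,+,\dots,+)$; $M$ Hausdorff and second countable). A \emph{time function} is a smooth $\tau:M\to\mathbb R$ whose gradient is timelike; it defines the time orientation given by $-\operatorname{grad}\tau$, and its nonempty level sets are its \emph{time slices}. For $S\subset M$ the \emph{domain of dependence} is $D(S)=D^+(S)\cup D^-(S)$, where $D^-(S)$ (resp. $D^+(S)$) is the set of points $p$ such that every smooth future-directed (resp. past-directed) causal curve $c:[a,b)\to M$, $b\le\infty$, with $c(a)=p$ for which $\lim_{t\to b}c(t)$ does not exist intersects $S$. Here a curve is future-directed (resp. past-directed) causal if its velocity is everywhere non-spacelike and, where nonzero, future-pointing (resp. past-pointing). $(M,g)$ is \emph{globally hyperbolic} if it has a time function all of whose time slices $S'$ satisfy $D(S')=M$. Let $S$ be a time slice of a time function $\tau$ with future-pointing unit normal field $n$. For $x\in S$ let $c_x$ be the maximal geodesic with $c_x(0)=x$, $\dot c_x(0)=n_x$, and let $\exp(t,x)=c_x(t)$, a smooth map from an open neighbourhood $U$ of $\{0\}\times S$ in $\mathbb R\times S$ to $M$. A point $q$ is \emph{conjugate to $S$ along $c_x$}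 if $q=\exp(t,x)$ for some $t$ such that $(t,x)\in U$ is a critical point of $\exp$, i.e. the differential of $\exp$ at $(t,x)$ is not surjective. \textbf{Proposition.} Let $(M,g)$ be globally hyperbolic, $S$ a time slice of a time function, $p\in M$, and let $c$ be a timelike geodesic, defined on an open interval containing $[a,b]$ with $a<b$, such that $c(a)\in S$, $\dot c(a)$ is orthogonal to $S$, and $c(b)=p$. If for some $s\in(a,b)$ the point $c(s)$ is conjugate to $S$ along the geodesic $c_{c(a)}$ (which is $c$ up to an affine reparametrization), then $c|_{[a,b]}$ does not maximize length among the timelike curves connecting $S$ to $p$: there is a smooth timelike curve $\gamma:[a',b']\to M$ with $\gamma(a')\in S$, $\gamma(b')=p$ and $$\int_{a'}^{b'}|\langle\dot\gamma,\dot\gamma\rangle|^{1/2}\,dt>\int_a^b|\langle\dot c,\dot c\rangle|^{1/2}\,dt .$$ -/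

import Mathlib

open Set Filter Topology
open scoped Manifold ContDiff Bundle

noncomputable section

namespace LorentzGeom

variable {E : Type*} [NormedAddCommGroup E] [NormedSpace ℝ E]
  {M : Type*} [TopologicalSpace M] [ChartedSpace E M]

/-- A smooth Lorentzian metric on `M`, of signature `(-,+,...,+)`: a smooth field of symmetric
bilinear forms such that each tangent space contains a timelike vector on whose orthogonal
complement the form is positive definite. -/
structure LorentzianMetric (E : Type*) [NormedAddCommGroup E] [NormedSpace ℝ E]
    (M : Type*) [TopologicalSpace M] [ChartedSpace E M] [IsManifold 𝓘(ℝ, E) ∞ M] where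
  /-- the bilinear form `⟨·,·⟩` on the tangent space at `x` -/
  val : ∀ x : M, TangentSpace 𝓘(ℝ, E) x →L[ℝ] TangentSpace 𝓘(ℝ, E) x →L[ℝ] ℝ
  symm : ∀ (x : M) (v w : TangentSpace 𝓘(ℝ, E) x), val x v w = val x w v
  signature : ∀ x : M, ∃ v : TangentSpace 𝓘(ℝ, E) x, val x v v < 0 ∧
    ∀ w : TangentSpace 𝓘(ℝ, E) x, val x v w = 0 → w ≠ 0 → 0 < val x w w
  contMDiff : ContMDiff 𝓘(ℝ, E) (𝓘(ℝ, E).prod 𝓘(ℝ, E →L[ℝ] E →L[ℝ] ℝ)) ∞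
    (fun x ↦ Bundle.TotalSpace.mk' (E →L[ℝ] E →L[ℝ] ℝ)
      (E := fun x : M ↦ TangentSpace 𝓘(ℝ, E) x →L[ℝ] TangentSpace 𝓘(ℝ, E) x →L[ℝ] ℝ) x (val x))

/-- The differential of a real function at `x`, as a linear form on the tangent space. -/
def differential (f : M → ℝ) (x : M) : TangentSpace 𝓘(ℝ, E) x →L[ℝ] ℝ :=
  mfderiv 𝓘(ℝ, E) 𝓘(ℝ, ℝ) f x

/-- The velocity at `t` of a curve defined near `t`. -/
def velocity (c : ℝ → M) (t : ℝ) : TangentSpace 𝓘(ℝ, E) (c t) :=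
  (mfderiv 𝓘(ℝ, ℝ) 𝓘(ℝ, E) c t : ℝ →L[ℝ] TangentSpace 𝓘(ℝ, E) (c t)) 1

/-- The velocity at `t` of a curve defined on the interval `J` (one-sided at end points). -/
def velocityWithin (c : ℝ → M) (J : Set ℝ) (t : ℝ) : TangentSpace 𝓘(ℝ, E) (c t) :=
  (mfderivWithin 𝓘(ℝ, ℝ) 𝓘(ℝ, E) c J t : ℝ →L[ℝ] TangentSpace 𝓘(ℝ, E) (c t)) 1

variable [IsManifold 𝓘(ℝ, E) ∞ M] (g : LorentzianMetric E M)

/-! Geodesics of the Levi-Civita connection -/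

/-- The coefficients of the metric in the preferred chart at `x₀`: the pull-back of the metric
under the inverse of the chart, a field of bilinear forms on (the chart's target in) `E`. -/
def LorentzianMetric.inChart (x₀ : M) (y : E) : E →L[ℝ] E →L[ℝ] ℝ :=
  let G : E →L[ℝ] E →L[ℝ] ℝ := g.val ((extChartAt 𝓘(ℝ, E) x₀).symm y)
  let D : E →L[ℝ] E := mfderiv 𝓘(ℝ, E) 𝓘(ℝ, E) (extChartAt 𝓘(ℝ, E) x₀).symm y
  G.bilinearComp D D

/-- The Christoffel symbols (of the first kind) of a field `G` of symmetric bilinear forms on `E`: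
`Γ(u,v;w) = (∂ᵤ G(v,w) + ∂ᵥ G(u,w) - ∂_w G(u,v)) / 2`. -/
def christoffel (G : E → E →L[ℝ] E →L[ℝ] ℝ) (y u v w : E) : ℝ :=
  (fderiv ℝ G y u v w + fderiv ℝ G y v u w - fderiv ℝ G y w u v) / 2

/-- `c` is a geodesic on the open set `J`: it is smooth there and in every chart its coordinate
expression `y` satisfies `G(y'', w) + Γ(y', y'; w) = 0` for all `w`. As `G` is nondegenerate this
is the equation `y'' + Γ(y', y') = 0` for the Levi-Civita connection. -/
def IsGeodesicOn (c : ℝ → M) (J : Set ℝ) : Prop :=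
  ContMDiffOn 𝓘(ℝ, ℝ) 𝓘(ℝ, E) ∞ c J ∧
  ∀ x₀ : M, ∀ t ∈ J, c t ∈ (chartAt E x₀).source → ∀ w : E,
    g.inChart x₀ (extChartAt 𝓘(ℝ, E) x₀ (c t))
        (deriv (deriv fun s ↦ extChartAt 𝓘(ℝ, E) x₀ (c s)) t) w
      + christoffel (g.inChart x₀) (extChartAt 𝓘(ℝ, E) x₀ (c t))
          (deriv (fun s ↦ extChartAt 𝓘(ℝ, E) x₀ (c s)) t)
          (deriv (fun s ↦ extChartAt 𝓘(ℝ, E) x₀ (c s)) t) w = 0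

/-! Timelike curves and their length -/

/-- The curve `c : [a,b] → M` is smooth with everywhere timelike velocity. -/
def IsTimelikeCurve (c : ℝ → M) (a b : ℝ) : Prop :=
  a < b ∧ ContMDiffOn 𝓘(ℝ, ℝ) 𝓘(ℝ, E) ∞ c (Icc a b) ∧
  ∀ t ∈ Icc a b,
    g.val (c t) (velocityWithin c (Icc a b) t) (velocityWithin c (Icc a b) t) < 0

/-- The length (proper time) of `c : [a,b] → M`. -/
def length (c : ℝ → M) (a b : ℝ) : ℝ :=
  ∫ t in a..b,
    Real.sqrt |g.val (c t) (velocityWithin c (Icc a b) t) (velocityWithin c (Icc a b) t)|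

/-- `c : [a,b] → M` is at least as long as every timelike curve connecting `S` to `p`. -/
def MaximizesLength (S : Set M) (p : M) (c : ℝ → M) (a b : ℝ) : Prop :=
  ∀ (γ : ℝ → M) (a' b' : ℝ), IsTimelikeCurve g γ a' b' → γ a' ∈ S → γ b' = p →
    length g γ a' b' ≤ length g c a b

/-! Time functions and global hyperbolicity -/

/-- `τ` is a global time function: it is smooth and its gradient (the vector `v` with
`⟨v, w⟩ = dτ(w)` for all `w`) is timelike at each point. -/
def IsTimeFunction (τ : M → ℝ) : Prop :=
  ContMDiff 𝓘(ℝ, E) 𝓘(ℝ, ℝ) ∞ τ ∧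
  ∀ x : M, ∃ v : TangentSpace 𝓘(ℝ, E) x,
    (∀ w : TangentSpace 𝓘(ℝ, E) x, g.val x v w = differential τ x w) ∧ g.val x v v < 0

/-- `(M,g)` admits a global time function. -/
def IsStablyCausal : Prop := ∃ τ : M → ℝ, IsTimeFunction g τ

/-- A causal vector `v` at `x` that, if nonzero, is future-pointing for the time orientation
defined by `-grad τ`, where `τ` is a time function: indeed `⟨-grad τ, v⟩ < 0` means `0 < dτ(v)`. -/
def IsFutureCausal (τ : M → ℝ) (x : M) (v : TangentSpace 𝓘(ℝ, E) x) : Prop :=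
  g.val x v v ≤ 0 ∧ (v ≠ 0 → 0 < differential τ x v)

/-- The half-open interval `[a,b)`, where `b = ∞` is allowed. -/
def halfOpen (a : ℝ) (b : EReal) : Set ℝ := {t | a ≤ t ∧ (t : EReal) < b}

/-- The curve `c : [a,b) → M` has no limit as the parameter tends to `b`. -/
def HasNoEndpoint (c : ℝ → M) (b : EReal) : Prop :=
  ¬ ∃ q : M, Tendsto c (comap (fun t : ℝ ↦ (t : EReal)) (𝓝[<] b)) (𝓝 q)

/-- The past domain of dependence `D⁻(S)`: all points `p` such that every future-inextendible
future-directed causal curve starting at `p` intersects `S`. -/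
def pastDomain (τ : M → ℝ) (S : Set M) : Set M :=
  {p | ∀ (c : ℝ → M) (a : ℝ) (b : EReal), (a : EReal) < b →
    ContMDiffOn 𝓘(ℝ, ℝ) 𝓘(ℝ, E) ∞ c (halfOpen a b) →
    (∀ t ∈ halfOpen a b, IsFutureCausal g τ (c t) (velocityWithin c (halfOpen a b) t)) →
    HasNoEndpoint c b → c a = p → ∃ t ∈ halfOpen a b, c t ∈ S}

/-- The future domain of dependence `D⁺(S)`: all points `p` such that every past-inextendible
past-directed causal curve starting at `p` intersects `S`. -/
def futureDomain (τ : M → ℝ) (S : Set M) : Set M :=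
  {p | ∀ (c : ℝ → M) (a : ℝ) (b : EReal), (a : EReal) < b →
    ContMDiffOn 𝓘(ℝ, ℝ) 𝓘(ℝ, E) ∞ c (halfOpen a b) →
    (∀ t ∈ halfOpen a b, IsFutureCausal g τ (c t) (-velocityWithin c (halfOpen a b) t)) →
    HasNoEndpoint c b → c a = p → ∃ t ∈ halfOpen a b, c t ∈ S}

/-- The domain of dependence `D(S) = D⁺(S) ∪ D⁻(S)`. -/
def domainOfDependence (τ : M → ℝ) (S : Set M) : Set M :=
  futureDomain g τ S ∪ pastDomain g τ S

/-- The set `S` is a time slice of the time function `τ`: one of its nonempty level sets. -/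
def IsTimeSlice (τ : M → ℝ) (S : Set M) : Prop := S.Nonempty ∧ ∃ a : ℝ, S = τ ⁻¹' {a}

/-- `(M,g)` is globally hyperbolic: it is stably causal and there is a time function all of whose
time slices have domain of dependence `M`. -/
def IsGloballyHyperbolic : Prop :=
  IsStablyCausal g ∧ ∃ τ : M → ℝ, IsTimeFunction g τ ∧
    ∀ S : Set M, IsTimeSlice τ S → domainOfDependence g τ S = univ

/-! The normal exponential map of a time slice and its critical values -/

/-- The vector `v` at `x` is orthogonal to the time slice of `τ` through `x` (whose tangent space
at `x` is the kernel of `dτ`). -/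
def IsOrthogonalToSlice (τ : M → ℝ) (x : M) (v : TangentSpace 𝓘(ℝ, E) x) : Prop :=
  ∀ w : TangentSpace 𝓘(ℝ, E) x, differential τ x w = 0 → g.val x v w = 0

/-- The vector `v` is the future-pointing unit normal at `x` of the time slice through `x`. -/
def IsFutureUnitNormal (τ : M → ℝ) (x : M) (v : TangentSpace 𝓘(ℝ, E) x) : Prop :=
  g.val x v v = -1 ∧ IsOrthogonalToSlice g τ x v ∧ 0 < differential τ x v

/-- `γ` is, on an open interval containing `0` and `t`, the geodesic starting at `x` with the
future-pointing unit normal as its initial velocity. -/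
def IsNormalGeodesic (τ : M → ℝ) (t : ℝ) (x : M) (γ : ℝ → M) : Prop :=
  ∃ a b : ℝ, 0 ∈ Ioo a b ∧ t ∈ Ioo a b ∧ IsGeodesicOn g γ (Ioo a b) ∧
    γ 0 = x ∧ IsFutureUnitNormal g τ (γ 0) (velocity γ 0)

/-- The (maximal) open domain of the normal exponential map. -/
def normalExpDomain (τ : M → ℝ) : Set (ℝ × M) :=
  {z | ∃ γ : ℝ → M, IsNormalGeodesic g τ z.1 z.2 γ}

open Classical in
/-- The normal exponential map `(t, x) ↦ γ t`, where `γ` is the geodesic starting at `x` with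
initial velocity the future-pointing unit normal at `x` of the time slice through `x`. It is
defined for all `x` at once; its restriction to pairs with `x ∈ S` is the exponential map of the
time slice `S`. Off its domain the value is irrelevant. -/
def normalExp (τ : M → ℝ) (z : ℝ × M) : M :=
  if h : ∃ γ : ℝ → M, IsNormalGeodesic g τ z.1 z.2 γ then h.choose z.1 else z.2

/-- The differential at `(t, x)` of the normal exponential map, on `ℝ × TₓM`. -/
def normalExpDeriv (τ : M → ℝ) (t : ℝ) (x : M) :
    ℝ × TangentSpace 𝓘(ℝ, E) x →L[ℝ] TangentSpace 𝓘(ℝ, E) (normalExp g τ (t, x)) :=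
  mfderiv (𝓘(ℝ, ℝ).prod 𝓘(ℝ, E)) 𝓘(ℝ, E) (normalExp g τ) (t, x)

/-- The pair `(t, x)` is a critical point of the exponential map `ℝ × S ⊇ U → M` of the time slice
`S` of `τ` through `x`: the differential, on `ℝ × TₓS` with `TₓS = ker dτ`, is not surjective. -/
def IsCriticalPoint (τ : M → ℝ) (t : ℝ) (x : M) : Prop :=
  (t, x) ∈ normalExpDomain g τ ∧
  ¬ ∀ u : TangentSpace 𝓘(ℝ, E) (normalExp g τ (t, x)),
      ∃ (s : ℝ) (v : TangentSpace 𝓘(ℝ, E) x),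
        differential τ x v = 0 ∧ normalExpDeriv g τ t x (s, v) = u

/-- The point `q` is conjugate to the time slice of `τ` through `x`, along the geodesic that starts
at `x` orthogonally to this slice. -/
def IsConjugatePointAlong (τ : M → ℝ) (x q : M) : Prop :=
  ∃ t : ℝ, IsCriticalPoint g τ t x ∧ normalExp g τ (t, x) = q

end LorentzGeom

end

/-! Let `T` be the velocity of `c`. A critical point of the normal exponential map at the conjugate
parameter `s` yields a variation `y (t, u)` of `c` through geodesics that leave the slice
orthogonally, all with the speed of `c`, whose variation field `J` vanishes at `s`. Each neighbour
is exactly as long as `c` on every common parameter interval, and at `s` it misses `c s` only to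
second order in `u`. Following a neighbour until about `s` and `c` afterwards therefore gives a
broken curve, and rounding its corner gains length of order `u ^ 2`.

The gain is computed in one chart around `c s`, on a window `[s - ε, s + ε]` with `t = s + ε * τ`.
Put `j = J' s` and `m = ⟨j, j⟩`. The rounded variation field is approximately `ε * h τ • j`, where
`h` is a smoothing of `min τ 0` with derivative `k`. Half the second `u`-derivative of the energy
`⟨∂ₜΓ, ∂ₜΓ⟩`, integrated over the window, is an index integral of about `ε * m * ∫ k ^ 2` plus a
boundary term at `s - ε` of about `-ε * m`. As `k` takes values in `[0, 1]` and has integral `1` on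
`[-1, 1]`, `∫ k ^ 2 < 1`; as `m > 0`, the sum is negative and the length grows
(`IsFocalVariation.exists_longer`). Outside the window the speed is that of `c`, so neither a global
index form nor curvature is needed.

The variation comes from `exists_normalVariation`. Smooth local flows (`exists_smooth_local_flow`)
and a continuation argument (`exists_geodesicFamily`) embed `c` in a smooth family of geodesics over
all of `[a, s]`, so near the critical point the normal exponential map is a smooth expression in
this family. Criticality gives a kernel vector `(σ, v)` with `v` tangent to the slice
(`exists_kernel_of_isCriticalPoint`), and `J` is the variation field with initial value `v`. The
Gauss lemma (`gauss`) makes `J` orthogonal to `T`, which forces `σ = 0` and `J s = 0`. The geodesic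
flow has injective differential on positions and velocities
(`IsGeodesicFamily.fderiv_phase_injective`), so `J' s ≠ 0`; being orthogonal to the timelike `T`, it
is spacelike, whence `m > 0`. The time function is injective along timelike curves, so the parameter
in the definition of a conjugate point is the one belonging to `s`. -/

namespace LorentzGeom

noncomputable section

section Instances

/-! Shortcut instances for iterated spaces of linear maps, which are slow to find otherwise. -/

variable {V W : Type*} [NormedAddCommGroup V] [NormedSpace ℝ V] [NormedAddCommGroup W]
  [NormedSpace ℝ W]

scoped instance normedAddCommGroupLinear : NormedAddCommGroup (V →L[ℝ] W) :=
  ContinuousLinearMap.toNormedAddCommGroup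

scoped instance normedSpaceLinear : NormedSpace ℝ (V →L[ℝ] W) := ContinuousLinearMap.toNormedSpace

scoped instance normedAddCommGroupBilinear : NormedAddCommGroup (V →L[ℝ] V →L[ℝ] ℝ) :=
  ContinuousLinearMap.toNormedAddCommGroup

scoped instance normedSpaceBilinear : NormedSpace ℝ (V →L[ℝ] V →L[ℝ] ℝ) :=
  ContinuousLinearMap.toNormedSpace

scoped instance normedAddCommGroupTrilinear : NormedAddCommGroup (V →L[ℝ] V →L[ℝ] V →L[ℝ] ℝ) :=
  ContinuousLinearMap.toNormedAddCommGroup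

scoped instance normedSpaceTrilinear : NormedSpace ℝ (V →L[ℝ] V →L[ℝ] V →L[ℝ] ℝ) :=
  ContinuousLinearMap.toNormedSpace

end Instances

end

end LorentzGeom

namespace LorentzGeom

noncomputable section

universe u

/-! ### Superposition operators on spaces of continuous curves -/

section Nemytskii

variable {K : Type*} [TopologicalSpace K] [CompactSpace K]
  {V : Type u} [NormedAddCommGroup V] [NormedSpace ℝ V]

/-- Pointwise application of a continuous family of linear maps to a continuous family of
vectors. -/
def pointwiseApply (K : Type*) [TopologicalSpace K] [CompactSpace K]
    (V W : Type*) [NormedAddCommGroup V] [NormedSpace ℝ V]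
    [NormedAddCommGroup W] [NormedSpace ℝ W] :
    C(K, V →L[ℝ] W) →L[ℝ] C(K, V) →L[ℝ] C(K, W) :=
  LinearMap.mkContinuous₂
    (LinearMap.mk₂ ℝ (fun (A : C(K, V →L[ℝ] W)) (h : C(K, V)) ↦
        (⟨fun x ↦ A x (h x), A.continuous.clm_apply h.continuous⟩ : C(K, W)))
      (fun A B h ↦ by ext x; simp) (fun c A h ↦ by ext x; simp)
      (fun A h k ↦ by ext x; simp) (fun c A h ↦ by ext x; simp)) 1
    (fun A h ↦ by
      rw [one_mul, ContinuousMap.norm_le _ (by positivity)]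
      intro x
      exact (A x).le_of_opNorm_le_of_le (A.norm_coe_le_norm x) (h.norm_coe_le_norm x))

@[simp] lemma pointwiseApply_apply {W : Type*} [NormedAddCommGroup W] [NormedSpace ℝ W]
    (A : C(K, V →L[ℝ] W)) (h : C(K, V)) (x : K) :
    pointwiseApply K V W A h x = A x (h x) := rfl

/-- The mean value inequality on the segment from `α x` to `β x` bounds the error by the oscillation
of `fderiv ℝ f` there. Compactness of `K` makes this uniform in `x`, in the form of continuity of
postcomposition for the sup norm. -/
lemma hasFDerivAt_comp_left {W : Type*} [NormedAddCommGroup W] [NormedSpace ℝ W]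
    {f : V → W} (hf : ContDiff ℝ 1 f) (α : C(K, V)) :
    HasFDerivAt (fun β : C(K, V) ↦ (⟨f, hf.continuous⟩ : C(V, W)).comp β)
      (pointwiseApply K V W
        ((⟨fderiv ℝ f, hf.continuous_fderiv one_ne_zero⟩ : C(V, V →L[ℝ] W)).comp α)) α := by
  rw [hasFDerivAt_iff_isLittleO, Asymptotics.isLittleO_iff]
  intro ε hε
  set D : C(V, V →L[ℝ] W) := ⟨fderiv ℝ f, hf.continuous_fderiv one_ne_zero⟩ with hD
  have hcont : Continuous fun β : C(K, V) ↦ D.comp β := ContinuousMap.continuous_postcomp D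
  obtain ⟨δ, hδ, hball⟩ := (Metric.continuous_iff (α := C(K, V)) (β := C(K, V →L[ℝ] W))).1 hcont α ε hε
  filter_upwards [Metric.ball_mem_nhds α hδ] with β hβ
  rw [ContinuousMap.norm_le _ (by positivity)]
  intro x
  have key := (convex_segment (𝕜 := ℝ) (α x) (β x)).norm_image_sub_le_of_norm_hasFDerivWithin_le'
    (f := f) (f' := fderiv ℝ f) (C := ε) (φ := fderiv ℝ f (α x)) (x := α x) (y := β x)
    (fun z _ ↦ ((hf.differentiable one_ne_zero) z).hasFDerivAt.hasFDerivWithinAt)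
    (by
      rintro z ⟨p, q, hp, hq, hpq, rfl⟩
      have h1 : p • α + q • β ∈ Metric.ball α δ :=
        (convex_ball α δ) (Metric.mem_ball_self hδ) hβ hp hq hpq
      have h2 := hball _ (Metric.mem_ball.1 h1)
      have h3 := (ContinuousMap.dist_apply_le_dist (f := D.comp (p • α + q • β))
        (g := D.comp α) x).trans h2.le
      simpa [hD, dist_eq_norm] using h3)
    (left_mem_segment _ _ _) (right_mem_segment _ _ _)
  calc _ = ‖f (β x) - f (α x) - fderiv ℝ f (α x) (β x - α x)‖ := by
        simp [hD]
    _ ≤ ε * ‖β x - α x‖ := key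
    _ ≤ ε * ‖β - α‖ := by
        gcongr
        exact (β - α).norm_coe_le_norm x

/-- The derivative is again a superposition operator, that of `fderiv ℝ f`, followed by a continuous
linear map, so induction applies. The target `W` changes to `V →L[ℝ] W` in each step; hence it is
quantified inside and shares the universe of `V`. -/
lemma contDiff_nat_comp_left (n : ℕ) : ∀ {W : Type u} [NormedAddCommGroup W] [NormedSpace ℝ W]
    {f : V → W} (hf : ContDiff ℝ n f),
    ContDiff ℝ n (fun β : C(K, V) ↦ (⟨f, hf.continuous⟩ : C(V, W)).comp β) := by
  induction n with
  | zero =>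
    intro W _ _ f hf
    exact contDiff_zero.2 (ContinuousMap.continuous_postcomp _)
  | succ n ih =>
    intro W _ _ f hf
    have h1 : ContDiff ℝ 1 f := hf.of_le (by simp)
    have h2 : ContDiff ℝ n (fderiv ℝ f) := hf.fderiv_right (by simp)
    refine (contDiff_succ_iff_hasFDerivAt (n := n)).2 ⟨_, ?_, fun α ↦ hasFDerivAt_comp_left h1 α⟩
    exact (pointwiseApply K V W).contDiff.comp (ih h2)

lemma contDiff_comp_left {W : Type u} [NormedAddCommGroup W] [NormedSpace ℝ W]
    {f : V → W} (hf : ContDiff ℝ ∞ f) :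
    ContDiff ℝ ∞ (fun β : C(K, V) ↦ (⟨f, hf.continuous⟩ : C(V, W)).comp β) :=
  contDiff_infty.2 fun n ↦ contDiff_nat_comp_left n (hf.of_le (by exact_mod_cast le_top))

end Nemytskii

section Primitive

variable (V : Type*) [NormedAddCommGroup V] [NormedSpace ℝ V]

/-- The primitive vanishing at `0` of a continuous function on `[-1,1]`. -/
def primitive : C(Icc (-1 : ℝ) 1, V) →L[ℝ] C(Icc (-1 : ℝ) 1, V) :=
  LinearMap.mkContinuous
    { toFun := fun α ↦ ⟨fun t ↦ ∫ r in (0 : ℝ)..t, IccExtend (by norm_num) α r, by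
        exact (intervalIntegral.continuous_primitive
          (fun a b ↦ (α.continuous.Icc_extend' (h := by norm_num)).intervalIntegrable a b)
            0).comp continuous_subtype_val⟩
      map_add' := fun α β ↦ by
        ext t
        exact intervalIntegral.integral_add
          ((α.continuous.Icc_extend' (h := by norm_num)).intervalIntegrable _ _)
          ((β.continuous.Icc_extend' (h := by norm_num)).intervalIntegrable _ _)
      map_smul' := fun c α ↦ by
        ext t
        exact intervalIntegral.integral_smul c _ } 1
    (fun α ↦ by
      rw [one_mul, ContinuousMap.norm_le _ (norm_nonneg _)]
      intro t
      refine (intervalIntegral.norm_integral_le_of_norm_le_const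
        (fun r _ ↦ α.norm_coe_le_norm _)).trans ?_
      have : |(t : ℝ) - 0| ≤ 1 := by rw [sub_zero, abs_le]; exact t.2
      exact mul_le_of_le_one_right (norm_nonneg _) this)

end Primitive

end

end LorentzGeom

namespace LorentzGeom

noncomputable section

universe u

/-! ### Smooth local flows by the inverse function theorem -/

section Flow

variable (V : Type u) [NormedAddCommGroup V] [NormedSpace ℝ V]

/-- The inclusion of the constant functions into the continuous functions on `[-1,1]`. -/
def constantCurve : V →L[ℝ] C(Icc (-1 : ℝ) 1, V) :=
  LinearMap.mkContinuous
    { toFun := fun x ↦ ContinuousMap.const _ x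
      map_add' := fun _ _ ↦ rfl
      map_smul' := fun _ _ ↦ rfl } 1
    (fun x ↦ by
      rw [one_mul, ContinuousMap.norm_le _ (norm_nonneg _)]
      intro t
      exact le_rfl)

@[simp] lemma constantCurve_apply (x : V) (t : Icc (-1 : ℝ) 1) : constantCurve V x t = x := rfl

variable {V}

/-- The map whose zeros `((x, s), α)` are the solutions on `[-1,1]` of `α' = s f(α)`,
`α 0 = x`. -/
def integralEquation {f : V → V} (hf : ContDiff ℝ ∞ f)
    (z : (V × ℝ) × C(Icc (-1 : ℝ) 1, V)) : C(Icc (-1 : ℝ) 1, V) :=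
  z.2 - constantCurve V z.1.1 -
    z.1.2 • primitive V ((⟨f, hf.continuous⟩ : C(V, V)).comp z.2)

lemma contDiff_integralEquation {f : V → V} (hf : ContDiff ℝ ∞ f) :
    ContDiff ℝ ∞ (integralEquation hf) := by
  unfold integralEquation
  refine (contDiff_snd.sub ((constantCurve V).contDiff.comp contDiff_fst.fst)).sub
    (contDiff_fst.snd.smul ((primitive V).contDiff.comp ?_))
  exact (contDiff_comp_left hf).comp contDiff_snd

/-- The derivative of `integralEquation` at a constant curve, completed to an isomorphism. -/
def shear {A B : Type*} [NormedAddCommGroup A] [NormedSpace ℝ A] [NormedAddCommGroup B]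
    [NormedSpace ℝ B] (L : A →L[ℝ] B) : (A × B) ≃L[ℝ] (A × B) :=
  ContinuousLinearEquiv.equivOfInverse
    ((ContinuousLinearMap.fst ℝ A B).prod
      (ContinuousLinearMap.snd ℝ A B + L.comp (ContinuousLinearMap.fst ℝ A B)))
    ((ContinuousLinearMap.fst ℝ A B).prod
      (ContinuousLinearMap.snd ℝ A B - L.comp (ContinuousLinearMap.fst ℝ A B)))
    (fun z ↦ by ext <;> simp) (fun z ↦ by ext <;> simp)

/-- At `s = 0` the nonlinear term carries the factor zero, so its derivative in the curve drops out.
What remains is unipotent, hence invertible without any smallness estimate. -/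
lemma hasFDerivAt_integralEquation {f : V → V} (hf : ContDiff ℝ ∞ f) (x₀ : V) :
    HasFDerivAt (fun z : (V × ℝ) × C(Icc (-1 : ℝ) 1, V) ↦ (z.1, integralEquation hf z))
      (shear (-((constantCurve V).comp (ContinuousLinearMap.fst ℝ V ℝ)) -
        (ContinuousLinearMap.snd ℝ V ℝ).smulRight
          (primitive V ((⟨f, hf.continuous⟩ : C(V, V)).comp (constantCurve V x₀)))) :
        ((V × ℝ) × C(Icc (-1 : ℝ) 1, V)) →L[ℝ] _) ((x₀, 0), constantCurve V x₀) := by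
  have h1 : HasFDerivAt (fun z : (V × ℝ) × C(Icc (-1 : ℝ) 1, V) ↦
      primitive V ((⟨f, hf.continuous⟩ : C(V, V)).comp z.2))
      ((primitive V).comp ((fderiv ℝ (fun β : C(Icc (-1 : ℝ) 1, V) ↦
        (⟨f, hf.continuous⟩ : C(V, V)).comp β) (constantCurve V x₀)).comp
          (ContinuousLinearMap.snd ℝ _ _))) ((x₀, 0), constantCurve V x₀) := by
    refine (primitive V).hasFDerivAt.comp _ ?_
    have h2 := (((contDiff_comp_left (K := Icc (-1 : ℝ) 1) hf).differentiable (by simp)) (constantCurve V x₀)).hasFDerivAt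
    exact HasFDerivAt.comp ((x₀, 0), constantCurve V x₀) (f := Prod.snd) h2 hasFDerivAt_snd
  have h3 := ((hasFDerivAt_snd (𝕜 := ℝ) (E := V × ℝ) (F := C(Icc (-1 : ℝ) 1, V))
    (p := ((x₀, 0), constantCurve V x₀))).sub
      (((constantCurve V).comp ((ContinuousLinearMap.fst ℝ V ℝ).comp
        (ContinuousLinearMap.fst ℝ (V × ℝ) C(Icc (-1 : ℝ) 1, V)))).hasFDerivAt)).sub
      (((ContinuousLinearMap.snd ℝ V ℝ).comp
        (ContinuousLinearMap.fst ℝ (V × ℝ) C(Icc (-1 : ℝ) 1, V))).hasFDerivAt.smul h1)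
  refine ((hasFDerivAt_fst (𝕜 := ℝ) (E := V × ℝ) (F := C(Icc (-1 : ℝ) 1, V))
    (p := ((x₀, 0), constantCurve V x₀))).prodMk h3).congr_fderiv ?_
  refine ContinuousLinearMap.ext fun z ↦ Prod.ext rfl ?_
  simp [shear, sub_eq_add_neg, add_assoc]
  

lemma integralEquation_apply {f : V → V} (hf : ContDiff ℝ ∞ f)
    (z : (V × ℝ) × C(Icc (-1 : ℝ) 1, V)) (t : Icc (-1 : ℝ) 1) :
    integralEquation hf z t = z.2 t - z.1.1 -
      z.1.2 • ∫ r in (0 : ℝ)..t, f (IccExtend (by norm_num) z.2 r) := rfl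

lemma abs_mul_le_one {a b : ℝ} (ha : a ∈ Icc (-1 : ℝ) 1) (hb : b ∈ Icc (-1 : ℝ) 1) :
    a * b ∈ Icc (-1 : ℝ) 1 := by
  rw [mem_Icc, ← abs_le] at *
  rw [abs_mul]
  exact mul_le_one₀ ha (abs_nonneg _) hb

/-- Slowing down a curve on `[-1,1]` by the factor `σ ∈ [-1,1]`. -/
def rescale (σ : Icc (-1 : ℝ) 1) (α : C(Icc (-1 : ℝ) 1, V)) : C(Icc (-1 : ℝ) 1, V) :=
  ⟨fun t ↦ α ⟨σ * t, abs_mul_le_one σ.2 t.2⟩, by fun_prop⟩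

/-- Substituting `σ * r` in the integral shows that slowing a solution down by `σ` multiplies its
rate by `σ`. This ties the solutions for different `s` to a single integral curve. -/
lemma integralEquation_rescale {f : V → V} (hf : ContDiff ℝ ∞ f) {x : V} {s : ℝ}
    {α : C(Icc (-1 : ℝ) 1, V)} (h : integralEquation hf ((x, s), α) = 0)
    (σ : Icc (-1 : ℝ) 1) : integralEquation hf ((x, s * σ), rescale σ α) = 0 := by
  ext t
  have h0 := congrArg (fun β ↦ β ⟨σ * t, abs_mul_le_one σ.2 t.2⟩) h
  simp only [integralEquation_apply, ContinuousMap.zero_apply] at h0 ⊢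
  have h1 : (∫ r in (0 : ℝ)..(σ * t : ℝ), f (IccExtend (by norm_num) α r)) =
      (σ : ℝ) • ∫ r in (0 : ℝ)..t, f (IccExtend (by norm_num) (rescale σ α) r) := by
    have h2 := intervalIntegral.smul_integral_comp_mul_left (a := 0) (b := (t : ℝ))
      (fun r ↦ f (IccExtend (by norm_num) α r)) (σ : ℝ)
    rw [mul_zero] at h2
    rw [← h2]
    congr 1
    refine intervalIntegral.integral_congr fun r hr ↦ ?_
    have hr' : r ∈ Icc (-1 : ℝ) 1 :=
      (convex_Icc (-1 : ℝ) 1).ordConnected.uIcc_subset (by norm_num) t.2 hr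
    rw [IccExtend_of_mem _ _ hr', IccExtend_of_mem _ _ (abs_mul_le_one σ.2 hr')]
    rfl
  rw [h1, smul_smul] at h0
  exact h0

lemma hasDerivAt_of_integralEquation [CompleteSpace V] {f : V → V} (hf : ContDiff ℝ ∞ f) {x : V} {s : ℝ}
    {α : C(Icc (-1 : ℝ) 1, V)} (h : integralEquation hf ((x, s), α) = 0)
    {σ : ℝ} (hσ : σ ∈ Ioo (-1 : ℝ) 1) :
    HasDerivAt (IccExtend (by norm_num) α) (s • f (α ⟨σ, Ioo_subset_Icc_self hσ⟩)) σ := by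
  have hc : Continuous fun r ↦ f (IccExtend (by norm_num : (-1 : ℝ) ≤ 1) α r) :=
    hf.continuous.comp (α.continuous.Icc_extend' (h := by norm_num))
  have h1 := ((hc.integral_hasStrictDerivAt 0 σ).hasDerivAt.const_smul s).const_add x
  rw [IccExtend_of_mem _ _ (Ioo_subset_Icc_self hσ)] at h1
  refine h1.congr_of_eventuallyEq ?_
  filter_upwards [isOpen_Ioo.mem_nhds hσ] with r hr
  have h0 := congrArg (fun β ↦ β ⟨r, Ioo_subset_Icc_self hr⟩) h
  simp only [integralEquation_apply, ContinuousMap.zero_apply] at h0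
  rw [IccExtend_of_mem _ _ (Ioo_subset_Icc_self hr)]
  rw [sub_sub, sub_eq_zero] at h0
  exact h0

/-- A smooth vector field has a smooth local flow. -/
theorem exists_smooth_local_flow_of_contDiff [CompleteSpace V] {f : V → V}
    (hf : ContDiff ℝ ∞ f) (x₀ : V) :
    ∃ ε > 0, ∃ N : Set V, IsOpen N ∧ x₀ ∈ N ∧ ∃ φ : ℝ × V → V,
      ContDiffOn ℝ ∞ φ (Ioo (-ε) ε ×ˢ N) ∧ (∀ x ∈ N, φ (0, x) = x) ∧
      ∀ t ∈ Ioo (-ε) ε, ∀ x ∈ N, HasDerivAt (fun r ↦ φ (r, x)) (f (φ (t, x))) t := by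
  set W := C(Icc (-1 : ℝ) 1, V)
  -- Keeping the parameters as a component turns the implicit function theorem for
  -- `integralEquation` into the inverse function theorem for `Ψ`.
  set Ψ : (V × ℝ) × W → (V × ℝ) × W := fun z ↦ (z.1, integralEquation hf z) with hΨ
  have hΨs : ContDiff ℝ ∞ Ψ := contDiff_fst.prodMk (contDiff_integralEquation hf)
  set z₀ : (V × ℝ) × W := ((x₀, 0), constantCurve V x₀) with hz₀
  have hd := hasFDerivAt_integralEquation hf x₀
  set e := hΨs.contDiffAt.toOpenPartialHomeomorph Ψ hd (by simp) with he
  have hcoe : (e : (V × ℝ) × W → (V × ℝ) × W) = Ψ :=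
    hΨs.contDiffAt.toOpenPartialHomeomorph_coe hd (by simp)
  have hz₀e : z₀ ∈ e.source := hΨs.contDiffAt.mem_toOpenPartialHomeomorph_source hd (by simp)
  have hΨz₀ : Ψ z₀ = ((x₀, 0), 0) := by
    refine Prod.ext rfl ?_
    ext t
    simp [hΨ, hz₀, integralEquation_apply]
  -- The inverse must be smooth on a whole neighbourhood and not just at the image of `z₀`;
  -- therefore the target is cut down to the open set where the derivative of `Ψ` is still
  -- invertible.
  set Inv : Set (((V × ℝ) × W) →L[ℝ] ((V × ℝ) × W)) :=
    range ContinuousLinearEquiv.toContinuousLinearMap with hInv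
  have hInvO : IsOpen Inv := ContinuousLinearEquiv.isOpen
  set Ω : Set ((V × ℝ) × W) := e.target ∩ e.symm ⁻¹' (fderiv ℝ Ψ ⁻¹' Inv) with hΩ
  have hΩo : IsOpen Ω :=
    e.symm.isOpen_inter_preimage (hInvO.preimage (hΨs.continuous_fderiv (by simp)))
  have hsymm₀ : e.symm ((x₀, 0), 0) = z₀ := by rw [← hΨz₀, ← hcoe, e.left_inv hz₀e]
  have hmem₀ : ((x₀, (0 : ℝ)), (0 : W)) ∈ Ω := by
    refine ⟨?_, ?_⟩
    · rw [← hΨz₀, ← hcoe]; exact e.map_source hz₀e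
    · rw [mem_preimage, mem_preimage, hsymm₀, hd.fderiv]; exact ⟨_, rfl⟩
  have hsm : ∀ w ∈ Ω, ContDiffAt ℝ ∞ e.symm w := by
    rintro w ⟨hw, ⟨L, hL⟩⟩
    refine e.contDiffAt_symm (f₀' := L) hw ?_ ?_
    · rw [hcoe, hL]; exact ((hΨs.differentiable (by simp)) _).hasFDerivAt
    · rw [hcoe]; exact hΨs.contDiffAt
  set A : V × ℝ → W := fun q ↦ (e.symm (q, 0)).2 with hA
  set B : Set (V × ℝ) := {q | (q, (0 : W)) ∈ Ω} with hB
  have hBo : IsOpen B := hΩo.preimage (by fun_prop)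
  have hAs : ∀ q ∈ B, ContDiffAt ℝ ∞ A q := fun q hq ↦
    ((hsm _ hq).comp q (contDiffAt_id.prodMk contDiffAt_const)).snd
  have hAe : ∀ q ∈ B, e.symm (q, 0) = (q, A q) ∧ integralEquation hf (q, A q) = 0 := by
    intro q hq
    have h1 : Ψ (e.symm (q, 0)) = (q, 0) := by rw [← hcoe]; exact e.right_inv hq.1
    have h2 : e.symm (q, 0) = (q, A q) := 
      Prod.ext (show (e.symm (q, 0)).1 = q from congrArg Prod.fst h1) rfl
    refine ⟨h2, ?_⟩
    rw [h2] at h1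
    exact congrArg Prod.snd h1
  have hA₀ : A (x₀, 0) = constantCurve V x₀ := by rw [hA]; simp only; rw [hsymm₀]
  obtain ⟨r, hr, hrs⟩ := Metric.isOpen_iff.1 e.open_source z₀ hz₀e
  have hnear : ∀ᶠ q in 𝓝 (x₀, (0 : ℝ)), q ∈ B ∧ A q ∈ Metric.ball (constantCurve V x₀) r := by
    refine Filter.Eventually.and (hBo.mem_nhds hmem₀) ((hAs _ hmem₀).continuousAt ?_)
    rw [hA₀]; exact Metric.ball_mem_nhds _ hr
  obtain ⟨δ, hδ, hball⟩ := Metric.eventually_nhds_iff.1 hnear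
  set d := min δ r / 2 with hd_def
  have hd0 : 0 < d := by positivity
  have hdr : d < r := by have := min_le_right δ r; linarith
  have hdδ : d < δ := by have := min_le_left δ r; linarith
  have hgood : ∀ x ∈ Metric.ball x₀ d, ∀ s ∈ Icc (-d) d,
      (x, s) ∈ B ∧ A (x, s) ∈ Metric.ball (constantCurve V x₀) r := by
    intro x hx s hs
    refine hball ?_
    rw [Prod.dist_eq, max_lt_iff]
    refine ⟨(Metric.mem_ball.1 hx).trans hdδ, ?_⟩
    rw [Real.dist_eq, sub_zero]
    exact (abs_le.2 hs).trans_lt hdδ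
  -- Both curves solve the equation with the parameters `(x, d * σ)` and lie in the ball where `Ψ`
  -- is injective, so they coincide. Rescaling does not leave the ball, as it only uses values of
  -- the original curve.
  have hscale : ∀ x ∈ Metric.ball x₀ d, ∀ σ : Icc (-1 : ℝ) 1,
      A (x, d * σ) = rescale σ (A (x, d)) := by
    intro x hx σ
    have hds : d * σ ∈ Icc (-d) d := by
      constructor <;> nlinarith [σ.2.1, σ.2.2]
    obtain ⟨hB1, hb1⟩ := hgood x hx d ⟨by linarith, le_rfl⟩
    obtain ⟨hB2, hb2⟩ := hgood x hx _ hds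
    have h1 : integralEquation hf ((x, d * σ), rescale σ (A (x, d))) = 0 :=
      integralEquation_rescale hf (hAe _ hB1).2 σ
    have h2 : integralEquation hf ((x, d * σ), A (x, d * σ)) = 0 := (hAe _ hB2).2
    have hsrc : ∀ β ∈ Metric.ball (constantCurve V x₀) r, ((x, d * (σ : ℝ)), β) ∈ e.source := by
      intro β hβ
      refine hrs ?_
      rw [Metric.mem_ball, Prod.dist_eq, Prod.dist_eq]
      refine max_lt (max_lt ((Metric.mem_ball.1 hx).trans hdr) ?_) hβ
      rw [Real.dist_eq, sub_zero]
      exact (abs_le.2 hds).trans_lt hdr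
    have hres : rescale σ (A (x, d)) ∈ Metric.ball (constantCurve V x₀) r := by
      rw [Metric.mem_ball] at hb1 ⊢
      refine lt_of_le_of_lt ((ContinuousMap.dist_le dist_nonneg).2 fun t ↦ ?_) hb1
      exact ContinuousMap.dist_apply_le_dist (f := A (x, d)) (g := constantCurve V x₀) _
    have h3 := e.injOn (hsrc _ hb2) (hsrc _ hres) (by
      rw [hcoe]; simp only [hΨ]; rw [h1, h2])
    exact congrArg Prod.snd h3
  -- The solution with rate `t` reaches at parameter `1` the point that the flow reaches at time
  -- `t`; thus smoothness in `t` is smoothness in a parameter.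
  refine ⟨d, hd0, Metric.ball x₀ d, Metric.isOpen_ball, Metric.mem_ball_self hd0,
    fun z ↦ A (z.2, z.1) ⟨1, by norm_num⟩, ?_, ?_, ?_⟩
  · rintro ⟨t, x⟩ ⟨ht, hx⟩
    have h1 : ContDiffAt ℝ ∞ (fun z : ℝ × V ↦ A (z.2, z.1)) (t, x) :=
      ContDiffAt.comp (g := A) (f := fun z : ℝ × V ↦ (z.2, z.1)) (t, x)
        (hAs _ (hgood x hx t (Ioo_subset_Icc_self ht)).1)
        (contDiffAt_snd.prodMk contDiffAt_fst)
    exact ((ContinuousMap.evalCLM ℝ (⟨1, by norm_num⟩ : Icc (-1 : ℝ) 1)).contDiff.contDiffAt.comp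
      (t, x) h1).contDiffWithinAt
  · intro x hx
    have h1 := (hAe _ (hgood x hx 0 ⟨by linarith, hd0.le⟩).1).2
    have h2 := congrArg (fun β ↦ β (⟨1, by norm_num⟩ : Icc (-1 : ℝ) 1)) h1
    simp only [integralEquation_apply, zero_smul, sub_zero, ContinuousMap.zero_apply] at h2
    exact sub_eq_zero.1 h2
  · intro t ht x hx
    have hmem : ∀ r ∈ Ioo (-d) d, r / d ∈ Ioo (-1 : ℝ) 1 := by
      intro r hr
      constructor
      · rw [lt_div_iff₀ hd0]; linarith [hr.1]
      · rw [div_lt_iff₀ hd0]; linarith [hr.2]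
    have heq : ∀ r (hr : r ∈ Ioo (-d) d), A (x, r) ⟨1, by norm_num⟩ =
        IccExtend (by norm_num) (A (x, d)) (r / d) := by
      intro r hr
      have h1 := hscale x hx ⟨r / d, Ioo_subset_Icc_self (hmem r hr)⟩
      rw [show d * (r / d) = r by field_simp] at h1
      rw [h1, IccExtend_of_mem _ _ (Ioo_subset_Icc_self (hmem r hr))]
      exact congrArg (A (x, d)) (Subtype.ext (mul_one _))
    have h2 := hasDerivAt_of_integralEquation hf
      (hAe _ (hgood x hx d ⟨by linarith, le_rfl⟩).1).2 (hmem t ht)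
    have h3 := h2.scomp t ((hasDerivAt_id t).div_const d)
    rw [← IccExtend_of_mem (by norm_num) (A (x, d)) (Ioo_subset_Icc_self (hmem t ht)),
      ← heq t ht, smul_smul, show (1 / d * d : ℝ) = 1 by field_simp, one_smul] at h3
    refine h3.congr_of_eventuallyEq ?_
    filter_upwards [isOpen_Ioo.mem_nhds ht] with r hr
    exact heq r hr

/-- A smooth vector field on an open set has a smooth local flow. -/
theorem exists_smooth_local_flow [FiniteDimensional ℝ V] {f : V → V} {U : Set V} (hU : IsOpen U)
    (hf : ContDiffOn ℝ ∞ f U) {x₀ : V} (hx₀ : x₀ ∈ U) :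
    ∃ ε > 0, ∃ N : Set V, IsOpen N ∧ x₀ ∈ N ∧ ∃ φ : ℝ × V → V,
      ContDiffOn ℝ ∞ φ (Ioo (-ε) ε ×ˢ N) ∧ (∀ x ∈ N, φ (0, x) = x) ∧
      ∀ t ∈ Ioo (-ε) ε, ∀ x ∈ N, φ (t, x) ∈ U ∧
        HasDerivAt (fun r ↦ φ (r, x)) (f (φ (t, x))) t := by
  have := FiniteDimensional.complete ℝ V
  obtain ⟨R, hR, hRU⟩ := Metric.isOpen_iff.1 hU x₀ hx₀
  -- The cut-off field is globally smooth and equals `f` on the ball of radius `R / 4`, which short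
  -- trajectories starting near `x₀` do not leave.
  let b : ContDiffBump x₀ := ⟨R / 4, R / 2, by positivity, by linarith⟩
  have hsm : ContDiff ℝ ∞ (fun x ↦ b x • f x) := by
    rw [contDiff_iff_contDiffAt]
    intro x
    by_cases hx : x ∈ Metric.ball x₀ R
    · exact b.contDiff.contDiffAt.smul (hf.contDiffAt (hU.mem_nhds (hRU hx)))
    · refine (contDiffAt_const (c := (0 : V))).congr_of_eventuallyEq ?_
      have : x ∈ (Metric.closedBall x₀ (R / 2))ᶜ := by
        simp only [mem_compl_iff, Metric.mem_closedBall, Metric.mem_ball, not_lt, not_le] at hx ⊢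
        linarith
      filter_upwards [Metric.isClosed_closedBall.isOpen_compl.mem_nhds this] with y hy
      rw [b.zero_of_le_dist, zero_smul]
      simp only [mem_compl_iff, Metric.mem_closedBall, not_le] at hy
      exact hy.le
  obtain ⟨ε, hε, N, hN, hxN, φ, hφ, hφ0, hφd⟩ := exists_smooth_local_flow_of_contDiff hsm x₀
  have hcont : ContinuousAt φ (0, x₀) :=
    (hφ.contDiffAt ((isOpen_Ioo.prod hN).mem_nhds ⟨⟨by linarith, hε⟩, hxN⟩)).continuousAt
  have hev : ∀ᶠ z in 𝓝 (0, x₀), φ z ∈ Metric.ball x₀ (R / 4) := by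
    refine hcont ?_
    rw [hφ0 x₀ hxN]
    exact Metric.ball_mem_nhds _ (by positivity)
  rw [nhds_prod_eq] at hev
  obtain ⟨P, hP, Q, hQ, hPQ⟩ := eventually_prod_iff.1 hev
  obtain ⟨δ, hδ, hδP⟩ := Metric.eventually_nhds_iff.1 hP
  obtain ⟨N', hN'Q, hN', hxN'⟩ := eventually_nhds_iff.1 hQ
  refine ⟨min ε δ, lt_min hε hδ, N ∩ N', hN.inter hN', ⟨hxN, hxN'⟩, φ, ?_, ?_, ?_⟩
  · refine hφ.mono (prod_mono (Ioo_subset_Ioo ?_ (min_le_left _ _)) inter_subset_left)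
    exact neg_le_neg (min_le_left _ _)
  · exact fun x hx ↦ hφ0 x hx.1
  · intro t ht x hx
    have ht' : |t| < min ε δ := abs_lt.2 ht
    have h1 := hPQ (hδP (y := t) (by
      rw [Real.dist_eq, sub_zero]; exact ht'.trans_le (min_le_right _ _))) (hN'Q x hx.2)
    have h2 := hφd t (abs_lt.1 (ht'.trans_le (min_le_left _ _))) x hx.1
    rw [b.one_of_mem_closedBall (Metric.ball_subset_closedBall h1), one_smul] at h2
    exact ⟨hRU (Metric.ball_subset_ball (by linarith) h1), h2⟩

end Flow

end

end LorentzGeom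

namespace LorentzGeom

noncomputable section

/-! ### The profile that rounds off the corner -/

section Profile

lemma smoothTransition_symm (x : ℝ) :
    Real.smoothTransition x + Real.smoothTransition (1 - x) = 1 := by
  have h := (Real.smoothTransition.pos_denom x).ne'
  unfold Real.smoothTransition
  rw [sub_sub_cancel, add_comm (expNegInvGlue (1 - x)), ← add_div, div_self h]

/-- A smoothing `h` of the function `min τ 0` with derivative `k`. -/
lemma exists_smoothing_profile : ∃ k h : ℝ → ℝ, ContDiff ℝ ∞ k ∧ ContDiff ℝ ∞ h ∧
    (∀ τ, HasDerivAt h (k τ) τ) ∧ (∀ τ ≤ -1, k τ = 1 ∧ h τ = τ) ∧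
    (∀ τ, 1 ≤ τ → k τ = 0 ∧ h τ = 0) ∧ ∫ τ in (-1 : ℝ)..1, k τ ^ 2 < 1 := by
  set k : ℝ → ℝ := fun τ ↦ Real.smoothTransition ((1 - τ) / 2) with hk
  have hks : ContDiff ℝ ∞ k := Real.smoothTransition.contDiff.comp (by fun_prop)
  have hkc : Continuous k := hks.continuous
  have hki : ∀ a b, IntervalIntegrable k MeasureTheory.volume a b := fun a b ↦
    hkc.intervalIntegrable a b
  have hk1 : ∀ τ ≤ -1, k τ = 1 := fun τ hτ ↦
    Real.smoothTransition.one_of_one_le (by linarith)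
  have hk0 : ∀ τ, 1 ≤ τ → k τ = 0 := fun τ hτ ↦
    Real.smoothTransition.zero_of_nonpos (by linarith)
  have hsym : ∀ τ, k τ + k (-τ) = 1 := by
    intro τ
    have := smoothTransition_symm ((1 - τ) / 2)
    rw [show 1 - (1 - τ) / 2 = (1 - -τ) / 2 by ring] at this
    exact this
  have hint : ∫ τ in (-1 : ℝ)..1, k τ = 1 := by
    have h1 : ∫ τ in (-1 : ℝ)..1, k (-τ) = ∫ τ in (-1 : ℝ)..1, k τ := by simp
    have h2 : ∫ τ in (-1 : ℝ)..1, (k τ + k (-τ)) = 2 := by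
      simp_rw [hsym]; norm_num
    rw [intervalIntegral.integral_add (g := fun τ ↦ k (-τ)) (hki _ _)
      ((hkc.comp continuous_neg).intervalIntegrable _ _), h1] at h2
    linarith
  -- Integrating from `1` makes `h` vanish to the right of `1`. Since `k` has integral `1` on `[-1,
  -- 1]`, `h (-1) = -1`, and the slope `1` to the left of `-1` gives `h τ = τ` there.
  set h : ℝ → ℝ := fun τ ↦ (∫ r in (1 : ℝ)..τ, k r) with hh
  have hd : ∀ τ, HasDerivAt h (k τ) τ := fun τ ↦ (hkc.integral_hasStrictDerivAt 1 τ).hasDerivAt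
  have hhs : ContDiff ℝ ∞ h := by
    rw [contDiff_infty_iff_deriv]
    refine ⟨fun τ ↦ (hd τ).differentiableAt, ?_⟩
    rwa [show deriv h = k from funext fun τ ↦ (hd τ).deriv]
  refine ⟨k, h, hks, hhs, hd, fun τ hτ ↦ ⟨hk1 τ hτ, ?_⟩, fun τ hτ ↦ ⟨hk0 τ hτ, ?_⟩, ?_⟩
  · have h1 : ∫ r in (1 : ℝ)..(-1), k r = -1 := by rw [intervalIntegral.integral_symm, hint]
    have h2 : ∫ r in (-1 : ℝ)..τ, k r = ∫ r in (-1 : ℝ)..τ, (1 : ℝ) := by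
      refine intervalIntegral.integral_congr fun r hr ↦ hk1 r ?_
      rw [uIcc_of_ge hτ] at hr
      exact hr.2
    simp only [hh]
    rw [← intervalIntegral.integral_add_adjacent_intervals (hki 1 (-1)) (hki (-1) τ), h1, h2]
    simp
  · have h2 : ∫ r in (1 : ℝ)..τ, k r = ∫ r in (1 : ℝ)..τ, (0 : ℝ) := by
      refine intervalIntegral.integral_congr fun r hr ↦ hk0 r ?_
      rw [uIcc_of_le hτ] at hr
      exact hr.1
    simp only [hh]
    rw [h2]
    simp
  -- Pointwise `k ^ 2 ≤ k`, strictly at `0`, where the symmetry gives `k 0 = 1 / 2`.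
  · refine lt_of_lt_of_eq ?_ hint
    refine intervalIntegral.integral_lt_integral_of_continuousOn_of_le_of_exists_lt
      (f := fun τ ↦ k τ ^ 2) (by norm_num)
      (hkc.pow 2).continuousOn hkc.continuousOn (fun τ _ ↦ ?_) ⟨0, by norm_num, ?_⟩
    · have h1 : 0 ≤ k τ := Real.smoothTransition.nonneg _
      have h2 : k τ ≤ 1 := Real.smoothTransition.le_one _
      nlinarith
    · have h1 := hsym 0
      rw [neg_zero] at h1
      nlinarith

end Profile

/-! ### Second-order growth of an integral of square roots -/

section Taylor

lemma le_taylor_of_le_second_deriv {φ φ' φ'' : ℝ → ℝ} {u A : ℝ} (hu : 0 ≤ u)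
    (h1 : ∀ v ∈ Icc 0 u, HasDerivAt φ (φ' v) v) (h2 : ∀ v ∈ Icc 0 u, HasDerivAt φ' (φ'' v) v)
    (h0 : φ' 0 = 0) (hA : ∀ v ∈ Icc 0 u, A ≤ φ'' v) : φ 0 + A * u ^ 2 / 2 ≤ φ u := by
  have m1 : MonotoneOn (fun v ↦ φ' v - A * v) (Icc 0 u) := by
    refine monotoneOn_of_hasDerivWithinAt_nonneg (f' := fun v ↦ φ'' v - A) (convex_Icc _ _)
      (fun v hv ↦ ?_) (fun v hv ↦ ?_) fun v hv ↦ ?_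
    · exact ((h2 v hv).continuousAt.sub (by fun_prop)).continuousWithinAt
    · have hv' := interior_subset hv
      exact ((h2 v hv').sub (by simpa using (hasDerivAt_id v).const_mul A)).hasDerivWithinAt
    · exact sub_nonneg.2 (hA v (interior_subset hv))
  have m2 : MonotoneOn (fun v ↦ φ v - A * v ^ 2 / 2) (Icc 0 u) := by
    refine monotoneOn_of_hasDerivWithinAt_nonneg (f' := fun v ↦ φ' v - A * v) (convex_Icc _ _)
      (fun v hv ↦ ?_) (fun v hv ↦ ?_) fun v hv ↦ ?_
    · exact ((h1 v hv).continuousAt.sub (by fun_prop)).continuousWithinAt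
    · have hv' := interior_subset hv
      have h3 : HasDerivAt (fun v : ℝ ↦ A * v ^ 2 / 2) (A * v) v := by
        have := (((hasDerivAt_id v).pow 2).const_mul A).div_const 2
        refine this.congr_deriv ?_
        simp; ring
      exact ((h1 v hv').sub h3).hasDerivWithinAt
    · have hv' := interior_subset hv
      have := m1 (left_mem_Icc.2 hu) hv' hv'.1
      simp only [h0, mul_zero, sub_zero] at this
      exact this
  have := m2 (left_mem_Icc.2 hu) (right_mem_Icc.2 hu) hu
  simp only at this
  nlinarith

/-- The left side factors as `(1 + x) * (1 - x / 2)`. The generous quadratic coefficient `1 / 2`, in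
place of the `1 / 8` of the Taylor expansion, makes the bound hold for every `x ≥ -1`. -/
lemma one_add_half_sub_le_sqrt {x : ℝ} (hx : -1 ≤ x) : 1 + x / 2 - x ^ 2 / 2 ≤ √(1 + x) := by
  rcases le_total (1 + x / 2 - x ^ 2 / 2) 0 with h | h
  · exact h.trans (Real.sqrt_nonneg _)
  · refine Real.le_sqrt_of_sq_le ?_
    have hx2 : x ≤ 2 := by nlinarith
    have e : 1 + x / 2 - x ^ 2 / 2 = (1 + x) * (1 - x / 2) := by ring
    rw [e]
    have h1 : (1 + x) * (1 - x / 2) ^ 2 ≤ 1 := by nlinarith [mul_nonneg (sq_nonneg x) (by linarith : (0 : ℝ) ≤ 3 - x)]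
    nlinarith

/-- The derivative in the first variable. -/
def dt {W : Type*} [NormedAddCommGroup W] [NormedSpace ℝ W] (F : ℝ × ℝ → W) (p : ℝ × ℝ) : W :=
  fderiv ℝ F p (1, 0)

/-- The derivative in the second variable. -/
def du {W : Type*} [NormedAddCommGroup W] [NormedSpace ℝ W] (F : ℝ × ℝ → W) (p : ℝ × ℝ) : W :=
  fderiv ℝ F p (0, 1)

variable {W : Type*} [NormedAddCommGroup W] [NormedSpace ℝ W] {F : ℝ × ℝ → W} {R : Set (ℝ × ℝ)}

lemma contDiffOn_dt (hR : IsOpen R) (hF : ContDiffOn ℝ ∞ F R) : ContDiffOn ℝ ∞ (dt F) R :=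
  (hF.fderiv_of_isOpen hR (by simp)).clm_apply contDiffOn_const

lemma contDiffOn_du (hR : IsOpen R) (hF : ContDiffOn ℝ ∞ F R) : ContDiffOn ℝ ∞ (du F) R :=
  (hF.fderiv_of_isOpen hR (by simp)).clm_apply contDiffOn_const

lemma differentiableAt_of_contDiffOn {V : Type*} [NormedAddCommGroup V] [NormedSpace ℝ V]
    {f : V → W} {U : Set V} (hU : IsOpen U) (hf : ContDiffOn ℝ ∞ f U) {x : V} (hx : x ∈ U) :
    DifferentiableAt ℝ f x :=
  (hf.contDiffAt (hU.mem_nhds hx)).differentiableAt (by simp)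

lemma hasDerivAt_dt {p : ℝ × ℝ} (hF : DifferentiableAt ℝ F p) :
    HasDerivAt (fun t ↦ F (t, p.2)) (dt F p) p.1 := by
  have h : HasDerivAt (fun t : ℝ ↦ (t, p.2)) ((1 : ℝ), (0 : ℝ)) p.1 :=
    (hasDerivAt_id p.1).prodMk (hasDerivAt_const p.1 p.2)
  exact HasFDerivAt.comp_hasDerivAt p.1 (f := fun t : ℝ ↦ (t, p.2)) hF.hasFDerivAt h

lemma hasDerivAt_du {p : ℝ × ℝ} (hF : DifferentiableAt ℝ F p) :
    HasDerivAt (fun u ↦ F (p.1, u)) (du F p) p.2 := by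
  have h : HasDerivAt (fun u : ℝ ↦ (p.1, u)) ((0 : ℝ), (1 : ℝ)) p.2 :=
    (hasDerivAt_const p.2 p.1).prodMk (hasDerivAt_id p.2)
  exact HasFDerivAt.comp_hasDerivAt p.2 (f := fun u : ℝ ↦ (p.1, u)) hF.hasFDerivAt h

lemma dt_du_comm (hR : IsOpen R) (hF : ContDiffOn ℝ ∞ F R) {p : ℝ × ℝ} (hp : p ∈ R) :
    dt (du F) p = du (dt F) p := by
  have hs := (hF.contDiffAt (hR.mem_nhds hp)).isSymmSndFDerivAt (n := ∞)
    (by simp [minSmoothness_of_isRCLikeNormedField]; exact WithTop.coe_le_coe.2 (le_top : (2 : ℕ∞) ≤ ⊤))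
  have hd : DifferentiableAt ℝ (fderiv ℝ F) p :=
    differentiableAt_of_contDiffOn hR (hF.fderiv_of_isOpen hR (m := ∞) (by simp)) hp
  have h1 : ∀ v : ℝ × ℝ, fderiv ℝ (fun q ↦ fderiv ℝ F q v) p =
      (fderiv ℝ (fderiv ℝ F) p).flip v := fun v ↦ by
    rw [fderiv_clm_apply hd (differentiableAt_const v)]
    simp
  unfold dt du
  rw [h1, h1]
  exact hs _ _

/-- If the second derivative in `u` of `f (t, u)` at `u = 0` has positive integral, the integral of
the square root of `f (t, u)` increases with `u`. -/
lemma eventually_lt_integral_sqrt {f : ℝ × ℝ → ℝ} (hR : IsOpen R) (hf : ContDiffOn ℝ ∞ f R)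
    {a b κ : ℝ} (hab : a < b) (hκ : 0 < κ) (hsub : ∀ t ∈ Icc a b, (t, (0 : ℝ)) ∈ R)
    (h0 : ∀ t ∈ Icc a b, f (t, 0) = κ) (h1 : ∀ t ∈ Icc a b, du f (t, 0) = 0)
    (h2 : 0 < ∫ t in a..b, du (du f) (t, 0)) :
    ∀ᶠ u in 𝓝[>] (0 : ℝ), (∀ t ∈ Icc a b, (t, u) ∈ R ∧ 0 < f (t, u)) ∧
      (b - a) * √κ < ∫ t in a..b, √(f (t, u)) := by
  have hfu := contDiffOn_du hR hf
  have hfuu := contDiffOn_du hR hfu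
  set m := ∫ t in a..b, du (du f) (t, 0) with hm
  -- The allowed oscillation of the second derivative: over `[a, b]` it costs `m / 2`, half of the
  -- available gain.
  set η := m / (2 * (b - a)) with hη
  have hba : 0 < b - a := sub_pos.2 hab
  have hη0 : 0 < η := by positivity
  have hline : ContinuousOn (fun t : ℝ ↦ du (du f) (t, 0)) (Icc a b) :=
    hfuu.continuousOn.comp (by fun_prop) hsub
  obtain ⟨C₀, hC₀⟩ := isCompact_Icc.exists_bound_of_continuousOn hline
  set C := |C₀| + η with hC
  have hCpos : 0 < C := by positivity
  have htube : ∀ᶠ u in 𝓝 (0 : ℝ), ∀ t ∈ Icc a b, (t, u) ∈ R ∧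
      |du (du f) (t, u) - du (du f) (t, 0)| < η := by
    refine isCompact_Icc.eventually_forall_of_forall_eventually fun t ht ↦ ?_
    have hc : ContinuousAt (fun z : ℝ × ℝ ↦ (z.2, z.1)) (0, t) := by fun_prop
    have hc0 : ContinuousAt (fun z : ℝ × ℝ ↦ (z.2, (0 : ℝ))) (0, t) := by fun_prop
    have hRt : R ∈ 𝓝 ((t, 0) : ℝ × ℝ) := hR.mem_nhds (hsub t ht)
    have hcf : ContinuousAt (du (du f)) (t, 0) := hfuu.continuousOn.continuousAt hRt
    have hd1 : ContinuousAt (fun z : ℝ × ℝ ↦ du (du f) (z.2, z.1)) (0, t) :=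
      ContinuousAt.comp (g := du (du f)) (f := fun z : ℝ × ℝ ↦ (z.2, z.1)) hcf hc
    have hd2 : ContinuousAt (fun z : ℝ × ℝ ↦ du (du f) (z.2, 0)) (0, t) :=
      ContinuousAt.comp (g := du (du f)) (f := fun z : ℝ × ℝ ↦ (z.2, (0 : ℝ))) hcf hc0
    have hd : ContinuousAt (fun z : ℝ × ℝ ↦
        |du (du f) (z.2, z.1) - du (du f) (z.2, 0)|) (0, t) := (hd1.sub hd2).abs
    refine (hc.eventually hRt).and (hd.eventually (gt_mem_nhds ?_))
    simpa using hη0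
  obtain ⟨r, hr, hball⟩ := Metric.eventually_nhds_iff.1 htube
  -- The last condition says that the error of order `u ^ 4` from the square root is less than the
  -- remaining gain of order `u ^ 2`; it is obtained by dividing by `u ^ 2` first.
  have hsmall : ∀ᶠ u in 𝓝[>] (0 : ℝ), 0 < u ∧ u < r ∧ C * u ^ 2 < κ ∧
      (b - a) * (√κ * ((C * u ^ 2 / (2 * κ)) ^ 2 / 2)) < u ^ 2 * (m / (8 * √κ)) := by
    have e1 : ∀ᶠ u in 𝓝 (0 : ℝ), u < r := gt_mem_nhds hr
    have e2 : ∀ᶠ u in 𝓝 (0 : ℝ), C * u ^ 2 < κ := by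
      have : ContinuousAt (fun u : ℝ ↦ C * u ^ 2) 0 := by fun_prop
      exact this.eventually (gt_mem_nhds (by simpa using hκ))
    have e3 : ∀ᶠ u in 𝓝 (0 : ℝ), (b - a) * (√κ * ((C / (2 * κ)) ^ 2 * u ^ 2 / 2)) <
        m / (8 * √κ) := by
      have : ContinuousAt (fun u : ℝ ↦ (b - a) * (√κ * ((C / (2 * κ)) ^ 2 * u ^ 2 / 2))) 0 := by
        fun_prop
      refine this.eventually (gt_mem_nhds ?_)
      simp only [ne_eq, OfNat.ofNat_ne_zero, not_false_eq_true, zero_pow, mul_zero, zero_div]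
      positivity
    filter_upwards [self_mem_nhdsWithin, nhdsWithin_le_nhds e1, nhdsWithin_le_nhds e2,
      nhdsWithin_le_nhds e3] with u hu0 hu1 hu2 hu3
    have hu : (0 : ℝ) < u := hu0
    refine ⟨hu, hu1, hu2, ?_⟩
    have := mul_lt_mul_of_pos_left hu3 (pow_pos hu 2)
    refine lt_of_eq_of_lt ?_ this
    field_simp
  filter_upwards [hsmall] with u ⟨hu, hur, huC, hu4⟩
  have hin : ∀ v ∈ Icc 0 u, ∀ t ∈ Icc a b, (t, v) ∈ R ∧
      |du (du f) (t, v) - du (du f) (t, 0)| < η := fun v hv ↦ hball (by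
    rw [Real.dist_eq, sub_zero, abs_of_nonneg hv.1]; exact hv.2.trans_lt hur)
  have hder1 : ∀ t ∈ Icc a b, ∀ v ∈ Icc 0 u, HasDerivAt (fun v ↦ f (t, v)) (du f (t, v)) v :=
    fun t ht v hv ↦ hasDerivAt_du (p := (t, v))
      (differentiableAt_of_contDiffOn hR hf (hin v hv t ht).1)
  have hder2 : ∀ t ∈ Icc a b, ∀ v ∈ Icc 0 u,
      HasDerivAt (fun v ↦ du f (t, v)) (du (du f) (t, v)) v :=
    fun t ht v hv ↦ hasDerivAt_du (p := (t, v))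
      (differentiableAt_of_contDiffOn hR hfu (hin v hv t ht).1)
  have hlow : ∀ t ∈ Icc a b, κ + (du (du f) (t, 0) - η) * u ^ 2 / 2 ≤ f (t, u) := by
    intro t ht
    have := le_taylor_of_le_second_deriv hu.le (hder1 t ht) (hder2 t ht) (h1 t ht)
      (A := du (du f) (t, 0) - η) fun v hv ↦ by
        have := (abs_lt.1 (hin v hv t ht).2).1
        linarith
    rwa [h0 t ht] at this
  have hbd0 : ∀ t ∈ Icc a b, |du (du f) (t, 0)| ≤ |C₀| := fun t ht ↦
    (hC₀ t ht).trans (le_abs_self _)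
  have hlow' : ∀ t ∈ Icc a b, κ - C * u ^ 2 / 2 ≤ f (t, u) := by
    intro t ht
    refine le_trans ?_ (hlow t ht)
    have := (abs_le.1 (hbd0 t ht)).1
    nlinarith [sq_nonneg u]
  -- The upper bound is the lower Taylor bound applied to `-f`.
  have hup' : ∀ t ∈ Icc a b, f (t, u) ≤ κ + C * u ^ 2 / 2 := by
    intro t ht
    have := le_taylor_of_le_second_deriv hu.le (fun v hv ↦ (hder1 t ht v hv).neg)
      (fun v hv ↦ (hder2 t ht v hv).neg) (by simp [h1 t ht]) (A := -C) fun v hv ↦ by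
        have h3 := (abs_lt.1 (hin v hv t ht).2).2
        have h4 := (abs_le.1 (hbd0 t ht)).2
        linarith
    simp only [Pi.neg_apply, h0 t ht] at this
    linarith
  have hpos : ∀ t ∈ Icc a b, 0 < f (t, u) := fun t ht ↦ by
    have := hlow' t ht
    linarith
  refine ⟨fun t ht ↦ ⟨(hin u ⟨hu.le, le_rfl⟩ t ht).1, hpos t ht⟩, ?_⟩
  have hκs : 0 < √κ := Real.sqrt_pos.2 hκ
  have hκκ : √κ * √κ = κ := Real.mul_self_sqrt hκ.le
  have hpt : ∀ t ∈ Icc a b, √κ + (du (du f) (t, 0) - η) * (u ^ 2 / (4 * √κ)) -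
      √κ * ((C * u ^ 2 / (2 * κ)) ^ 2 / 2) ≤ √(f (t, u)) := by
    intro t ht
    set x := (f (t, u) - κ) / κ with hx
    have hfx : f (t, u) = κ * (1 + x) := by rw [hx]; field_simp; ring
    have hx1 : -1 ≤ x := by rw [hx, le_div_iff₀ hκ]; linarith [hpos t ht]
    have hxa : |x| ≤ C * u ^ 2 / (2 * κ) := by
      rw [hx, abs_div, abs_of_pos hκ, div_le_iff₀ hκ]
      rw [show C * u ^ 2 / (2 * κ) * κ = C * u ^ 2 / 2 by field_simp, abs_le]
      constructor <;> linarith [hlow' t ht, hup' t ht]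
    have hx2 : x ^ 2 ≤ (C * u ^ 2 / (2 * κ)) ^ 2 := sq_le_sq.2 (hxa.trans (le_abs_self _))
    rw [hfx, Real.sqrt_mul hκ.le]
    have h3 := mul_le_mul_of_nonneg_left (one_add_half_sub_le_sqrt hx1) hκs.le
    refine le_trans ?_ h3
    have h4 : (du (du f) (t, 0) - η) * (u ^ 2 / (4 * √κ)) ≤ √κ * (x / 2) := by
      have h5 : (du (du f) (t, 0) - η) * u ^ 2 / 2 ≤ κ * x := by
        have := hlow t ht
        rw [hfx] at this
        linarith
      have h6 : √κ * (x / 2) = κ * x / (2 * √κ) := by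
        rw [eq_div_iff (by positivity)]; linear_combination x * hκκ
      rw [h6, le_div_iff₀ (by positivity)]
      refine le_trans (le_of_eq ?_) h5
      field_simp
      ring
    nlinarith
  have hcontf : ContinuousOn (fun t ↦ √(f (t, u))) (uIcc a b) := by
    rw [uIcc_of_le hab.le]
    exact (hf.continuousOn.comp (by fun_prop)
      fun t ht ↦ (hin u ⟨hu.le, le_rfl⟩ t ht).1).sqrt
  have hint := hline
  rw [← uIcc_of_le hab.le] at hint
  have hI := hint.intervalIntegrable (μ := MeasureTheory.volume)
  have hI2 : IntervalIntegrable (fun t ↦ (du (du f) (t, 0) - η) * (u ^ 2 / (4 * √κ)))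
      MeasureTheory.volume a b := (hI.sub intervalIntegrable_const).mul_const _
  have hmono := intervalIntegral.integral_mono_on hab.le
    (((intervalIntegrable_const (c := √κ)).add hI2).sub
      (intervalIntegrable_const (c := √κ * ((C * u ^ 2 / (2 * κ)) ^ 2 / 2))))
    hcontf.intervalIntegrable hpt
  refine lt_of_lt_of_le ?_ hmono
  rw [intervalIntegral.integral_sub (intervalIntegrable_const.add hI2) intervalIntegrable_const,
    intervalIntegral.integral_add intervalIntegrable_const hI2,
    intervalIntegral.integral_mul_const, intervalIntegral.integral_sub hI intervalIntegrable_const]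
  simp only [intervalIntegral.integral_const, smul_eq_mul]
  rw [← hm, show (b - a) * η = m / 2 by rw [hη]; field_simp]
  have h7 : (m - m / 2) * (u ^ 2 / (4 * √κ)) = u ^ 2 * (m / (8 * √κ)) := by
    field_simp; ring
  rw [h7]
  linarith

end Taylor

end

end LorentzGeom

namespace LorentzGeom

noncomputable section


/-! ### First and second variation of the energy in coordinates -/

section SecondVariation

variable {E : Type*} [NormedAddCommGroup E] [NormedSpace ℝ E]

lemma fderiv_bilin_apply {X : Type*} [NormedAddCommGroup X] [NormedSpace ℝ X]
    {B : X → E →L[ℝ] E →L[ℝ] ℝ} {a b : X → E} {p : X} (hB : DifferentiableAt ℝ B p)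
    (ha : DifferentiableAt ℝ a p) (hb : DifferentiableAt ℝ b p) (w : X) :
    fderiv ℝ (fun q ↦ B q (a q) (b q)) p w =
      fderiv ℝ B p w (a p) (b p) + B p (fderiv ℝ a p w) (b p) + B p (a p) (fderiv ℝ b p w) := by
  rw [fderiv_clm_apply (hB.clm_apply ha) hb, fderiv_clm_apply hB ha]
  simp
  ring

lemma hasDerivAt_bilin_apply {B : ℝ → E →L[ℝ] E →L[ℝ] ℝ} {a b : ℝ → E} {t : ℝ}
    {B' : E →L[ℝ] E →L[ℝ] ℝ} {a' b' : E} (hB : HasDerivAt B B' t)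
    (ha : HasDerivAt a a' t) (hb : HasDerivAt b b' t) :
    HasDerivAt (fun r ↦ B r (a r) (b r)) (B' (a t) (b t) + B t a' (b t) + B t (a t) b') t := by
  refine ((hB.clm_apply ha).clm_apply hb).congr_deriv ?_
  simp

variable {G : E → E →L[ℝ] E →L[ℝ] ℝ} {U : Set E}

lemma fderiv_metric_symm (hU : IsOpen U) (hG : ContDiffOn ℝ ∞ G U)
    (hs : ∀ z ∈ U, ∀ v w, G z v w = G z w v) {z : E} (hz : z ∈ U) (x v w : E) :
    fderiv ℝ G z x v w = fderiv ℝ G z x w v := by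
  have hd := differentiableAt_of_contDiffOn hU hG hz
  have h1 : ∀ v w : E, fderiv ℝ (fun q ↦ G q v w) z x = fderiv ℝ G z x v w := fun v w ↦ by
    rw [fderiv_bilin_apply hd (differentiableAt_const v) (differentiableAt_const w)]
    simp
  rw [← h1 v w, ← h1 w v]
  have : (fun q ↦ G q v w) =ᶠ[𝓝 z] fun q ↦ G q w v := by
    filter_upwards [hU.mem_nhds hz] with q hq using hs q hq v w
  rw [this.fderiv_eq]

/-- The integrand of the second variation of the energy. -/
def indexIntegrand (G : E → E →L[ℝ] E →L[ℝ] ℝ) (z T X X' : E) : ℝ :=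
  G z X' X' + 2 * fderiv ℝ G z X X' T + fderiv ℝ (fderiv ℝ G) z X X T T / 2

lemma first_derivative_energy (hU : IsOpen U) (hG : ContDiffOn ℝ ∞ G U)
    (hs : ∀ z ∈ U, ∀ v w, G z v w = G z w v) {R : Set (ℝ × ℝ)} (hR : IsOpen R)
    {Γ : ℝ × ℝ → E} (hΓ : ContDiffOn ℝ ∞ Γ R) (hm : MapsTo Γ R U) {p : ℝ × ℝ} (hp : p ∈ R) :
    du (fun q ↦ G (Γ q) (dt Γ q) (dt Γ q)) p =
      fderiv ℝ G (Γ p) (du Γ p) (dt Γ p) (dt Γ p) + 2 * G (Γ p) (dt (du Γ) p) (dt Γ p) := by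
  have hd := differentiableAt_of_contDiffOn hR hΓ hp
  have hdG := differentiableAt_of_contDiffOn hU hG (hm hp)
  have hdt := differentiableAt_of_contDiffOn hR (contDiffOn_dt hR hΓ) hp
  rw [dt_du_comm hR hΓ hp]
  unfold du
  rw [fderiv_bilin_apply (B := fun q ↦ G (Γ q)) (hdG.comp p hd) hdt hdt]
  rw [show (fun q ↦ G (Γ q)) = G ∘ Γ from rfl, fderiv_comp p hdG hd,
    hs _ (hm hp) (dt Γ p)]
  simp only [ContinuousLinearMap.comp_apply]
  ring

/-- The terms are grouped so that those with `∂ᵤ∂ᵤΓ` stand alone. Along a geodesic they are, by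
`hasDerivAt_metric_geodesic`, the `t`-derivative of `⟨∂ᵤ∂ᵤΓ, ∂ₜΓ⟩`, so they contribute boundary
values only. The remaining integrand depends just on the variation field and its coordinate
derivative; no curvature has to be introduced. -/
lemma second_derivative_energy (hU : IsOpen U) (hG : ContDiffOn ℝ ∞ G U)
    (hs : ∀ z ∈ U, ∀ v w, G z v w = G z w v) {R : Set (ℝ × ℝ)} (hR : IsOpen R)
    {Γ : ℝ × ℝ → E} (hΓ : ContDiffOn ℝ ∞ Γ R) (hm : MapsTo Γ R U) {p : ℝ × ℝ} (hp : p ∈ R) :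
    du (du (fun q ↦ G (Γ q) (dt Γ q) (dt Γ q))) p / 2 =
      indexIntegrand G (Γ p) (dt Γ p) (du Γ p) (dt (du Γ) p) +
      (G (Γ p) (dt (du (du Γ)) p) (dt Γ p) +
        fderiv ℝ G (Γ p) (du (du Γ) p) (dt Γ p) (dt Γ p) / 2) := by
  have hΓt := contDiffOn_dt hR hΓ
  have hΓu := contDiffOn_du hR hΓ
  have hΓtu := contDiffOn_dt hR hΓu
  have hDG : ContDiffOn ℝ ∞ (fderiv ℝ G) U := hG.fderiv_of_isOpen hU (by simp)
  have hd := differentiableAt_of_contDiffOn hR hΓ hp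
  have hdG := differentiableAt_of_contDiffOn hU hG (hm hp)
  have hdDG := differentiableAt_of_contDiffOn hU hDG (hm hp)
  have hdt := differentiableAt_of_contDiffOn hR hΓt hp
  have hdu := differentiableAt_of_contDiffOn hR hΓu hp
  have hdtu := differentiableAt_of_contDiffOn hR hΓtu hp
  have h1 : du (fun q ↦ G (Γ q) (dt Γ q) (dt Γ q)) =ᶠ[𝓝 p] fun q ↦
      fderiv ℝ G (Γ q) (du Γ q) (dt Γ q) (dt Γ q) + 2 * G (Γ q) (dt (du Γ) q) (dt Γ q) := by
    filter_upwards [hR.mem_nhds hp] with q hq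
      using first_derivative_energy hU hG hs hR hΓ hm hq
  have e1 : du (du Γ) p = fderiv ℝ (du Γ) p (0, 1) := rfl
  have e2 : dt (du (du Γ)) p = fderiv ℝ (dt (du Γ)) p (0, 1) := dt_du_comm hR hΓu hp
  have e3 : dt (du Γ) p = fderiv ℝ (dt Γ) p (0, 1) := dt_du_comm hR hΓ hp
  have hB1 : DifferentiableAt ℝ (fun q ↦ fderiv ℝ G (Γ q)) p := hdDG.comp p hd
  have hB2 : DifferentiableAt ℝ (fun q ↦ fderiv ℝ G (Γ q) (du Γ q)) p := hB1.clm_apply hdu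
  have hB3 : DifferentiableAt ℝ (fun q ↦ G (Γ q)) p := hdG.comp p hd
  have step : du (du (fun q ↦ G (Γ q) (dt Γ q) (dt Γ q))) p =
      fderiv ℝ (fun q ↦ fderiv ℝ G (Γ q) (du Γ q) (dt Γ q) (dt Γ q)) p (0, 1) +
      2 * fderiv ℝ (fun q ↦ G (Γ q) (dt (du Γ) q) (dt Γ q)) p (0, 1) := by
    rw [du, h1.fderiv_eq, fderiv_fun_add ((hB2.clm_apply hdt).clm_apply hdt)
      (((hB3.clm_apply hdtu).clm_apply hdt).const_mul 2), fderiv_const_mul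
      ((hB3.clm_apply hdtu).clm_apply hdt)]
    simp
  rw [step, fderiv_bilin_apply (B := fun q ↦ fderiv ℝ G (Γ q) (du Γ q)) hB2 hdt hdt,
    fderiv_bilin_apply (B := fun q ↦ G (Γ q)) hB3 hdtu hdt, fderiv_clm_apply hB1 hdu,
    show (fun q ↦ fderiv ℝ G (Γ q)) = fderiv ℝ G ∘ Γ from rfl, fderiv_comp p hdDG hd,
    show (fun q ↦ G (Γ q)) = G ∘ Γ from rfl, fderiv_comp p hdG hd]
  simp only [ContinuousLinearMap.comp_apply, add_apply,
    ContinuousLinearMap.flip_apply, indexIntegrand]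
  rw [← e1, ← e2, ← e3, fderiv_metric_symm hU hG hs (hm hp) (du Γ p) (dt Γ p) (dt (du Γ) p),
    show fderiv ℝ Γ p (0, 1) = du Γ p from rfl]
  ring

/-- The first variation formula along a geodesic. -/
lemma hasDerivAt_metric_geodesic (hU : IsOpen U) (hG : ContDiffOn ℝ ∞ G U)
    (hs : ∀ z ∈ U, ∀ v w, G z v w = G z w v) {c T X : ℝ → E} {T' X' : E} {t : ℝ} (hcU : c t ∈ U)
    (hc : HasDerivAt c (T t) t) (hT : HasDerivAt T T' t) (hX : HasDerivAt X X' t)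
    (hgeo : ∀ w, G (c t) T' w + christoffel G (c t) (T t) (T t) w = 0) :
    HasDerivAt (fun r ↦ G (c r) (X r) (T r))
      (G (c t) X' (T t) + fderiv ℝ G (c t) (X t) (T t) (T t) / 2) t := by
  have hdG := differentiableAt_of_contDiffOn hU hG hcU
  refine (hasDerivAt_bilin_apply (B := fun r ↦ G (c r)) (hdG.hasFDerivAt.comp_hasDerivAt t hc)
    hX hT).congr_deriv ?_
  -- The geodesic equation tested against `X` replaces the acceleration term; after symmetrization,
  -- half of the derivative of the metric in the direction `X` survives.
  have := hgeo (X t)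
  rw [christoffel, hs _ hcU T' (X t)] at this
  rw [fderiv_metric_symm hU hG hs hcU (T t) (X t) (T t)]
  linarith

end SecondVariation

end

end LorentzGeom

namespace LorentzGeom

noncomputable section

/-! ### Lengthening a geodesic beyond a focal parameter -/

section FocalVariation

variable {E : Type*} [NormedAddCommGroup E] [NormedSpace ℝ E]

/-- The open rectangle on which a variation is defined. -/
def box (s δ η : ℝ) : Set (ℝ × ℝ) := Ioo (s - δ) (s + δ) ×ˢ Ioo (-η) η

lemma isOpen_box (s δ η : ℝ) : IsOpen (box s δ η) := isOpen_Ioo.prod isOpen_Ioo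

/-- A variation `y` of a geodesic `y (·, 0)`, in an open subset `U` of a vector space with the
metric `G`, whose variation field is orthogonal to the geodesics and vanishes to first order
exactly at the parameter `s`. -/
structure IsFocalVariation (G : E → E →L[ℝ] E →L[ℝ] ℝ) (U : Set E) (y : ℝ × ℝ → E)
    (s δ η κ : ℝ) : Prop where
  isOpen : IsOpen U
  smooth_metric : ContDiffOn ℝ ∞ G U
  symm : ∀ z ∈ U, ∀ v w, G z v w = G z w v
  delta_pos : 0 < δ
  eta_pos : 0 < η
  kappa_pos : 0 < κ
  smooth : ContDiffOn ℝ ∞ y (box s δ η)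
  mapsTo : MapsTo y (box s δ η) U
  geodesic : ∀ t ∈ Ioo (s - δ) (s + δ), ∀ w, G (y (t, 0)) (dt (dt y) (t, 0)) w +
    christoffel G (y (t, 0)) (dt y (t, 0)) (dt y (t, 0)) w = 0
  speed : ∀ t ∈ Ioo (s - δ) (s + δ), G (y (t, 0)) (dt y (t, 0)) (dt y (t, 0)) = -κ
  orthogonal : ∀ p ∈ box s δ η, G (y p) (du y p) (dt y p) = 0
  focal : du y (s, 0) = 0
  spacelike : 0 < G (y (s, 0)) (dt (du y) (s, 0)) (dt (du y) (s, 0))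

namespace IsFocalVariation

variable {G : E → E →L[ℝ] E →L[ℝ] ℝ} {U : Set E} {y : ℝ × ℝ → E} {s δ η κ : ℝ}
  (H : IsFocalVariation G U y s δ η κ)
include H

lemma mem_box {t : ℝ} (ht : t ∈ Ioo (s - δ) (s + δ)) : (t, (0 : ℝ)) ∈ box s δ η :=
  ⟨ht, by simp [H.eta_pos], H.eta_pos⟩

lemma mem_s : s ∈ Ioo (s - δ) (s + δ) := ⟨by linarith [H.delta_pos], by linarith [H.delta_pos]⟩

lemma hasDerivAt_of_contDiffOn {F : ℝ × ℝ → E} (hF : ContDiffOn ℝ ∞ F (box s δ η)) {t : ℝ}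
    (ht : t ∈ Ioo (s - δ) (s + δ)) :
    HasDerivAt (fun r ↦ F (r, 0)) (dt F (t, 0)) t :=
  hasDerivAt_dt (p := (t, 0)) (differentiableAt_of_contDiffOn (isOpen_box _ _ _) hF (H.mem_box ht))

lemma continuousAt_axis {F : ℝ × ℝ → E} (hF : ContDiffOn ℝ ∞ F (box s δ η)) :
    ContinuousAt (fun r ↦ F (r, 0)) s :=
  (H.hasDerivAt_of_contDiffOn hF H.mem_s).continuousAt

lemma contDiffOn_axis {W : Type*} [NormedAddCommGroup W] [NormedSpace ℝ W] {F : ℝ × ℝ → W}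
    (hF : ContDiffOn ℝ ∞ F (box s δ η)) :
    ContDiffOn ℝ ∞ (fun r ↦ F (r, 0)) (Ioo (s - δ) (s + δ)) :=
  hF.comp (by fun_prop) fun _ ht ↦ H.mem_box ht

/-- Differentiating `⟨J, T⟩ = 0` along the geodesic leaves only `⟨J', T⟩` at `s`, since the other
term contains `J s = 0`. -/
lemma orthogonal_deriv :
    G (y (s, 0)) (dt (du y) (s, 0)) (dt y (s, 0)) = 0 := by
  have hu := contDiffOn_du (isOpen_box s δ η) H.smooth
  have h := H.orthogonal
  have h1 := hasDerivAt_metric_geodesic H.isOpen H.smooth_metric H.symm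
    (H.mapsTo (H.mem_box H.mem_s)) (H.hasDerivAt_of_contDiffOn H.smooth H.mem_s)
    (H.hasDerivAt_of_contDiffOn (contDiffOn_dt (isOpen_box s δ η) H.smooth) H.mem_s)
    (H.hasDerivAt_of_contDiffOn hu H.mem_s) (H.geodesic s H.mem_s)
  have h2 : (fun r ↦ G (y (r, 0)) (du y (r, 0)) (dt y (r, 0))) =ᶠ[𝓝 s] fun _ ↦ 0 := by
    filter_upwards [isOpen_Ioo.mem_nhds H.mem_s] with r hr using h _ (H.mem_box hr)
  have h3 := h1.unique ((hasDerivAt_const s (0 : ℝ)).congr_of_eventuallyEq h2)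
  rw [H.focal] at h3
  simpa using h3

/-- Differentiating the orthogonality relation in `u` expresses the boundary term of the second
variation through `J` and `J'`, that is, through first-order data which vanish at `s` in a
controlled way. -/
lemma orthogonal_second {t : ℝ} (ht : t ∈ Ioo (s - δ) (s + δ)) :
    G (y (t, 0)) (du (du y) (t, 0)) (dt y (t, 0)) =
      - G (y (t, 0)) (du y (t, 0)) (dt (du y) (t, 0)) -
        fderiv ℝ G (y (t, 0)) (du y (t, 0)) (du y (t, 0)) (dt y (t, 0)) := by
  have hp := H.mem_box ht
  have hb := isOpen_box s δ η
  have hd := differentiableAt_of_contDiffOn hb H.smooth hp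
  have hdu := differentiableAt_of_contDiffOn hb (contDiffOn_du hb H.smooth) hp
  have hdt := differentiableAt_of_contDiffOn hb (contDiffOn_dt hb H.smooth) hp
  have hdG := differentiableAt_of_contDiffOn H.isOpen H.smooth_metric (H.mapsTo hp)
  have h1 : (fun p ↦ G (y p) (du y p) (dt y p)) =ᶠ[𝓝 (t, 0)] fun _ ↦ 0 := by
    filter_upwards [hb.mem_nhds hp] with p hp using H.orthogonal p hp
  have h2 := fderiv_bilin_apply (B := fun q ↦ G (y q)) (hdG.comp (t, (0 : ℝ)) hd) hdu hdt
    ((0 : ℝ), (1 : ℝ))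
  rw [h1.fderiv_eq, show (fun q ↦ G (y q)) = G ∘ y from rfl, fderiv_comp (t, (0 : ℝ)) hdG hd] at h2
  have e3 : dt (du y) (t, 0) = fderiv ℝ (dt y) (t, 0) (0, 1) := dt_du_comm hb H.smooth hp
  rw [← e3] at h2
  simp only [ContinuousLinearMap.comp_apply, fderiv_fun_const, Pi.zero_apply,
    zero_apply] at h2
  unfold du at h2 ⊢
  linarith

omit H in
/-- The vector field along the geodesic `y (·, 0)` which is orthogonal to it and agrees at `s` with
the derivative of the variation field. -/
def auxField (G : E → E →L[ℝ] E →L[ℝ] ℝ) (y : ℝ × ℝ → E) (s κ t : ℝ) : E :=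
  dt (du y) (s, 0) + (G (y (t, 0)) (dt (du y) (s, 0)) (dt y (t, 0)) / κ) • dt y (t, 0)

lemma contDiffOn_auxField : ContDiffOn ℝ ∞ (auxField G y s κ) (Ioo (s - δ) (s + δ)) := by
  have hT := H.contDiffOn_axis (contDiffOn_dt (isOpen_box _ _ _) H.smooth)
  have hG : ContDiffOn ℝ ∞ (fun t ↦ G (y (t, 0))) (Ioo (s - δ) (s + δ)) :=
    H.smooth_metric.comp (H.contDiffOn_axis H.smooth) fun t ht ↦ H.mapsTo (H.mem_box ht)
  exact contDiffOn_const.add ((((hG.clm_apply contDiffOn_const).clm_apply hT).div_const _).smul hT)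

lemma auxField_self : auxField G y s κ s = dt (du y) (s, 0) := by
  simp [auxField, H.orthogonal_deriv]

lemma auxField_orthogonal {t : ℝ} (ht : t ∈ Ioo (s - δ) (s + δ)) :
    G (y (t, 0)) (auxField G y s κ t) (dt y (t, 0)) = 0 := by
  have := H.kappa_pos.ne'
  simp only [auxField, map_add, map_smul, add_apply, smul_apply, H.speed t ht, smul_eq_mul]
  field_simp
  ring

lemma variationField_eq (t : ℝ) :
    du y (t, 0) = (t - s) • dslope (fun r ↦ du y (r, 0)) s t := by
  rw [sub_smul_dslope, H.focal, sub_zero]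

lemma continuousAt_dslope : ContinuousAt (dslope (fun r ↦ du y (r, 0)) s) s :=
  continuousAt_dslope_same.2 (H.hasDerivAt_of_contDiffOn
    (contDiffOn_du (isOpen_box _ _ _) H.smooth) H.mem_s).differentiableAt

lemma dslope_self : dslope (fun r ↦ du y (r, 0)) s s = dt (du y) (s, 0) := by
  rw [dslope_same]
  exact (H.hasDerivAt_of_contDiffOn (contDiffOn_du (isOpen_box _ _ _) H.smooth) H.mem_s).deriv

/-- Writing `J (s - ε) = -ε • K (s - ε)` with the slope `K`, which tends to `j = J' s`, pulls out
the factor `ε`; in the quotient, the term with the derivative of the metric still contains `J` and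
disappears in the limit. -/
lemma boundary_term_lt {r : ℝ} (hr : 0 < r) : ∀ᶠ ε in 𝓝[>] (0 : ℝ),
    - G (y (s - ε, 0)) (du (du y) (s - ε, 0)) (dt y (s - ε, 0)) <
      ε * (- G (y (s, 0)) (dt (du y) (s, 0)) (dt (du y) (s, 0)) + r) := by
  set K := dslope (fun r ↦ du y (r, 0)) s with hK
  have hb := isOpen_box s δ η
  have hyU := H.mapsTo (H.mem_box H.mem_s)
  have hDG : ContDiffOn ℝ ∞ (fderiv ℝ G) U :=
    H.smooth_metric.fderiv_of_isOpen H.isOpen (by simp)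
  have cy := H.continuousAt_axis H.smooth
  have cT := H.continuousAt_axis (contDiffOn_dt hb H.smooth)
  have cJ := H.continuousAt_axis (contDiffOn_du hb H.smooth)
  have cJ' := H.continuousAt_axis (contDiffOn_dt hb (contDiffOn_du hb H.smooth))
  have cG : ContinuousAt (fun t ↦ G (y (t, 0))) s :=
    ContinuousAt.comp (f := fun t ↦ y (t, 0))
      (H.smooth_metric.continuousOn.continuousAt (H.isOpen.mem_nhds hyU)) cy
  have cDG : ContinuousAt (fun t ↦ fderiv ℝ G (y (t, 0))) s :=
    ContinuousAt.comp (f := fun t ↦ y (t, 0))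
      (hDG.continuousOn.continuousAt (H.isOpen.mem_nhds hyU)) cy
  have cK : ContinuousAt K s := H.continuousAt_dslope
  have c1 : ContinuousAt (fun t ↦ -(G (y (t, 0)) (K t) (dt (du y) (t, 0)) +
      fderiv ℝ G (y (t, 0)) (K t) (du y (t, 0)) (dt y (t, 0)))) s :=
    (((cG.clm_apply cK).clm_apply cJ').add (((cDG.clm_apply cK).clm_apply cJ).clm_apply cT)).neg
  have c2 : Tendsto (fun ε : ℝ ↦ s - ε) (𝓝[>] 0) (𝓝 s) := by
    have : Tendsto (fun ε : ℝ ↦ s - ε) (𝓝 0) (𝓝 (s - 0)) := by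
      exact (continuous_const.sub continuous_id).tendsto 0
    rw [sub_zero] at this
    exact this.mono_left nhdsWithin_le_nhds
  have c3 : ∀ᶠ t in 𝓝 s, -(G (y (t, 0)) (K t) (dt (du y) (t, 0)) +
      fderiv ℝ G (y (t, 0)) (K t) (du y (t, 0)) (dt y (t, 0))) <
      - G (y (s, 0)) (dt (du y) (s, 0)) (dt (du y) (s, 0)) + r := by
    refine c1.eventually (gt_mem_nhds ?_)
    simp only [hK, H.dslope_self, H.focal]
    simp [hr]
  have c4 : ∀ᶠ t in 𝓝 s, t ∈ Ioo (s - δ) (s + δ) := isOpen_Ioo.mem_nhds H.mem_s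
  filter_upwards [c2.eventually c3, c2.eventually c4, self_mem_nhdsWithin] with ε h3 h4 h5
  have h6 : (0 : ℝ) < ε := h5
  refine lt_of_eq_of_lt ?_ (mul_lt_mul_of_pos_left h3 h6)
  rw [H.orthogonal_second h4]
  have h7 := H.variationField_eq (s - ε)
  rw [← hK, sub_sub_cancel_left] at h7
  have e1 : G (y (s - ε, 0)) (du y (s - ε, 0)) = -ε • G (y (s - ε, 0)) (K (s - ε)) := by
    rw [h7, map_smul]
  have e2 : fderiv ℝ G (y (s - ε, 0)) (du y (s - ε, 0)) =
      -ε • fderiv ℝ G (y (s - ε, 0)) (K (s - ε)) := by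
    rw [h7, map_smul]
  rw [e2, e1]
  simp only [smul_apply, smul_eq_mul]
  ring

/-- After substitution of the slope for `J`, the field and its derivative extend continuously to `ε
= 0` with the values `0` and `k τ • j`. Only the term quadratic in the derivative survives, and
compactness of `[-1, 1]` makes the estimate uniform in `τ`. -/
lemma indexIntegrand_lt {k h : ℝ → ℝ} (hk : ContDiff ℝ ∞ k) (hh : ContDiff ℝ ∞ h) {r : ℝ}
    (hr : 0 < r) : ∀ᶠ ε in 𝓝[>] (0 : ℝ), ∀ τ ∈ Icc (-1 : ℝ) 1,
    indexIntegrand G (y (s + ε * τ, 0)) (dt y (s + ε * τ, 0))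
      (k τ • du y (s + ε * τ, 0) + (ε * (h τ - τ * k τ)) • auxField G y s κ (s + ε * τ))
      ((deriv k τ / ε) • du y (s + ε * τ, 0) + k τ • dt (du y) (s + ε * τ, 0) +
        ((-τ * deriv k τ) • auxField G y s κ (s + ε * τ) +
          (ε * (h τ - τ * k τ)) • deriv (auxField G y s κ) (s + ε * τ))) <
      G (y (s, 0)) (dt (du y) (s, 0)) (dt (du y) (s, 0)) * k τ ^ 2 + r := by
  set K := dslope (fun r ↦ du y (r, 0)) s with hK
  set P := auxField G y s κ with hP
  set j := dt (du y) (s, 0) with hj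
  have hb := isOpen_box s δ η
  have hyU := H.mapsTo (H.mem_box H.mem_s)
  have hDG : ContDiffOn ℝ ∞ (fderiv ℝ G) U :=
    H.smooth_metric.fderiv_of_isOpen H.isOpen (by simp)
  have hDDG : ContDiffOn ℝ ∞ (fderiv ℝ (fderiv ℝ G)) U := hDG.fderiv_of_isOpen H.isOpen (by simp)
  have cy := H.continuousAt_axis H.smooth
  have cT := H.continuousAt_axis (contDiffOn_dt hb H.smooth)
  have cJ' := H.continuousAt_axis (contDiffOn_dt hb (contDiffOn_du hb H.smooth))
  have cG : ContinuousAt (fun t ↦ G (y (t, 0))) s :=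
    ContinuousAt.comp (f := fun t ↦ y (t, 0))
      (H.smooth_metric.continuousOn.continuousAt (H.isOpen.mem_nhds hyU)) cy
  have cDG : ContinuousAt (fun t ↦ fderiv ℝ G (y (t, 0))) s :=
    ContinuousAt.comp (f := fun t ↦ y (t, 0))
      (hDG.continuousOn.continuousAt (H.isOpen.mem_nhds hyU)) cy
  have cDDG : ContinuousAt (fun t ↦ fderiv ℝ (fderiv ℝ G) (y (t, 0))) s :=
    ContinuousAt.comp (f := fun t ↦ y (t, 0))
      (hDDG.continuousOn.continuousAt (H.isOpen.mem_nhds hyU)) cy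
  have cK : ContinuousAt K s := H.continuousAt_dslope
  have cP : ContinuousAt P s :=
    H.contDiffOn_auxField.continuousOn.continuousAt (isOpen_Ioo.mem_nhds H.mem_s)
  have cP' : ContinuousAt (deriv P) s :=
    (H.contDiffOn_auxField.deriv_of_isOpen (m := ∞) isOpen_Ioo
      (by simp)).continuousOn.continuousAt (isOpen_Ioo.mem_nhds H.mem_s)
  have ck : Continuous k := hk.continuous
  have ch : Continuous h := hh.continuous
  have ck' : Continuous (deriv k) := hk.continuous_deriv (by simp)
  -- Because `J (s + ε * τ) = (ε * τ) • K (s + ε * τ)`, the singular coefficient `deriv k τ / ε`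
  -- becomes `τ * deriv k τ`. At `ε = 0` this term cancels against the one from the auxiliary field,
  -- as both `K` and `P` take the value `j` at `s`.
  set X : ℝ × ℝ → E := fun z ↦ z.1 • ((z.2 * k z.2) • K (s + z.1 * z.2) +
    (h z.2 - z.2 * k z.2) • P (s + z.1 * z.2)) with hX
  set X' : ℝ × ℝ → E := fun z ↦ (z.2 * deriv k z.2) • K (s + z.1 * z.2) +
    k z.2 • dt (du y) (s + z.1 * z.2, 0) + ((-z.2 * deriv k z.2) • P (s + z.1 * z.2) +
    (z.1 * (h z.2 - z.2 * k z.2)) • deriv P (s + z.1 * z.2)) with hX'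
  have hev : ∀ᶠ ε in 𝓝 (0 : ℝ), ∀ τ ∈ Icc (-1 : ℝ) 1,
      indexIntegrand G (y (s + ε * τ, 0)) (dt y (s + ε * τ, 0)) (X (ε, τ)) (X' (ε, τ)) <
        G (y (s, 0)) j j * k τ ^ 2 + r := by
    refine isCompact_Icc.eventually_forall_of_forall_eventually fun τ _ ↦ ?_
    have lim : Tendsto (fun z : ℝ × ℝ ↦ s + z.1 * z.2) (𝓝 (0, τ)) (𝓝 s) := by
      have : Continuous (fun z : ℝ × ℝ ↦ s + z.1 * z.2) := by fun_prop
      simpa using this.tendsto (0, τ)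
    have lift : ∀ {W : Type _} [TopologicalSpace W] {f : ℝ → W}, ContinuousAt f s →
        ContinuousAt (fun z : ℝ × ℝ ↦ f (s + z.1 * z.2)) (0, τ) := by
      intro W _ f hf
      have : ContinuousAt f (s + (0, τ).1 * (0, τ).2) := by simpa using hf
      exact ContinuousAt.comp (f := fun z : ℝ × ℝ ↦ s + z.1 * z.2) this (by fun_prop)
    have cX : ContinuousAt X (0, τ) := by
      have l1 := lift cK
      have l2 := lift cP
      exact continuousAt_fst.smul (((Continuous.continuousAt (by fun_prop)).smul l1).add
        ((Continuous.continuousAt (by fun_prop)).smul l2))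
    have cX' : ContinuousAt X' (0, τ) := by
      have l1 := lift cK
      have l2 := lift cP
      have l3 := lift cP'
      have l4 := lift cJ'
      exact (((Continuous.continuousAt (by fun_prop)).smul l1).add
        ((Continuous.continuousAt (by fun_prop)).smul l4)).add
        (((Continuous.continuousAt (by fun_prop)).smul l2).add
          ((Continuous.continuousAt (by fun_prop)).smul l3))
    have c : ContinuousAt (fun z : ℝ × ℝ ↦ indexIntegrand G (y (s + z.1 * z.2, 0))
        (dt y (s + z.1 * z.2, 0)) (X z) (X' z) - G (y (s, 0)) j j * k z.2 ^ 2) (0, τ) := by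
      have lG := lift cG
      have lDG := lift cDG
      have lDDG := lift cDDG
      have lT := lift cT
      have c1 := (lG.clm_apply cX').clm_apply cX'
      have c2 := ((lDG.clm_apply cX).clm_apply cX').clm_apply lT
      have c3 := (((lDDG.clm_apply cX).clm_apply cX).clm_apply lT).clm_apply lT
      exact ((c1.add (continuousAt_const.mul c2)).add (c3.div_const 2)).sub
        (Continuous.continuousAt (by fun_prop))
    have h0 : indexIntegrand G (y (s + 0 * τ, 0)) (dt y (s + 0 * τ, 0)) (X (0, τ)) (X' (0, τ)) -
        G (y (s, 0)) j j * k τ ^ 2 < r := by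
      have x0 : X (0, τ) = 0 := by simp [hX]
      have x0' : X' (0, τ) = k τ • j := by
        simp only [hX', zero_mul, add_zero, zero_smul]
        rw [hK, H.dslope_self, hP, H.auxField_self]
        rw [neg_mul, neg_smul]
        abel
      rw [x0, x0']
      simp only [indexIntegrand, zero_mul, add_zero, map_zero, zero_apply, mul_zero,
        zero_div, map_smul, smul_apply, smul_eq_mul]
      nlinarith
    filter_upwards [c.eventually (gt_mem_nhds h0)] with z hz
    linarith
  filter_upwards [nhdsWithin_le_nhds hev, self_mem_nhdsWithin] with ε hε hε0 τ hτ
  have hε0' : (0 : ℝ) < ε := hε0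
  have := hε τ hτ
  have eJ : du y (s + ε * τ, 0) = (ε * τ) • K (s + ε * τ) := by
    rw [H.variationField_eq, hK, add_sub_cancel_left]
  rw [eJ]
  convert this using 2
  · simp only [hX, smul_add, smul_smul]
    congr 2
    ring
  · simp only [hX', smul_smul]
    rw [show deriv k τ / ε * (ε * τ) = τ * deriv k τ by field_simp]

omit H in
/-- The smoothing, at the scale `ε`, of the variation which follows `y` up to the parameter `s` and
the geodesic `y (·, 0)` afterwards. -/
def smoothedVariation (G : E → E →L[ℝ] E →L[ℝ] ℝ) (y : ℝ × ℝ → E) (s κ : ℝ) (k h : ℝ → ℝ) (ε : ℝ)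
    (p : ℝ × ℝ) : E :=
  y (p.1, 0) + k ((p.1 - s) / ε) • (y p - y (p.1, 0)) +
    (p.2 * (ε * (h ((p.1 - s) / ε) - (p.1 - s) / ε * k ((p.1 - s) / ε)))) • auxField G y s κ p.1

section Smoothed

variable {k h : ℝ → ℝ} (hk : ContDiff ℝ ∞ k) (hh : ContDiff ℝ ∞ h) {ε : ℝ}
include hk hh

lemma contDiffOn_smoothedVariation :
    ContDiffOn ℝ ∞ (smoothedVariation G y s κ k h ε) (box s δ η) := by
  have h1 : ContDiffOn ℝ ∞ (fun p : ℝ × ℝ ↦ y (p.1, 0)) (box s δ η) :=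
    (H.contDiffOn_axis H.smooth).comp contDiffOn_fst fun p hp ↦ hp.1
  have h2 : ContDiffOn ℝ ∞ (fun p : ℝ × ℝ ↦ auxField G y s κ p.1) (box s δ η) :=
    H.contDiffOn_auxField.comp contDiffOn_fst fun p hp ↦ hp.1
  have h3 : ContDiff ℝ ∞ (fun p : ℝ × ℝ ↦ (p.1 - s) / ε) := by fun_prop
  exact (h1.add ((hk.comp h3).contDiffOn.smul (H.smooth.sub h1))).add
    ((contDiff_snd.mul (contDiff_const.mul
      ((hh.comp h3).sub (h3.mul (hk.comp h3))))).contDiffOn.smul h2)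

/-- On the window `J ≈ (ε * τ) • j` and the auxiliary field is close to `j`, so the sum is about `ε
* h τ • j`: the summand with `h - τ * k` turns a mere cut-off of `J` into a smoothed corner. It
vanishes for `|τ| ≥ 1`. -/
lemma du_smoothedVariation {p : ℝ × ℝ} (hp : p ∈ box s δ η) :
    du (smoothedVariation G y s κ k h ε) p = k ((p.1 - s) / ε) • du y p +
      (ε * (h ((p.1 - s) / ε) - (p.1 - s) / ε * k ((p.1 - s) / ε))) • auxField G y s κ p.1 := by
  have hb := isOpen_box s δ η
  have h1 := hasDerivAt_du (differentiableAt_of_contDiffOn hb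
    (H.contDiffOn_smoothedVariation hk hh (ε := ε)) hp)
  have h2 := hasDerivAt_du (differentiableAt_of_contDiffOn hb H.smooth hp)
  have h3 := (((h2.sub_const (y (p.1, 0))).const_smul (k ((p.1 - s) / ε))).const_add
    (y (p.1, 0))).add (((hasDerivAt_id p.2).mul_const (ε * (h ((p.1 - s) / ε) -
      (p.1 - s) / ε * k ((p.1 - s) / ε)))).smul_const (auxField G y s κ p.1))
  have h4 := h1.unique h3
  rw [h4, one_mul]

/-- The correction is linear in `u`, so it leaves the boundary terms alone: at `s - ε` the full
second derivative of `y` appears, at `s + ε` nothing. -/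
lemma du_du_smoothedVariation {p : ℝ × ℝ} (hp : p ∈ box s δ η) :
    du (du (smoothedVariation G y s κ k h ε)) p = k ((p.1 - s) / ε) • du (du y) p := by
  have hb := isOpen_box s δ η
  have h1 := hasDerivAt_du (differentiableAt_of_contDiffOn hb
    (contDiffOn_du hb (H.contDiffOn_smoothedVariation hk hh (ε := ε))) hp)
  have h2 := hasDerivAt_du (differentiableAt_of_contDiffOn hb (contDiffOn_du hb H.smooth) hp)
  have h3 := (h2.const_smul (k ((p.1 - s) / ε))).add_const
    ((ε * (h ((p.1 - s) / ε) - (p.1 - s) / ε * k ((p.1 - s) / ε))) • auxField G y s κ p.1)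
  have h4 : (fun u ↦ du (smoothedVariation G y s κ k h ε) (p.1, u)) =ᶠ[𝓝 p.2] fun u ↦
      k ((p.1 - s) / ε) • du y (p.1, u) +
      (ε * (h ((p.1 - s) / ε) - (p.1 - s) / ε * k ((p.1 - s) / ε))) • auxField G y s κ p.1 := by
    have : ∀ᶠ u in 𝓝 p.2, (p.1, u) ∈ box s δ η :=
      (Continuous.continuousAt (by fun_prop)).eventually (hb.mem_nhds hp)
    filter_upwards [this] with u hu using H.du_smoothedVariation hk hh hu
  exact h1.unique (h3.congr_of_eventuallyEq h4)

/-- Since `h' = k`, the derivative of `ε * (h - τ * k)` is `-τ * deriv k τ`: no undifferentiated `k`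
remains next to the auxiliary field. -/
lemma dt_du_smoothedVariation (hkh : ∀ τ, HasDerivAt h (k τ) τ) (hε : 0 < ε) {t : ℝ}
    (ht : t ∈ Ioo (s - δ) (s + δ)) :
    dt (du (smoothedVariation G y s κ k h ε)) (t, 0) =
      (deriv k ((t - s) / ε) / ε) • du y (t, 0) + k ((t - s) / ε) • dt (du y) (t, 0) +
        ((-((t - s) / ε) * deriv k ((t - s) / ε)) • auxField G y s κ t +
          (ε * (h ((t - s) / ε) - (t - s) / ε * k ((t - s) / ε))) •
            deriv (auxField G y s κ) t) := by
  have hb := isOpen_box s δ η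
  have h1 := H.hasDerivAt_of_contDiffOn
    (contDiffOn_du hb (H.contDiffOn_smoothedVariation hk hh (ε := ε))) ht
  have h2 := H.hasDerivAt_of_contDiffOn (contDiffOn_du hb H.smooth) ht
  have h3 : HasDerivAt (fun r : ℝ ↦ (r - s) / ε) (1 / ε) t :=
    ((hasDerivAt_id t).sub_const s).div_const ε
  have hkd : HasDerivAt k (deriv k ((t - s) / ε)) ((t - s) / ε) :=
    (hk.differentiable (by simp) _).hasDerivAt
  have h4 : HasDerivAt (fun r ↦ k ((r - s) / ε)) (deriv k ((t - s) / ε) * (1 / ε)) t :=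
    hkd.comp t h3
  have h5 : HasDerivAt (fun r ↦ h ((r - s) / ε)) (k ((t - s) / ε) * (1 / ε)) t :=
    (hkh _).comp t h3
  have h6 : HasDerivAt (auxField G y s κ) (deriv (auxField G y s κ) t) t :=
    (differentiableAt_of_contDiffOn isOpen_Ioo H.contDiffOn_auxField ht).hasDerivAt
  have h7 := (h4.smul h2).add (((h5.sub (h3.mul h4)).const_mul ε).smul h6)
  have h8 : (fun r ↦ du (smoothedVariation G y s κ k h ε) (r, 0)) =ᶠ[𝓝 t] fun r ↦
      k ((r - s) / ε) • du y (r, 0) +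
      (ε * (h ((r - s) / ε) - (r - s) / ε * k ((r - s) / ε))) • auxField G y s κ r := by
    filter_upwards [isOpen_Ioo.mem_nhds ht] with r hr
      using H.du_smoothedVariation hk hh (H.mem_box hr)
  rw [h1.unique (h7.congr_of_eventuallyEq h8)]
  have e1 : deriv k ((t - s) / ε) * (1 / ε) = deriv k ((t - s) / ε) / ε := by ring
  have e2 : ε * (k ((t - s) / ε) * (1 / ε) - (1 / ε * k ((t - s) / ε) +
      (t - s) / ε * (deriv k ((t - s) / ε) * (1 / ε)))) =
      -((t - s) / ε) * deriv k ((t - s) / ε) := by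
    field_simp
    ring
  simp only [Pi.sub_apply, Pi.mul_apply]
  rw [e2, e1]
  abel

end Smoothed

/-- A geodesic with a focal variation does not maximize length past the focal parameter: the
variation, followed by the geodesic, can be smoothed to longer curves. -/
theorem exists_longer : ∃ ε ∈ Ioo 0 δ, ∃ Γ : ℝ × ℝ → E, ContDiffOn ℝ ∞ Γ (box s δ η) ∧
    (∀ p : ℝ × ℝ, p.1 ≤ s - ε → Γ p = y p) ∧ (∀ p : ℝ × ℝ, s + ε ≤ p.1 → Γ p = y (p.1, 0)) ∧
    ∀ᶠ u in 𝓝[>] (0 : ℝ), (∀ t ∈ Icc (s - ε) (s + ε), (t, u) ∈ box s δ η ∧ Γ (t, u) ∈ U ∧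
      G (Γ (t, u)) (dt Γ (t, u)) (dt Γ (t, u)) < 0) ∧
      2 * ε * √κ < ∫ t in (s - ε)..(s + ε), √(-G (Γ (t, u)) (dt Γ (t, u)) (dt Γ (t, u))) := by
  obtain ⟨k, h, hk, hh, hkh, hleft, hright, hint⟩ := exists_smoothing_profile
  have hb := isOpen_box s δ η
  set m := G (y (s, 0)) (dt (du y) (s, 0)) (dt (du y) (s, 0)) with hm
  have hm0 : 0 < m := H.spacelike
  set I := ∫ τ in (-1 : ℝ)..1, k τ ^ 2 with hI
  -- The tolerance `r` is spent once on the boundary term and twice on the index integral, whose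
  -- window has length `2 * ε`. The main gain is `4 * r * ε`, so `r * ε` is left.
  set r := m * (1 - I) / 4 with hr
  have hr0 : 0 < r := by
    have : 0 < 1 - I := by linarith
    positivity
  have hδε : ∀ᶠ ε in 𝓝[>] (0 : ℝ), ε < δ := nhdsWithin_le_nhds (gt_mem_nhds H.delta_pos)
  obtain ⟨ε, ⟨hbound, hindex⟩, hεδ, hε0⟩ :=
    (((H.boundary_term_lt hr0).and (H.indexIntegrand_lt hk hh hr0)).and
      (hδε.and self_mem_nhdsWithin)).exists
  have hε : 0 < ε := hε0
  set Γ := smoothedVariation G y s κ k h ε with hΓ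
  have hΓs : ContDiffOn ℝ ∞ Γ (box s δ η) := H.contDiffOn_smoothedVariation hk hh
  have hsubI : Icc (s - ε) (s + ε) ⊆ Ioo (s - δ) (s + δ) := fun t ht ↦
    ⟨by linarith [ht.1], by linarith [ht.2]⟩
  have hΓ0 : ∀ t, Γ (t, 0) = y (t, 0) := fun t ↦ by simp [hΓ, smoothedVariation]
  -- Linear combinations of points of `U` may leave `U`. The metric is evaluated on the open set
  -- where `Γ` stays inside; it contains the axis, where `Γ` agrees with `y`.
  set R := box s δ η ∩ Γ ⁻¹' U with hRdef
  have hR : IsOpen R := hΓs.continuousOn.isOpen_inter_preimage hb H.isOpen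
  have hRm : MapsTo Γ R U := fun p hp ↦ hp.2
  have hΓR : ContDiffOn ℝ ∞ Γ R := hΓs.mono inter_subset_left
  have hRt : ∀ t ∈ Ioo (s - δ) (s + δ), (t, (0 : ℝ)) ∈ R := fun t ht ↦
    ⟨H.mem_box ht, by rw [mem_preimage, hΓ0]; exact H.mapsTo (H.mem_box ht)⟩
  have hdtΓ : ∀ t ∈ Ioo (s - δ) (s + δ), dt Γ (t, 0) = dt y (t, 0) := by
    intro t ht
    have h1 := H.hasDerivAt_of_contDiffOn hΓs ht
    simp only [hΓ0] at h1
    exact h1.unique (H.hasDerivAt_of_contDiffOn H.smooth ht)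
  set e : ℝ × ℝ → ℝ := fun q ↦ G (Γ q) (dt Γ q) (dt Γ q) with he
  have hes : ContDiffOn ℝ ∞ e R :=
    ((H.smooth_metric.comp hΓR hRm).clm_apply (contDiffOn_dt hR hΓR)).clm_apply
      (contDiffOn_dt hR hΓR)
  have hduneg : ∀ f : ℝ × ℝ → ℝ, du (fun q ↦ -f q) = fun q ↦ -du f q := fun f ↦ by
    funext q; simp [du, fderiv_fun_neg]
  -- the vector field whose product with the velocity is the boundary term
  set V : ℝ → E := fun t ↦ du (du Γ) (t, 0) with hV
  set β : ℝ → ℝ := fun t ↦ G (y (t, 0)) (V t) (dt y (t, 0)) with hβ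
  set β' : ℝ → ℝ := fun t ↦ G (y (t, 0)) (dt (du (du Γ)) (t, 0)) (dt y (t, 0)) +
    fderiv ℝ G (y (t, 0)) (V t) (dt y (t, 0)) (dt y (t, 0)) / 2 with hβ'
  have hβd : ∀ t ∈ Ioo (s - δ) (s + δ), HasDerivAt β (β' t) t := fun t ht ↦
    hasDerivAt_metric_geodesic H.isOpen H.smooth_metric H.symm (H.mapsTo (H.mem_box ht))
      (H.hasDerivAt_of_contDiffOn H.smooth ht)
      (H.hasDerivAt_of_contDiffOn (contDiffOn_dt hb H.smooth) ht)
      (H.hasDerivAt_of_contDiffOn (contDiffOn_du hb (contDiffOn_du hb hΓs)) ht)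
      (H.geodesic t ht)
  have hβs : ContDiffOn ℝ ∞ β (Ioo (s - δ) (s + δ)) :=
    ((H.smooth_metric.comp (H.contDiffOn_axis H.smooth)
      fun t ht ↦ H.mapsTo (H.mem_box ht)).clm_apply (H.contDiffOn_axis
        (contDiffOn_du hb (contDiffOn_du hb hΓs)))).clm_apply
      (H.contDiffOn_axis (contDiffOn_dt hb H.smooth))
  have hβ'c : ContinuousOn β' (Ioo (s - δ) (s + δ)) := by
    have h1 := (hβs.deriv_of_isOpen (m := ∞) isOpen_Ioo (by simp)).continuousOn
    exact h1.congr fun t ht ↦ (hβd t ht).deriv.symm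
  have huIcc : uIcc (s - ε) (s + ε) = Icc (s - ε) (s + ε) := uIcc_of_le (by linarith)
  -- The part with second `u`-derivatives is an exact derivative. It contributes nothing at `s + ε`,
  -- where `k` has become `0`, and the value for `y` at `s - ε`, where `k` is still `1`.
  have hβint : ∫ t in (s - ε)..(s + ε), β' t = β (s + ε) - β (s - ε) := by
    refine intervalIntegral.integral_eq_sub_of_hasDerivAt (fun t ht ↦ hβd t ?_) ?_
    · rw [huIcc] at ht; exact hsubI ht
    · refine ContinuousOn.intervalIntegrable ?_
      rw [huIcc]; exact hβ'c.mono hsubI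
  have hβ1 : β (s + ε) = 0 := by
    have h1 : s + ε ∈ Ioo (s - δ) (s + δ) := hsubI ⟨by linarith, le_rfl⟩
    have h2 := H.du_du_smoothedVariation hk hh (ε := ε) (H.mem_box h1)
    simp only [add_sub_cancel_left, div_self hε.ne', (hright 1 le_rfl).1, zero_smul] at h2
    simp only [hβ, hV]
    rw [h2]
    simp
  have hβ2 : β (s - ε) = G (y (s - ε, 0)) (du (du y) (s - ε, 0)) (dt y (s - ε, 0)) := by
    have h1 : s - ε ∈ Ioo (s - δ) (s + δ) := hsubI ⟨le_rfl, by linarith⟩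
    have h2 := H.du_du_smoothedVariation hk hh (ε := ε) (H.mem_box h1)
    simp only [sub_sub_cancel_left, neg_div, div_self hε.ne', (hleft (-1) le_rfl).1,
      one_smul] at h2
    simp only [hβ, hV]
    rw [h2]
  have hsecond : ∀ t ∈ Icc (s - ε) (s + ε),
      du (du e) (t, 0) ≤ 2 * (m * k ((t - s) / ε) ^ 2 + r + β' t) := by
    intro t ht
    have ht' := hsubI ht
    have h1 := second_derivative_energy H.isOpen H.smooth_metric H.symm hR hΓR hRm (hRt t ht')
    have hτ : (t - s) / ε ∈ Icc (-1 : ℝ) 1 := by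
      constructor
      · rw [le_div_iff₀ hε]; linarith [ht.1]
      · rw [div_le_iff₀ hε]; linarith [ht.2]
    have h2 := hindex _ hτ
    have h3 : s + ε * ((t - s) / ε) = t := by field_simp; ring
    rw [h3] at h2
    rw [hΓ0, hdtΓ t ht'] at h1
    have h4 := H.dt_du_smoothedVariation hk hh hkh hε ht'
    have h5 := H.du_smoothedVariation hk hh (ε := ε) (H.mem_box ht')
    rw [← hΓ] at h4 h5
    simp only at h5
    rw [← h4, ← h5] at h2
    simp only [hβ', hV]
    linarith
  have hcont : ContinuousOn (fun t ↦ du (du e) (t, 0)) (Icc (s - ε) (s + ε)) :=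
    (contDiffOn_du hR (contDiffOn_du hR hes)).continuousOn.comp (by fun_prop)
      fun t ht ↦ hRt t (hsubI ht)
  have hkint : ∫ t in (s - ε)..(s + ε), k ((t - s) / ε) ^ 2 = ε * I := by
    have h1 := intervalIntegral.integral_comp_div_sub (a := s - ε) (b := s + ε)
      (fun τ ↦ k τ ^ 2) hε.ne' (s / ε)
    rw [show (s - ε) / ε - s / ε = -1 by field_simp; ring,
      show (s + ε) / ε - s / ε = 1 by field_simp; ring, smul_eq_mul, ← hI] at h1
    rw [← h1]
    refine intervalIntegral.integral_congr fun t _ ↦ ?_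
    simp only [sub_div]
  have hkc : Continuous fun t ↦ m * k ((t - s) / ε) ^ 2 + r := by
    have := hk.continuous
    fun_prop
  have hneg : ∫ t in (s - ε)..(s + ε), du (du e) (t, 0) < 0 := by
    have i1 : IntervalIntegrable (fun t ↦ m * k ((t - s) / ε) ^ 2 + r) MeasureTheory.volume
      (s - ε) (s + ε) := hkc.intervalIntegrable _ _
    have i2 : IntervalIntegrable β' MeasureTheory.volume (s - ε) (s + ε) := by
      refine ContinuousOn.intervalIntegrable ?_
      rw [huIcc]; exact hβ'c.mono hsubI
    have i3 : IntervalIntegrable (fun t ↦ du (du e) (t, 0)) MeasureTheory.volume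
        (s - ε) (s + ε) := by
      refine ContinuousOn.intervalIntegrable ?_
      rw [huIcc]; exact hcont
    have h1 := intervalIntegral.integral_mono_on (by linarith) i3 ((i1.add i2).const_mul 2)
      hsecond
    rw [intervalIntegral.integral_const_mul, intervalIntegral.integral_add i1 i2, hβint, hβ1, hβ2,
      intervalIntegral.integral_add (Continuous.intervalIntegrable (by
        have := hk.continuous
        fun_prop) _ _) intervalIntegrable_const, intervalIntegral.integral_const_mul, hkint,
      intervalIntegral.integral_const, smul_eq_mul] at h1
    refine h1.trans_lt ?_
    have h2 : ε * (-m + r) + m * (ε * I) + (s + ε - (s - ε)) * r = -(ε * r) := by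
      rw [hr]; ring
    nlinarith [mul_pos hε hr0]
  -- The energy of a timelike curve is negative, so the criterion is applied to `-e`. The first
  -- variation vanishes because the field is orthogonal to the velocity along the whole geodesic,
  -- and half of it is the derivative of that product.
  have hfinal := eventually_lt_integral_sqrt (f := fun q ↦ -e q) hR hes.neg
    (show s - ε < s + ε by linarith) H.kappa_pos (fun t ht ↦ hRt t (hsubI ht))
    (fun t ht ↦ by
      simp only [he]
      rw [hΓ0, hdtΓ t (hsubI ht), H.speed t (hsubI ht), neg_neg])
    (fun t ht ↦ by
      have ht' := hsubI ht
      rw [hduneg]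
      simp only [neg_eq_zero]
      rw [he, first_derivative_energy H.isOpen H.smooth_metric H.symm hR hΓR hRm (hRt t ht'),
        hΓ0, hdtΓ t ht']
      have h1 := hasDerivAt_metric_geodesic H.isOpen H.smooth_metric H.symm
        (H.mapsTo (H.mem_box ht')) (H.hasDerivAt_of_contDiffOn H.smooth ht')
        (H.hasDerivAt_of_contDiffOn (contDiffOn_dt hb H.smooth) ht')
        (H.hasDerivAt_of_contDiffOn (contDiffOn_du hb hΓs) ht') (H.geodesic t ht')
      have h2 : (fun r ↦ G (y (r, 0)) (du Γ (r, 0)) (dt y (r, 0))) =ᶠ[𝓝 t] fun _ ↦ 0 := by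
        filter_upwards [isOpen_Ioo.mem_nhds ht'] with q hq
        rw [hΓ, H.du_smoothedVariation hk hh (H.mem_box hq)]
        simp only [map_add, map_smul, add_apply, smul_apply, H.orthogonal _ (H.mem_box hq),
          H.auxField_orthogonal hq, smul_zero, add_zero]
      have h3 := h1.unique ((hasDerivAt_const t (0 : ℝ)).congr_of_eventuallyEq h2)
      linarith)
    (by
      rw [hduneg, hduneg]
      simp only
      rw [intervalIntegral.integral_neg]
      linarith)
  refine ⟨ε, ⟨hε, hεδ⟩, Γ, hΓs, ?_, ?_, ?_⟩
  · intro p hp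
    have h1 : (p.1 - s) / ε ≤ -1 := by rw [div_le_iff₀ hε]; linarith
    obtain ⟨h2, h3⟩ := hleft _ h1
    simp [hΓ, smoothedVariation, h2, h3]
  · intro p hp
    have h1 : 1 ≤ (p.1 - s) / ε := by rw [le_div_iff₀ hε]; linarith
    obtain ⟨h2, h3⟩ := hright _ h1
    simp [hΓ, smoothedVariation, h2, h3]
  · filter_upwards [hfinal] with u hu
    refine ⟨fun t ht ↦ ⟨(hu.1 t ht).1.1, (hu.1 t ht).1.2, neg_pos.1 (hu.1 t ht).2⟩, ?_⟩
    rw [show 2 * ε * √κ = (s + ε - (s - ε)) * √κ by ring]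
    exact hu.2

end IsFocalVariation

end FocalVariation

end

end LorentzGeom

namespace LorentzGeom

noncomputable section

/-! ### The metric in a chart -/

section Charts

variable {E : Type*} [NormedAddCommGroup E] [NormedSpace ℝ E]
  {M : Type*} [TopologicalSpace M] [ChartedSpace E M] [IsManifold 𝓘(ℝ, E) ∞ M]

/-- The differential of the inverse of the chart at `x₀`. -/
def chartFrame (x₀ : M) (y : E) : E →L[ℝ] E :=
  mfderiv 𝓘(ℝ, E) 𝓘(ℝ, E) (extChartAt 𝓘(ℝ, E) x₀).symm y

/-- The metric as a field of bilinear forms on the model space. -/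
def LorentzianMetric.form (g : LorentzianMetric E M) (x : M) : E →L[ℝ] E →L[ℝ] ℝ := g.val x

omit [IsManifold 𝓘(ℝ, E) ∞ M] in
lemma isOpen_target (x₀ : M) : IsOpen (extChartAt 𝓘(ℝ, E) x₀).target := isOpen_extChartAt_target x₀

omit [IsManifold 𝓘(ℝ, E) ∞ M] in
lemma mem_source_iff {x₀ x : M} : x ∈ (extChartAt 𝓘(ℝ, E) x₀).source ↔ x ∈ (chartAt E x₀).source := by
  rw [extChartAt_source]

lemma mdifferentiableAt_ext_symm {x₀ : M} {y : E} (hy : y ∈ (extChartAt 𝓘(ℝ, E) x₀).target) :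
    MDifferentiableAt 𝓘(ℝ, E) 𝓘(ℝ, E) (extChartAt 𝓘(ℝ, E) x₀).symm y := by
  have : IsManifold 𝓘(ℝ, E) 1 M := IsManifold.of_le (n := ∞) (by norm_cast)
  have := mdifferentiableWithinAt_extChartAt_symm (I := 𝓘(ℝ, E)) hy
  rwa [ModelWithCorners.range_eq_univ, mdifferentiableWithinAt_univ] at this

lemma chartFrame_isInvertible {x₀ : M} {y : E} (hy : y ∈ (extChartAt 𝓘(ℝ, E) x₀).target) :
    (chartFrame x₀ y).IsInvertible := by
  have : IsManifold 𝓘(ℝ, E) 1 M := IsManifold.of_le (n := ∞) (by norm_cast)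
  have := isInvertible_mfderivWithin_extChartAt_symm (I := 𝓘(ℝ, E)) hy
  rwa [ModelWithCorners.range_eq_univ, mfderivWithin_univ] at this

lemma inChart_apply (g : LorentzianMetric E M) (x₀ : M) (y v w : E) :
    g.inChart x₀ y v w =
      g.form ((extChartAt 𝓘(ℝ, E) x₀).symm y) (chartFrame x₀ y v) (chartFrame x₀ y w) := rfl

lemma inChart_symm (g : LorentzianMetric E M) (x₀ : M) (y v w : E) :
    g.inChart x₀ y v w = g.inChart x₀ y w v := by
  rw [inChart_apply, inChart_apply]
  exact g.symm _ _ _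

variable {X : Type*} [NormedAddCommGroup X] [NormedSpace ℝ X]

/-- The differential of a map into `M`, in a chart. -/
lemma mfderiv_eq_chartFrame {F : X → M} {p : X} {x₀ : M}
    (hF : MDifferentiableAt 𝓘(ℝ, X) 𝓘(ℝ, E) F p) (hx : F p ∈ (chartAt E x₀).source) (w : X) :
    (mfderiv 𝓘(ℝ, X) 𝓘(ℝ, E) F p : X →L[ℝ] E) w =
      chartFrame x₀ (extChartAt 𝓘(ℝ, E) x₀ (F p)) (fderiv ℝ (fun q ↦ extChartAt 𝓘(ℝ, E) x₀ (F q)) p w) := by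
  have : IsManifold 𝓘(ℝ, E) 1 M := IsManifold.of_le (n := ∞) (by norm_cast)
  have h1 : MDifferentiableAt 𝓘(ℝ, E) 𝓘(ℝ, E) (extChartAt 𝓘(ℝ, E) x₀) (F p) := mdifferentiableAt_extChartAt hx
  have h2 : MDifferentiableAt 𝓘(ℝ, X) 𝓘(ℝ, E) (fun q ↦ extChartAt 𝓘(ℝ, E) x₀ (F q)) p :=
    MDifferentiableAt.comp p h1 hF
  have hy : extChartAt 𝓘(ℝ, E) x₀ (F p) ∈ (extChartAt 𝓘(ℝ, E) x₀).target := (extChartAt 𝓘(ℝ, E) x₀).map_source (mem_source_iff.2 hx)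
  have h3 : F =ᶠ[𝓝 p] (extChartAt 𝓘(ℝ, E) x₀).symm ∘ fun q ↦ extChartAt 𝓘(ℝ, E) x₀ (F q) := by
    have : ∀ᶠ q in 𝓝 p, F q ∈ (extChartAt 𝓘(ℝ, E) x₀).source :=
      hF.continuousAt.eventually ((isOpen_extChartAt_source x₀).mem_nhds (mem_source_iff.2 hx))
    filter_upwards [this] with q hq
    exact ((extChartAt 𝓘(ℝ, E) x₀).left_inv hq).symm
  have h4 := (mdifferentiableAt_ext_symm hy).hasMFDerivAt.comp p h2.hasMFDerivAt
  have h5 := (h4.congr_of_eventuallyEq h3).mfderiv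
  have h6 : (mfderiv 𝓘(ℝ, X) 𝓘(ℝ, E) F p : X →L[ℝ] E) =
    (chartFrame x₀ (extChartAt 𝓘(ℝ, E) x₀ (F p))).comp (fderiv ℝ (fun q ↦ extChartAt 𝓘(ℝ, E) x₀ (F q)) p) := by
    rw [← mfderiv_eq_fderiv]
    exact h5
  rw [h6]
  rfl

lemma form_mfderiv (g : LorentzianMetric E M) {F : X → M} {p : X} {x₀ : M}
    (hF : MDifferentiableAt 𝓘(ℝ, X) 𝓘(ℝ, E) F p) (hx : F p ∈ (chartAt E x₀).source) (v w : X) :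
    g.form (F p) ((mfderiv 𝓘(ℝ, X) 𝓘(ℝ, E) F p : X →L[ℝ] E) v)
      ((mfderiv 𝓘(ℝ, X) 𝓘(ℝ, E) F p : X →L[ℝ] E) w) =
    g.inChart x₀ (extChartAt 𝓘(ℝ, E) x₀ (F p)) (fderiv ℝ (fun q ↦ extChartAt 𝓘(ℝ, E) x₀ (F q)) p v)
      (fderiv ℝ (fun q ↦ extChartAt 𝓘(ℝ, E) x₀ (F q)) p w) := by
  rw [mfderiv_eq_chartFrame hF hx, mfderiv_eq_chartFrame hF hx, inChart_apply,
    (extChartAt 𝓘(ℝ, E) x₀).left_inv (mem_source_iff.2 hx)]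

/-- Each coefficient is the metric applied to two coordinate fields, which are smooth as images of
constant fields under the tangent map of the inverse chart. The pairing is a smooth section of a
trivial line bundle, from which the real function is read off. -/
lemma contDiffOn_inChart [FiniteDimensional ℝ E] (g : LorentzianMetric E M) (x₀ : M) :
    ContDiffOn ℝ ∞ (g.inChart x₀) (extChartAt 𝓘(ℝ, E) x₀).target := by
  have i1 : IsManifold 𝓘(ℝ, E) 1 M := IsManifold.of_le (n := ∞) (by norm_cast)
  have hb : ContMDiffOn 𝓘(ℝ, E) 𝓘(ℝ, E) ∞ (extChartAt 𝓘(ℝ, E) x₀).symm (extChartAt 𝓘(ℝ, E) x₀).target :=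
    contMDiffOn_extChartAt_symm x₀
  have hfield : ∀ v : E, ContMDiffOn 𝓘(ℝ, E) 𝓘(ℝ, E).tangent ∞
      (fun y ↦ (⟨(extChartAt 𝓘(ℝ, E) x₀).symm y, chartFrame x₀ y v⟩ : TangentBundle 𝓘(ℝ, E) M))
      (extChartAt 𝓘(ℝ, E) x₀).target := by
    intro v
    have h1 := hb.contMDiffOn_tangentMapWithin (m := ∞) (by simp)
      (isOpen_target x₀).uniqueMDiffOn
    have h2 : ContMDiff 𝓘(ℝ, E) 𝓘(ℝ, E).tangent ∞
        (fun y : E ↦ (⟨y, v⟩ : TangentBundle 𝓘(ℝ, E) E)) := fun y ↦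
      contMDiffAt_vectorSpace_iff_contDiffAt.2 contDiffAt_const
    have h3 := h1.comp h2.contMDiffOn (s := (extChartAt 𝓘(ℝ, E) x₀).target) (fun y hy ↦ hy)
    refine h3.congr fun y hy ↦ ?_
    simp only [Function.comp_apply, tangentMapWithin]
    rw [mfderivWithin_of_isOpen (isOpen_target x₀) hy]
    rfl
  rw [contDiffOn_clm_apply]
  intro v
  rw [contDiffOn_clm_apply]
  intro w
  rw [← contMDiffOn_iff_contDiffOn]
  intro y hy
  have h4 : ContMDiffWithinAt 𝓘(ℝ, E) (𝓘(ℝ, E).prod 𝓘(ℝ)) ∞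
      (fun y ↦ Bundle.TotalSpace.mk' ℝ (E := Bundle.Trivial M ℝ) ((extChartAt 𝓘(ℝ, E) x₀).symm y)
        (g.val ((extChartAt 𝓘(ℝ, E) x₀).symm y) (chartFrame x₀ y v) (chartFrame x₀ y w)))
      (extChartAt 𝓘(ℝ, E) x₀).target y := by
    apply ContMDiffWithinAt.clm_bundle_apply₂ (F₁ := E) (F₂ := E)
    · exact ContMDiffAt.comp_contMDiffWithinAt y g.contMDiff.contMDiffAt (hb y hy)
    · exact hfield v y hy
    · exact hfield w y hy
  simp only [Bundle.contMDiffWithinAt_totalSpace] at h4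
  exact h4.2

end Charts

end

end LorentzGeom

namespace LorentzGeom

noncomputable section

/-! ### Lorentzian linear algebra -/

section LinearAlgebra

variable {E : Type*} [NormedAddCommGroup E] [NormedSpace ℝ E]
  {M : Type*} [TopologicalSpace M] [ChartedSpace E M] [IsManifold 𝓘(ℝ, E) ∞ M]
  (g : LorentzianMetric E M)

lemma form_symm (x : M) (v w : E) : g.form x v w = g.form x w v := g.symm x v w

lemma form_signature (x : M) : ∃ v : E, g.form x v v < 0 ∧
    ∀ w : E, g.form x v w = 0 → w ≠ 0 → 0 < g.form x w w := g.signature x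

variable {g}

lemma eq_zero_of_form_eq_zero {x : M} {v : E} (h : ∀ w, g.form x v w = 0) : v = 0 := by
  obtain ⟨u, -, hu⟩ := form_signature g x
  by_contra hv
  have := hu v (by rw [form_symm]; exact h u) hv
  rw [h v] at this
  exact lt_irrefl _ this

/-- A nonzero vector orthogonal to a timelike vector is spacelike. -/
lemma form_pos_of_orthogonal {x : M} {T j : E} (hT : g.form x T T < 0) (h : g.form x T j = 0)
    (hj : j ≠ 0) : 0 < g.form x j j := by
  obtain ⟨u, hu0, hu⟩ := form_signature g x
  by_contra! hjj
  -- With these coefficients `a • T + b • j` is orthogonal to the timelike vector `u` of the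
  -- signature condition, yet its square is at most zero. So it is zero, `a = b = 0`, and then `T`
  -- itself is orthogonal to `u`, which is absurd for a timelike vector.
  set a := g.form x u j with ha
  set b := -g.form x u T with hb
  have hz : g.form x u (a • T + b • j) = 0 := by
    simp only [map_add, map_smul, smul_eq_mul, ha, hb]; ring
  have hzz : g.form x (a • T + b • j) (a • T + b • j) =
      a ^ 2 * g.form x T T + b ^ 2 * g.form x j j := by
    simp only [map_add, map_smul, smul_eq_mul, add_apply, smul_apply, h, form_symm g x j T]
    ring
  have hz0 : a • T + b • j = 0 := by
    by_contra hne
    have := hu _ hz hne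
    rw [hzz] at this
    nlinarith [sq_nonneg a, sq_nonneg b]
  have h1 : a * g.form x T T = 0 := by
    have : g.form x T (a • T + b • j) = 0 := by rw [hz0, map_zero]
    simpa [h] using this
  have ha0 : a = 0 := (mul_eq_zero.1 h1).resolve_right hT.ne
  have hb0 : b = 0 := by
    rw [ha0, zero_smul, zero_add] at hz0
    exact (smul_eq_zero.1 hz0).resolve_right hj
  have hT0 : T ≠ 0 := by rintro rfl; simp at hT
  have := hu T (by linarith) hT0
  linarith

lemma inChart_pos_of_orthogonal {x₀ : M} {y : E} (hy : y ∈ (extChartAt 𝓘(ℝ, E) x₀).target)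
    {T j : E} (hT : g.inChart x₀ y T T < 0) (h : g.inChart x₀ y T j = 0) (hj : j ≠ 0) :
    0 < g.inChart x₀ y j j := by
  refine form_pos_of_orthogonal (T := chartFrame x₀ y T) hT h ?_
  exact fun h0 ↦ hj ((chartFrame_isInvertible hy).injective
    ((show chartFrame x₀ y j = 0 from h0).trans (map_zero _).symm))

lemma inChart_isInvertible [FiniteDimensional ℝ E] {x₀ : M} {y : E}
    (hy : y ∈ (extChartAt 𝓘(ℝ, E) x₀).target) : (g.inChart x₀ y).IsInvertible := by
  have hinv := chartFrame_isInvertible hy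
  have hinj : Function.Injective (g.inChart x₀ y : E →ₗ[ℝ] (E →L[ℝ] ℝ)) := by
    rw [injective_iff_map_eq_zero]
    intro v hv
    have h1 : chartFrame x₀ y v = 0 := by
      refine eq_zero_of_form_eq_zero (g := g) (x := (extChartAt 𝓘(ℝ, E) x₀).symm y) fun w ↦ ?_
      obtain ⟨w', rfl⟩ := hinv.surjective w
      rw [← inChart_apply]
      have : g.inChart x₀ y v = 0 := hv
      rw [this]
      rfl
    exact hinv.injective (by rw [h1, map_zero])
  have hfin : Module.finrank ℝ E = Module.finrank ℝ (E →L[ℝ] ℝ) := by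
    rw [← (LinearMap.toContinuousLinearMap (𝕜 := ℝ) (E := E) (F' := ℝ)).finrank_eq]
    exact (Subspace.dual_finrank_eq (K := ℝ) (V := E)).symm
  let e := (LinearEquiv.ofInjectiveOfFinrankEq _ hinj hfin).toContinuousLinearEquiv
  exact ⟨e, by ext v w; rfl⟩

end LinearAlgebra

/-! ### Change of coordinates -/

section Transformation

variable {E : Type*} [NormedAddCommGroup E] [NormedSpace ℝ E]

/-- The transformation law of the Christoffel symbols. -/
lemma christoffel_pullback {G₀ G₁ : E → E →L[ℝ] E →L[ℝ] ℝ} {φ : E → E} {y : E}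
    (hφ : ContDiffAt ℝ ∞ φ y) (hG₁ : DifferentiableAt ℝ G₁ (φ y))
    (hs : ∀ v w, G₁ (φ y) v w = G₁ (φ y) w v) (hG₀ : DifferentiableAt ℝ G₀ y)
    (h : ∀ᶠ z in 𝓝 y, ∀ v w, G₀ z v w = G₁ (φ z) (fderiv ℝ φ z v) (fderiv ℝ φ z w))
    (u v w : E) :
    christoffel G₀ y u v w =
      christoffel G₁ (φ y) (fderiv ℝ φ y u) (fderiv ℝ φ y v) (fderiv ℝ φ y w) +
        G₁ (φ y) (fderiv ℝ (fderiv ℝ φ) y u v) (fderiv ℝ φ y w) := by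
  have hd : DifferentiableAt ℝ φ y := hφ.differentiableAt (by simp)
  have hd2 : DifferentiableAt ℝ (fderiv ℝ φ) y :=
    (hφ.fderiv_right (m := ∞) (by simp)).differentiableAt (by simp)
  have hsymm := hφ.isSymmSndFDerivAt (n := ∞)
    (by simp [minSmoothness_of_isRCLikeNormedField]; exact WithTop.coe_le_coe.2 (le_top : (2 : ℕ∞) ≤ ⊤))
  have key : ∀ u v w : E, fderiv ℝ G₀ y u v w =
      fderiv ℝ G₁ (φ y) (fderiv ℝ φ y u) (fderiv ℝ φ y v) (fderiv ℝ φ y w) +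
        G₁ (φ y) (fderiv ℝ (fderiv ℝ φ) y u v) (fderiv ℝ φ y w) +
        G₁ (φ y) (fderiv ℝ φ y v) (fderiv ℝ (fderiv ℝ φ) y u w) := by
    intro u v w
    have e1 : fderiv ℝ (fun z ↦ G₀ z v w) y u = fderiv ℝ G₀ y u v w := by
      rw [fderiv_bilin_apply hG₀ (differentiableAt_const v) (differentiableAt_const w)]
      simp
    have e2 : (fun z ↦ G₀ z v w) =ᶠ[𝓝 y]
        fun z ↦ G₁ (φ z) (fderiv ℝ φ z v) (fderiv ℝ φ z w) := h.mono fun z hz ↦ hz v w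
    have e3 : ∀ v : E, fderiv ℝ (fun z ↦ fderiv ℝ φ z v) y u = fderiv ℝ (fderiv ℝ φ) y u v := by
      intro v
      rw [fderiv_clm_apply hd2 (differentiableAt_const v)]
      simp
    rw [← e1, e2.fderiv_eq, fderiv_bilin_apply (B := fun z ↦ G₁ (φ z)) (hG₁.comp y hd)
      (hd2.clm_apply (differentiableAt_const v)) (hd2.clm_apply (differentiableAt_const w)), e3, e3,
      show (fun z ↦ G₁ (φ z)) = G₁ ∘ φ from rfl, fderiv_comp y hG₁ hd]
    rfl
  -- Six terms contain second derivatives of `φ`. By their symmetry four cancel, and the other two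
  -- coincide.
  simp only [christoffel, key]
  rw [hsymm.eq v u, hsymm.eq w u, hsymm.eq w v, hs (fderiv ℝ φ y v), hs (fderiv ℝ φ y u),
    hs (fderiv ℝ (fderiv ℝ φ) y u w)]
  rw [hs (fderiv ℝ φ y v)]
  ring

end Transformation

end

end LorentzGeom

namespace LorentzGeom

noncomputable section

/-! ### Curves in charts and independence of the geodesic equation of the chart -/

section Coordinates

variable {E : Type*} [NormedAddCommGroup E] [NormedSpace ℝ E]
  {M : Type*} [TopologicalSpace M] [ChartedSpace E M] [IsManifold 𝓘(ℝ, E) ∞ M]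
  {X : Type*} [NormedAddCommGroup X] [NormedSpace ℝ X]

omit [IsManifold 𝓘(ℝ, E) ∞ M] in
lemma isOpen_inter_preimage_source {F : X → M} {N : Set X} (hN : IsOpen N)
    (hF : ContMDiffOn 𝓘(ℝ, X) 𝓘(ℝ, E) ∞ F N) (x₀ : M) :
    IsOpen (N ∩ F ⁻¹' (chartAt E x₀).source) :=
  hF.continuousOn.isOpen_inter_preimage hN (chartAt E x₀).open_source

lemma contDiffOn_coord {F : X → M} {N : Set X} (hF : ContMDiffOn 𝓘(ℝ, X) 𝓘(ℝ, E) ∞ F N) (x₀ : M) :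
    ContDiffOn ℝ ∞ (fun q ↦ extChartAt 𝓘(ℝ, E) x₀ (F q)) (N ∩ F ⁻¹' (chartAt E x₀).source) := by
  rw [← contMDiffOn_iff_contDiffOn]
  exact (contMDiffOn_extChartAt (x := x₀)).comp (hF.mono inter_subset_left)
    fun q hq ↦ hq.2

lemma contMDiffOn_of_coord {y : X → E} {N : Set X} {x₀ : M} (hy : ContDiffOn ℝ ∞ y N)
    (hm : MapsTo y N (extChartAt 𝓘(ℝ, E) x₀).target) :
    ContMDiffOn 𝓘(ℝ, X) 𝓘(ℝ, E) ∞ (fun q ↦ (extChartAt 𝓘(ℝ, E) x₀).symm (y q)) N :=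
  (contMDiffOn_extChartAt_symm (n := ∞) x₀).comp hy.contMDiffOn hm

omit [IsManifold 𝓘(ℝ, E) ∞ M] in
lemma mdifferentiableAt_of_contMDiffOn {F : X → M} {N : Set X} (hN : IsOpen N)
    (hF : ContMDiffOn 𝓘(ℝ, X) 𝓘(ℝ, E) ∞ F N) {p : X} (hp : p ∈ N) :
    MDifferentiableAt 𝓘(ℝ, X) 𝓘(ℝ, E) F p :=
  (hF.contMDiffAt (hN.mem_nhds hp)).mdifferentiableAt (by simp)

/-- The coordinates of a curve in the chart at `x₀`. -/
def coord (x₀ : M) (c : ℝ → M) (t : ℝ) : E := extChartAt 𝓘(ℝ, E) x₀ (c t)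

lemma velocity_eq_chartFrame {c : ℝ → M} {t : ℝ} {x₀ : M}
    (hc : MDifferentiableAt 𝓘(ℝ, ℝ) 𝓘(ℝ, E) c t) (hx : c t ∈ (chartAt E x₀).source) :
    (velocity c t : E) = chartFrame x₀ (coord x₀ c t) (deriv (coord (E := E) x₀ c) t) :=
  mfderiv_eq_chartFrame hc hx 1

lemma form_velocity (g : LorentzianMetric E M) {c : ℝ → M} {t : ℝ} {x₀ : M}
    (hc : MDifferentiableAt 𝓘(ℝ, ℝ) 𝓘(ℝ, E) c t) (hx : c t ∈ (chartAt E x₀).source) :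
    g.form (c t) (velocity c t) (velocity c t) =
      g.inChart x₀ (coord x₀ c t) (deriv (coord x₀ c) t) (deriv (coord x₀ c) t) :=
  form_mfderiv g hc hx 1 1

/-- The change of coordinates from the chart at `x₀` to the chart at `x₁`. -/
def transition (E : Type*) [NormedAddCommGroup E] [NormedSpace ℝ E] {M : Type*} [TopologicalSpace M]
    [ChartedSpace E M] (x₀ x₁ : M) (y : E) : E :=
  extChartAt 𝓘(ℝ, E) x₁ ((extChartAt 𝓘(ℝ, E) x₀).symm y)

lemma transition_spec {x₀ x₁ : M} {x : M} (h₀ : x ∈ (chartAt E x₀).source)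
    (h₁ : x ∈ (chartAt E x₁).source) :
    ∃ V : Set E, IsOpen V ∧ extChartAt 𝓘(ℝ, E) x₀ x ∈ V ∧ V ⊆ (extChartAt 𝓘(ℝ, E) x₀).target ∧
      ContDiffOn ℝ ∞ (transition E x₀ x₁) V ∧
      (∀ y ∈ V, (extChartAt 𝓘(ℝ, E) x₁).symm (transition E x₀ x₁ y) =
        (extChartAt 𝓘(ℝ, E) x₀).symm y) ∧
      MapsTo (transition E x₀ x₁) V (extChartAt 𝓘(ℝ, E) x₁).target ∧
      ∀ y ∈ V, ∀ w, chartFrame x₀ y w =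
        chartFrame x₁ (transition E x₀ x₁ y) (fderiv ℝ (transition E x₀ x₁) y w) := by
  have hs : ContMDiffOn 𝓘(ℝ, E) 𝓘(ℝ, E) ∞ (extChartAt 𝓘(ℝ, E) x₀).symm
    (extChartAt 𝓘(ℝ, E) x₀).target := contMDiffOn_extChartAt_symm x₀
  refine ⟨_, isOpen_inter_preimage_source (isOpen_target x₀) hs x₁, ⟨?_, ?_⟩, inter_subset_left,
    contDiffOn_coord hs x₁, fun y hy ↦ ?_, fun y hy ↦ ?_, fun y hy w ↦ ?_⟩
  · exact (extChartAt 𝓘(ℝ, E) x₀).map_source (mem_source_iff.2 h₀)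
  · rwa [mem_preimage, (extChartAt 𝓘(ℝ, E) x₀).left_inv (mem_source_iff.2 h₀)]
  · exact (extChartAt 𝓘(ℝ, E) x₁).left_inv (mem_source_iff.2 hy.2)
  · exact (extChartAt 𝓘(ℝ, E) x₁).map_source (mem_source_iff.2 hy.2)
  · exact mfderiv_eq_chartFrame (mdifferentiableAt_ext_symm hy.1) hy.2 w

end Coordinates

section Geodesics

variable {E : Type*} [NormedAddCommGroup E] [NormedSpace ℝ E] [FiniteDimensional ℝ E]
  {M : Type*} [TopologicalSpace M] [ChartedSpace E M] [IsManifold 𝓘(ℝ, E) ∞ M]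
  {g : LorentzianMetric E M}

lemma differentiableAt_inChart {x₀ : M} {y : E} (hy : y ∈ (extChartAt 𝓘(ℝ, E) x₀).target) :
    DifferentiableAt ℝ (g.inChart x₀) y :=
  differentiableAt_of_contDiffOn (isOpen_target x₀) (contDiffOn_inChart g x₀) hy

variable (g) in
/-- The geodesic equation for the coordinates `y` of a curve in the chart at `x₀`. -/
def GeodesicEq (x₀ : M) (y : ℝ → E) (t : ℝ) : Prop :=
  ∀ w : E, g.inChart x₀ (y t) (deriv (deriv y) t) w +
    christoffel (g.inChart x₀) (y t) (deriv y t) (deriv y t) w = 0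

omit [FiniteDimensional ℝ E] in
lemma coord_derivs {c : ℝ → M} {J : Set ℝ} (hJ : IsOpen J)
    (hc : ContMDiffOn 𝓘(ℝ, ℝ) 𝓘(ℝ, E) ∞ c J) {x₀ : M} {t : ℝ} (ht : t ∈ J)
    (hx : c t ∈ (chartAt E x₀).source) :
    HasDerivAt (coord x₀ c) (deriv (coord (E := E) x₀ c) t) t ∧
    HasDerivAt (deriv (coord (E := E) x₀ c)) (deriv (deriv (coord (E := E) x₀ c)) t) t := by
  have ho := isOpen_inter_preimage_source hJ hc x₀
  have h1 := contDiffOn_coord hc x₀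
  have h2 : ContDiffOn ℝ ∞ (deriv (coord (E := E) x₀ c)) (J ∩ c ⁻¹' (chartAt E x₀).source) :=
    h1.deriv_of_isOpen ho (by simp)
  exact ⟨(differentiableAt_of_contDiffOn ho h1 ⟨ht, hx⟩).hasDerivAt,
    (differentiableAt_of_contDiffOn ho h2 ⟨ht, hx⟩).hasDerivAt⟩

/-- The geodesic equation does not depend on the chart. -/
lemma geodesicEq_of_geodesicEq {c : ℝ → M} {J : Set ℝ} (hJ : IsOpen J)
    (hc : ContMDiffOn 𝓘(ℝ, ℝ) 𝓘(ℝ, E) ∞ c J) {x₀ x₁ : M} {t : ℝ} (ht : t ∈ J)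
    (h₀ : c t ∈ (chartAt E x₀).source) (h₁ : c t ∈ (chartAt E x₁).source)
    (h : GeodesicEq g x₀ (coord x₀ c) t) : GeodesicEq g x₁ (coord x₁ c) t := by
  obtain ⟨V, hV, hcV, hVt, hφ, hφs, hφm, hφf⟩ := transition_spec (E := E) h₀ h₁
  set φ := transition E x₀ x₁ with hφdef
  set y := coord (E := E) x₀ c with hy
  set z := coord (E := E) x₁ c with hz
  have hytV : y t ∈ V := hcV
  obtain ⟨hd1, hd2⟩ := coord_derivs (E := E) hJ hc ht h₀
  have hφt : DifferentiableAt ℝ φ (y t) := differentiableAt_of_contDiffOn hV hφ hytV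
  have hDφ : ContDiffOn ℝ ∞ (fderiv ℝ φ) V := hφ.fderiv_of_isOpen hV (by simp)
  have hev : ∀ᶠ r in 𝓝 t, z r = φ (y r) ∧ HasDerivAt y (deriv y r) r ∧ y r ∈ V := by
    have hsub := (isOpen_inter_preimage_source hJ hc x₀).mem_nhds ⟨ht, h₀⟩
    filter_upwards [hsub, hd1.continuousAt.eventually (hV.mem_nhds hytV)] with r hr hrV
    refine ⟨?_, (coord_derivs (E := E) hJ hc hr.1 hr.2).1, hrV⟩
    simp only [hz, hy, coord, hφdef, transition]
    rw [(extChartAt 𝓘(ℝ, E) x₀).left_inv (mem_source_iff.2 hr.2)]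
  have hz' : ∀ᶠ r in 𝓝 t, HasDerivAt z (fderiv ℝ φ (y r) (deriv y r)) r := by
    filter_upwards [hev.eventually_nhds] with r hr
    have h1 := hr.self_of_nhds
    refine ((differentiableAt_of_contDiffOn hV hφ h1.2.2).hasFDerivAt.comp_hasDerivAt r
      h1.2.1).congr_of_eventuallyEq ?_
    filter_upwards [hr] with q hq using hq.1
  have hzt := hev.self_of_nhds.1
  have e1 : deriv z t = fderiv ℝ φ (y t) (deriv y t) := hz'.self_of_nhds.deriv
  have e2 : deriv (deriv z) t = fderiv ℝ (fderiv ℝ φ) (y t) (deriv y t) (deriv y t) +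
      fderiv ℝ φ (y t) (deriv (deriv y) t) := by
    have h1 : deriv z =ᶠ[𝓝 t] fun r ↦ fderiv ℝ φ (y r) (deriv y r) := by
      filter_upwards [hz'] with r hr using hr.deriv
    rw [h1.deriv_eq]
    exact (((differentiableAt_of_contDiffOn hV hDφ hytV).hasFDerivAt.comp_hasDerivAt t
      hd1).clm_apply hd2).deriv
  have hmetric : ∀ q ∈ V, ∀ v w, g.inChart x₀ q v w =
      g.inChart x₁ (φ q) (fderiv ℝ φ q v) (fderiv ℝ φ q w) := by
    intro q hq v w
    rw [inChart_apply, inChart_apply, hφf q hq, hφf q hq]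
    rw [hφs q hq]
  intro w
  -- The differential of the coordinate change is onto, since both chart frames are invertible;
  -- hence it suffices to test the new equation on its image.
  have hsurj : ∃ w₀, fderiv ℝ φ (y t) w₀ = w := by
    obtain ⟨w₀, hw₀⟩ := (chartFrame_isInvertible (hVt hytV)).surjective (chartFrame x₁ (φ (y t)) w)
    refine ⟨w₀, (chartFrame_isInvertible (hφm hytV)).injective ?_⟩
    rw [← hφf _ hytV, hw₀]
  obtain ⟨w₀, rfl⟩ := hsurj
  have h2 := h w₀
  rw [christoffel_pullback (hφ.contDiffAt (hV.mem_nhds hytV))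
    (differentiableAt_inChart (hφm hytV)) (inChart_symm g x₁ _)
    (differentiableAt_inChart (hVt hytV)) (eventually_of_mem (hV.mem_nhds hytV) hmetric),
    hmetric _ hytV] at h2
  rw [hzt, e1, e2, map_add, add_apply]
  linarith

end Geodesics

end

end LorentzGeom

namespace LorentzGeom

noncomputable section

/-! ### The geodesic flow in a chart and uniqueness of geodesics -/

section Spray

variable {E : Type*} [NormedAddCommGroup E] [NormedSpace ℝ E]

/-- The inverse of a field of nondegenerate bilinear forms. -/
def raiseIndex (G : E → E →L[ℝ] E →L[ℝ] ℝ) (y : E) : (E →L[ℝ] ℝ) →L[ℝ] E :=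
  ContinuousLinearMap.inverse (G y)

lemma apply_raiseIndex {G : E → E →L[ℝ] E →L[ℝ] ℝ} {y : E} (h : (G y).IsInvertible)
    (α : E →L[ℝ] ℝ) : G y (raiseIndex G y α) = α := by
  obtain ⟨e, he⟩ := h
  rw [raiseIndex, ← he, ContinuousLinearMap.inverse_equiv]
  exact e.apply_symm_apply α

lemma eq_raiseIndex_iff {G : E → E →L[ℝ] E →L[ℝ] ℝ} {y : E} (h : (G y).IsInvertible)
    (v : E) (α : E →L[ℝ] ℝ) : v = raiseIndex G y α ↔ ∀ w, G y v w = α w := by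
  constructor
  · rintro rfl w
    rw [apply_raiseIndex h]
  · intro hv
    refine h.injective ?_
    rw [apply_raiseIndex h]
    ext w
    exact hv w

lemma contDiffOn_raiseIndex [FiniteDimensional ℝ E] {G : E → E →L[ℝ] E →L[ℝ] ℝ} {U : Set E}
    (hG : ContDiffOn ℝ ∞ G U) (hinv : ∀ y ∈ U, (G y).IsInvertible) :
    ContDiffOn ℝ ∞ (raiseIndex G) U := by
  intro y hy
  obtain ⟨e, he⟩ := hinv y hy
  have h := contDiffAt_map_inverse (𝕜 := ℝ) (n := ∞) e
  rw [he] at h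
  exact h.comp_contDiffWithinAt y (hG y hy)

/-- The linear form `w ↦ Γ(v,v;w)`. -/
def christoffelForm (G : E → E →L[ℝ] E →L[ℝ] ℝ) (z : E × E) : E →L[ℝ] ℝ :=
  fderiv ℝ G z.1 z.2 z.2 - (2⁻¹ : ℝ) • ((fderiv ℝ G z.1).flip z.2).flip z.2

lemma christoffelForm_apply (G : E → E →L[ℝ] E →L[ℝ] ℝ) (z : E × E) (w : E) :
    christoffelForm G z w = christoffel G z.1 z.2 z.2 w := by
  simp only [christoffelForm, christoffel, sub_apply, smul_apply, smul_eq_mul,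
    ContinuousLinearMap.flip_apply]
  ring

/-- The vector field on `E × E` whose integral curves are the geodesics and their velocities. -/
def spray (G : E → E →L[ℝ] E →L[ℝ] ℝ) (z : E × E) : E × E :=
  (z.2, -raiseIndex G z.1 (christoffelForm G z))

lemma contDiffOn_spray [FiniteDimensional ℝ E] {G : E → E →L[ℝ] E →L[ℝ] ℝ} {U : Set E}
    (hU : IsOpen U) (hG : ContDiffOn ℝ ∞ G U) (hinv : ∀ y ∈ U, (G y).IsInvertible) :
    ContDiffOn ℝ ∞ (spray G) (U ×ˢ univ) := by
  have h1 : ContDiffOn ℝ ∞ (fun z : E × E ↦ raiseIndex G z.1) (U ×ˢ univ) :=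
    (contDiffOn_raiseIndex hG hinv).comp contDiffOn_fst fun z hz ↦ hz.1
  have h2 : ContDiffOn ℝ ∞ (fun z : E × E ↦ fderiv ℝ G z.1) (U ×ˢ univ) :=
    (hG.fderiv_of_isOpen hU (by simp)).comp contDiffOn_fst fun z hz ↦ hz.1
  have h3 : ContDiffOn ℝ ∞ (christoffelForm G) (U ×ˢ univ) := by
    rw [contDiffOn_clm_apply]
    intro w
    have e : (fun z ↦ christoffelForm G z w) =
        fun z : E × E ↦ fderiv ℝ G z.1 z.2 z.2 w - 2⁻¹ * fderiv ℝ G z.1 w z.2 z.2 := rfl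
    rw [e]
    exact (((h2.clm_apply contDiffOn_snd).clm_apply contDiffOn_snd).clm_apply
      contDiffOn_const).sub (contDiffOn_const.mul
        (((h2.clm_apply contDiffOn_const).clm_apply contDiffOn_snd).clm_apply contDiffOn_snd))
  exact contDiffOn_snd.prodMk (h1.clm_apply h3).neg

end Spray

section Geodesics

variable {E : Type*} [NormedAddCommGroup E] [NormedSpace ℝ E] [FiniteDimensional ℝ E]
  {M : Type*} [TopologicalSpace M] [ChartedSpace E M] [IsManifold 𝓘(ℝ, E) ∞ M]
  {g : LorentzianMetric E M}

lemma contDiffOn_spray_inChart (g : LorentzianMetric E M) (x₀ : M) :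
    ContDiffOn ℝ ∞ (spray (g.inChart x₀)) ((extChartAt 𝓘(ℝ, E) x₀).target ×ˢ univ) :=
  contDiffOn_spray (isOpen_target x₀) (contDiffOn_inChart g x₀) fun _ hy ↦ inChart_isInvertible hy

lemma geodesicEq_iff {x₀ : M} {y : ℝ → E} {t : ℝ} (hy : y t ∈ (extChartAt 𝓘(ℝ, E) x₀).target) :
    GeodesicEq g x₀ y t ↔ deriv (deriv y) t = (spray (g.inChart x₀) (y t, deriv y t)).2 := by
  rw [spray, ← neg_eq_iff_eq_neg, eq_raiseIndex_iff (inChart_isInvertible hy)]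
  refine forall_congr' fun w ↦ ?_
  rw [christoffelForm_apply, map_neg, neg_apply]
  constructor <;> intro h <;> linarith

omit [FiniteDimensional ℝ E] in
lemma IsGeodesicOn.mono {c : ℝ → M} {J K : Set ℝ} (h : IsGeodesicOn g c J) (hK : K ⊆ J) :
    IsGeodesicOn g c K :=
  ⟨h.1.mono hK, fun x₀ t ht ↦ h.2 x₀ t (hK ht)⟩

omit [FiniteDimensional ℝ E] [IsManifold 𝓘(ℝ, E) ∞ M] in
lemma velocity_congr {c d : ℝ → M} {t : ℝ} (h : c =ᶠ[𝓝 t] d) :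
    (velocity c t : E) = (velocity d t : E) := by
  have := h.mfderiv_eq (I := 𝓘(ℝ, ℝ)) (I' := 𝓘(ℝ, E))
  simp only [velocity]
  exact congrArg (fun L : ℝ →L[ℝ] E ↦ L 1) this

omit [FiniteDimensional ℝ E] in
/-- Being a geodesic is a local property. -/
lemma isGeodesicOn_of_local {c : ℝ → M} {J : Set ℝ}
    (h : ∀ t ∈ J, ∃ d : ℝ → M, ∃ K ∈ 𝓝 t, IsGeodesicOn g d K ∧ c =ᶠ[𝓝 t] d) :
    IsGeodesicOn g c J := by
  refine ⟨fun t ht ↦ ?_, fun x₀ t ht hx ↦ ?_⟩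
  · obtain ⟨d, K, hK, hd, hcd⟩ := h t ht
    exact ((hd.1.contMDiffAt hK).congr_of_eventuallyEq hcd).contMDiffWithinAt
  · obtain ⟨d, K, hK, hd, hcd⟩ := h t ht
    have h0 : c t = d t := hcd.self_of_nhds
    have h1 : coord (E := E) x₀ c =ᶠ[𝓝 t] coord x₀ d := hcd.fun_comp (extChartAt 𝓘(ℝ, E) x₀)
    have h2 := hd.2 x₀ t (mem_of_mem_nhds hK) (h0 ▸ hx)
    intro w
    have e1 := h1.deriv.deriv_eq
    have e2 := h1.deriv_eq
    have e3 := h1.self_of_nhds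
    have := h2 w
    simp only [coord] at e1 e2 e3
    change g.inChart x₀ (extChartAt 𝓘(ℝ, E) x₀ (c t))
        (deriv (deriv fun s ↦ extChartAt 𝓘(ℝ, E) x₀ (c s)) t) w +
      christoffel (g.inChart x₀) (extChartAt 𝓘(ℝ, E) x₀ (c t))
        (deriv (fun s ↦ extChartAt 𝓘(ℝ, E) x₀ (c s)) t)
        (deriv (fun s ↦ extChartAt 𝓘(ℝ, E) x₀ (c s)) t) w = 0
    rw [e3]
    have e1' : deriv (deriv fun s ↦ extChartAt 𝓘(ℝ, E) x₀ (c s)) t =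
      deriv (deriv fun s ↦ extChartAt 𝓘(ℝ, E) x₀ (d s)) t := e1
    have e2' : deriv (fun s ↦ extChartAt 𝓘(ℝ, E) x₀ (c s)) t =
      deriv (fun s ↦ extChartAt 𝓘(ℝ, E) x₀ (d s)) t := e2
    rw [e1', e2']
    exact this

/-- The position and the velocity of a geodesic solve the geodesic flow equation. -/
lemma hasDerivAt_phase {c : ℝ → M} {J : Set ℝ} (hJ : IsOpen J) (hc : IsGeodesicOn g c J)
    {x₀ : M} {t : ℝ} (ht : t ∈ J) (hx : c t ∈ (chartAt E x₀).source) :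
    HasDerivAt (fun r ↦ (coord x₀ c r, deriv (coord (E := E) x₀ c) r))
      (spray (g.inChart x₀) (coord x₀ c t, deriv (coord (E := E) x₀ c) t)) t := by
  obtain ⟨h1, h2⟩ := coord_derivs (E := E) hJ hc.1 ht hx
  have hy : coord (E := E) x₀ c t ∈ (extChartAt 𝓘(ℝ, E) x₀).target :=
    (extChartAt 𝓘(ℝ, E) x₀).map_source (mem_source_iff.2 hx)
  have h3 := (geodesicEq_iff hy).1 (hc.2 x₀ t ht hx)
  rw [h3] at h2
  exact h1.prodMk h2

/-- The solutions of the geodesic flow equation in a chart give geodesics. -/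
lemma isGeodesicOn_of_spray {x₀ : M} {φ : ℝ → E × E} {J : Set ℝ} (hJ : IsOpen J)
    (hφ : ContDiffOn ℝ ∞ φ J) (hm : ∀ t ∈ J, (φ t).1 ∈ (extChartAt 𝓘(ℝ, E) x₀).target)
    (h : ∀ t ∈ J, HasDerivAt φ (spray (g.inChart x₀) (φ t)) t) :
    IsGeodesicOn g (fun t ↦ (extChartAt 𝓘(ℝ, E) x₀).symm (φ t).1) J ∧
    ∀ t ∈ J, (velocity (fun t ↦ (extChartAt 𝓘(ℝ, E) x₀).symm (φ t).1) t : E) =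
      chartFrame x₀ (φ t).1 (φ t).2 := by
  set c : ℝ → M := fun t ↦ (extChartAt 𝓘(ℝ, E) x₀).symm (φ t).1 with hc
  have hsm : ContMDiffOn 𝓘(ℝ, ℝ) 𝓘(ℝ, E) ∞ c J :=
    contMDiffOn_of_coord (contDiff_fst.comp_contDiffOn hφ) hm
  have hsrc : ∀ t ∈ J, c t ∈ (chartAt E x₀).source := fun t ht ↦
    mem_source_iff.1 ((extChartAt 𝓘(ℝ, E) x₀).map_target (hm t ht))
  have hco : ∀ t ∈ J, coord (E := E) x₀ c t = (φ t).1 := fun t ht ↦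
    (extChartAt 𝓘(ℝ, E) x₀).right_inv (hm t ht)
  have hco' : ∀ t ∈ J, coord (E := E) x₀ c =ᶠ[𝓝 t] fun r ↦ (φ r).1 := fun t ht ↦
    eventually_of_mem (hJ.mem_nhds ht) hco
  have hd1 : ∀ t ∈ J, deriv (coord (E := E) x₀ c) t = (φ t).2 := fun t ht ↦ by
    rw [(hco' t ht).deriv_eq]
    exact (hasFDerivAt_fst.comp_hasDerivAt t (h t ht)).deriv
  have hd2 : ∀ t ∈ J, deriv (deriv (coord (E := E) x₀ c)) t = (spray (g.inChart x₀) (φ t)).2 :=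
    fun t ht ↦ by
      have : deriv (coord (E := E) x₀ c) =ᶠ[𝓝 t] fun r ↦ (φ r).2 :=
        eventually_of_mem (hJ.mem_nhds ht) hd1
      rw [this.deriv_eq]
      exact (hasFDerivAt_snd.comp_hasDerivAt t (h t ht)).deriv
  refine ⟨⟨hsm, fun x₁ t ht hx₁ ↦ ?_⟩, fun t ht ↦ ?_⟩
  · refine geodesicEq_of_geodesicEq hJ hsm ht (hsrc t ht) hx₁ ?_
    rw [geodesicEq_iff (by rw [hco t ht]; exact hm t ht), hd2 t ht, hco t ht, hd1 t ht]
  · rw [velocity_eq_chartFrame (mdifferentiableAt_of_contMDiffOn hJ hsm ht) (hsrc t ht), hco t ht,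
      hd1 t ht]

omit [FiniteDimensional ℝ E] in
-- The chart frame at the common point is invertible, so velocities in the tangent space and in
-- coordinates carry the same information.
lemma deriv_coord_eq {c d : ℝ → M} {J K : Set ℝ} (hJ : IsOpen J) (hK : IsOpen K)
    (hc : ContMDiffOn 𝓘(ℝ, ℝ) 𝓘(ℝ, E) ∞ c J) (hd : ContMDiffOn 𝓘(ℝ, ℝ) 𝓘(ℝ, E) ∞ d K) {x₀ : M}
    {t : ℝ} (htJ : t ∈ J) (htK : t ∈ K) (hx : c t ∈ (chartAt E x₀).source) (h : c t = d t) :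
    deriv (coord (E := E) x₀ c) t = deriv (coord (E := E) x₀ d) t ↔
      (velocity c t : E) = (velocity d t : E) := by
  rw [velocity_eq_chartFrame (mdifferentiableAt_of_contMDiffOn hJ hc htJ) hx,
    velocity_eq_chartFrame (mdifferentiableAt_of_contMDiffOn hK hd htK) (h ▸ hx)]
  have e : coord (E := E) x₀ c t = coord x₀ d t := by simp only [coord, h]
  rw [e]
  refine ⟨fun h ↦ by rw [h], fun h' ↦ ?_⟩
  refine (chartFrame_isInvertible ?_).injective h'
  exact (extChartAt 𝓘(ℝ, E) x₀).map_source (mem_source_iff.2 (h ▸ hx))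

/-- In a chart both curves, with their velocities, solve the same first-order equation with a
locally Lipschitz right side. -/
lemma eventuallyEq_of_velocity_eq {c d : ℝ → M} {J K : Set ℝ} (hJ : IsOpen J) (hK : IsOpen K)
    (hc : IsGeodesicOn g c J) (hd : IsGeodesicOn g d K) {t : ℝ} (htJ : t ∈ J) (htK : t ∈ K)
    (h : c t = d t) (hv : (velocity c t : E) = (velocity d t : E)) : c =ᶠ[𝓝 t] d := by
  obtain ⟨x₀, hx⟩ : ∃ x₀ : M, c t ∈ (chartAt E x₀).source := ⟨c t, mem_chart_source E _⟩
  have hdx : d t ∈ (chartAt E x₀).source := h ▸ hx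
  have hv' := (deriv_coord_eq hJ hK hc.1 hd.1 htJ htK hx h).2 hv
  have hy : coord (E := E) x₀ c t ∈ (extChartAt 𝓘(ℝ, E) x₀).target :=
    (extChartAt 𝓘(ℝ, E) x₀).map_source (mem_source_iff.2 hx)
  have hsp : ContDiffAt ℝ 1 (spray (g.inChart x₀))
      (coord x₀ c t, deriv (coord (E := E) x₀ c) t) :=
    ((contDiffOn_spray_inChart g x₀).contDiffAt
      (((isOpen_target x₀).prod isOpen_univ).mem_nhds ⟨hy, mem_univ _⟩)).of_le (by norm_cast)
  obtain ⟨L, s, hs, hL⟩ := hsp.exists_lipschitzOnWith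
  have hphase : ∀ {c : ℝ → M} {J : Set ℝ}, IsOpen J → IsGeodesicOn g c J → t ∈ J →
      c t ∈ (chartAt E x₀).source → s ∈ 𝓝 (coord x₀ c t, deriv (coord (E := E) x₀ c) t) →
      ∀ᶠ r in 𝓝 t, HasDerivAt (fun r ↦ (coord x₀ c r, deriv (coord (E := E) x₀ c) r))
        (spray (g.inChart x₀) (coord x₀ c r, deriv (coord (E := E) x₀ c) r)) r ∧
        (coord x₀ c r, deriv (coord (E := E) x₀ c) r) ∈ s := by
    intro c J hJ hc ht hx hs
    filter_upwards [(isOpen_inter_preimage_source hJ hc.1 x₀).mem_nhds ⟨ht, hx⟩,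
      (hasDerivAt_phase hJ hc ht hx).continuousAt.eventually hs] with r hr hrs
    exact ⟨hasDerivAt_phase hJ hc hr.1 hr.2, hrs⟩
  have e : coord (E := E) x₀ c t = coord x₀ d t := by simp only [coord, h]
  have key := ODE_solution_unique_of_eventually (v := fun _ ↦ spray (g.inChart x₀)) (s := fun _ ↦ s)
    (Eventually.of_forall fun _ ↦ hL) (hphase hJ hc htJ hx hs)
    (hphase hK hd htK hdx (by rwa [← e, ← hv'])) (by rw [e, hv'])
  filter_upwards [key, (isOpen_inter_preimage_source hJ hc.1 x₀).mem_nhds ⟨htJ, hx⟩,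
    (isOpen_inter_preimage_source hK hd.1 x₀).mem_nhds ⟨htK, hdx⟩] with r hr h1 h2
  exact (extChartAt 𝓘(ℝ, E) x₀).injOn (mem_source_iff.2 h1.2) (mem_source_iff.2 h2.2)
    (Prod.ext_iff.1 hr).1

/-- Uniqueness of geodesics. -/
lemma eqOn_of_velocity_eq [T2Space M] {c d : ℝ → M} {J : Set ℝ} (hJ : IsOpen J)
    (hJ' : J.OrdConnected) (hc : IsGeodesicOn g c J) (hd : IsGeodesicOn g d J) {t₀ : ℝ}
    (ht₀ : t₀ ∈ J) (h : c t₀ = d t₀) (hv : (velocity c t₀ : E) = (velocity d t₀ : E)) :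
    EqOn c d J := by
  have hsub : J ⊆ {t | c =ᶠ[𝓝 t] d} := by
    -- The set of times near which the curves agree is open. It is closed in `J` because positions
    -- and coordinate velocities agree in the limit, and local uniqueness restarts there.
    refine hJ'.isPreconnected.subset_of_closure_inter_subset isOpen_setOfPred_eventually_nhds
      ⟨t₀, ht₀, eventuallyEq_of_velocity_eq hJ hJ hc hd ht₀ ht₀ h hv⟩ ?_
    rintro t ⟨htc, ht⟩
    have hf : ∃ᶠ r in 𝓝 t, c =ᶠ[𝓝 r] d := mem_closure_iff_frequently.1 htc
    have hct := hc.1.continuousOn.continuousAt (hJ.mem_nhds ht)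
    have hdt := hd.1.continuousOn.continuousAt (hJ.mem_nhds ht)
    have h0 : c t = d t := tendsto_nhds_unique_of_frequently_eq hct hdt
      (hf.mono fun r hr ↦ hr.self_of_nhds)
    have hx : c t ∈ (chartAt E (c t)).source := mem_chart_source E _
    refine eventuallyEq_of_velocity_eq hJ hJ hc hd ht ht h0
      ((deriv_coord_eq hJ hJ hc.1 hd.1 ht ht hx h0).1 ?_)
    refine tendsto_nhds_unique_of_frequently_eq
      (coord_derivs (E := E) hJ hc.1 ht hx).2.continuousAt
      (coord_derivs (E := E) hJ hd.1 ht (h0 ▸ hx)).2.continuousAt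
      (hf.mono fun r hr ↦ ?_)
    exact (hr.fun_comp (extChartAt 𝓘(ℝ, E) (c t))).deriv_eq
  exact fun t ht ↦ (hsub ht).self_of_nhds

end Geodesics

end

end LorentzGeom

namespace LorentzGeom

noncomputable section

/-! ### Affine reparametrization, constant speed and the Gauss lemma -/

section Reparametrization

variable {E : Type*} [NormedAddCommGroup E] [NormedSpace ℝ E]
  {M : Type*} [TopologicalSpace M] [ChartedSpace E M] [IsManifold 𝓘(ℝ, E) ∞ M]
  {g : LorentzianMetric E M}

lemma deriv_comp_affine (f : ℝ → E) (a μ r : ℝ) :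
    deriv (fun r ↦ f (a + μ * r)) r = μ • deriv f (a + μ * r) := by
  rw [deriv_comp_mul_left μ (fun x ↦ f (a + x)) r, deriv_comp_const_add]

lemma contMDiff_affine (a μ : ℝ) : ContMDiff 𝓘(ℝ, ℝ) 𝓘(ℝ, ℝ) ∞ (fun r : ℝ ↦ a + μ * r) :=
  ContDiff.contMDiff (by fun_prop)

/-- Both terms of the geodesic equation are multiplied by `μ ^ 2`, so any `μ` is allowed, including
the negative one needed when `c` is past-directed. -/
lemma IsGeodesicOn.comp_affine {c : ℝ → M} {J : Set ℝ} (hc : IsGeodesicOn g c J) (a μ : ℝ) :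
    IsGeodesicOn g (fun r ↦ c (a + μ * r)) {r | a + μ * r ∈ J} := by
  refine ⟨hc.1.comp (contMDiff_affine a μ).contMDiffOn fun r hr ↦ hr, fun x₀ r hr hx w ↦ ?_⟩
  have h := hc.2 x₀ (a + μ * r) hr hx w
  set y : ℝ → E := fun s ↦ extChartAt 𝓘(ℝ, E) x₀ (c s)
  have e1 : deriv (fun r ↦ y (a + μ * r)) = fun r ↦ μ • deriv y (a + μ * r) :=
    funext fun r ↦ deriv_comp_affine y a μ r
  have e2 : deriv (fun r ↦ μ • deriv y (a + μ * r)) r = μ • μ • deriv (deriv y) (a + μ * r) := by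
    rw [deriv_fun_const_smul_field, deriv_comp_affine]
  change g.inChart x₀ (y (a + μ * r)) (deriv (deriv fun r ↦ y (a + μ * r)) r) w +
    christoffel (g.inChart x₀) (y (a + μ * r)) (deriv (fun r ↦ y (a + μ * r)) r)
      (deriv (fun r ↦ y (a + μ * r)) r) w = 0
  change g.inChart x₀ (y (a + μ * r)) (deriv (deriv y) (a + μ * r)) w +
    christoffel (g.inChart x₀) (y (a + μ * r)) (deriv y (a + μ * r))
      (deriv y (a + μ * r)) w = 0 at h
  rw [e1, e2]
  simp only [christoffel, map_smul, smul_apply, smul_eq_mul] at h ⊢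
  linear_combination μ ^ 2 * h

lemma velocity_comp_affine {c : ℝ → M} {a μ r : ℝ}
    (hc : MDifferentiableAt 𝓘(ℝ, ℝ) 𝓘(ℝ, E) c (a + μ * r)) :
    (velocity (fun r ↦ c (a + μ * r)) r : E) = μ • (velocity c (a + μ * r) : E) := by
  have hx : c (a + μ * r) ∈ (chartAt E (c (a + μ * r))).source := mem_chart_source E _
  have h1 : MDifferentiableAt 𝓘(ℝ, ℝ) 𝓘(ℝ, E) (fun r ↦ c (a + μ * r)) r :=
    MDifferentiableAt.comp r hc ((contMDiff_affine a μ r).mdifferentiableAt (by simp))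
  have e1 := velocity_eq_chartFrame h1 hx
  have e2 := velocity_eq_chartFrame hc hx
  have e3 : deriv (coord (E := E) (c (a + μ * r)) fun r ↦ c (a + μ * r)) r =
      μ • deriv (coord (E := E) (c (a + μ * r)) c) (a + μ * r) :=
    deriv_comp_affine (coord (E := E) (c (a + μ * r)) c) a μ r
  rw [e1, e2, e3, map_smul]
  rfl

end Reparametrization

section Speed

variable {E : Type*} [NormedAddCommGroup E] [NormedSpace ℝ E] [FiniteDimensional ℝ E]
  {M : Type*} [TopologicalSpace M] [ChartedSpace E M] [IsManifold 𝓘(ℝ, E) ∞ M]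
  {g : LorentzianMetric E M}

lemma eq_of_hasDerivAt_zero {f : ℝ → ℝ} {J : Set ℝ} (hJ : IsOpen J) (hJ' : J.OrdConnected)
    (hf : ∀ t ∈ J, HasDerivAt f 0 t) {a b : ℝ} (ha : a ∈ J) (hb : b ∈ J) : f a = f b :=
  hJ.is_const_of_deriv_eq_zero hJ'.isPreconnected
    (fun t ht ↦ (hf t ht).differentiableAt.differentiableWithinAt) (fun t ht ↦ (hf t ht).deriv)
    ha hb

/-- Geodesics have constant speed. -/
lemma form_velocity_eq {c : ℝ → M} {J : Set ℝ} (hJ : IsOpen J)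
    (hJ' : J.OrdConnected) (hc : IsGeodesicOn g c J) {a b : ℝ} (ha : a ∈ J) (hb : b ∈ J) :
    g.form (c a) (velocity c a) (velocity c a) = g.form (c b) (velocity c b) (velocity c b) := by
  refine eq_of_hasDerivAt_zero (f := fun t ↦ g.form (c t) (velocity c t) (velocity c t))
    hJ hJ' (fun t ht ↦ ?_) ha hb
  have hx : c t ∈ (chartAt E (c t)).source := mem_chart_source E _
  set x₀ := c t
  obtain ⟨h1, h2⟩ := coord_derivs (E := E) hJ hc.1 ht hx
  have hy : coord (E := E) x₀ c t ∈ (extChartAt 𝓘(ℝ, E) x₀).target :=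
    (extChartAt 𝓘(ℝ, E) x₀).map_source (mem_source_iff.2 hx)
  have hgeo : GeodesicEq g x₀ (coord x₀ c) t := hc.2 x₀ t ht hx
  have h3 := hasDerivAt_metric_geodesic (isOpen_target x₀) (contDiffOn_inChart g x₀)
    (fun z _ ↦ inChart_symm g x₀ z) hy h1 h2 h2 hgeo
  -- The derivative of the squared speed, given by the first variation formula with the velocity as
  -- the field, is precisely the geodesic equation tested against the velocity.
  have h4 := hgeo (deriv (coord x₀ c) t)
  refine (h3.congr_of_eventuallyEq ?_).congr_deriv ?_
  · filter_upwards [(isOpen_inter_preimage_source hJ hc.1 x₀).mem_nhds ⟨ht, hx⟩] with r hr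
    exact form_velocity g (mdifferentiableAt_of_contMDiffOn hJ hc.1 hr.1) hr.2
  · simp only [christoffel] at h4
    linarith

end Speed

section Gauss

variable {E : Type*} [NormedAddCommGroup E] [NormedSpace ℝ E]
  {M : Type*} [TopologicalSpace M] [ChartedSpace E M] [IsManifold 𝓘(ℝ, E) ∞ M]
  {g : LorentzianMetric E M}
  {P : Type*} [NormedAddCommGroup P] [NormedSpace ℝ P]

omit [IsManifold 𝓘(ℝ, E) ∞ M] in
/-- The velocity of the curves `t ↦ F (t, p)`. -/
lemma velocity_slice {F : ℝ × P → M} {q : ℝ × P}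
    (hF : MDifferentiableAt 𝓘(ℝ, ℝ × P) 𝓘(ℝ, E) F q) :
    MDifferentiableAt 𝓘(ℝ, ℝ) 𝓘(ℝ, E) (fun t ↦ F (t, q.2)) q.1 ∧
    (velocity (fun t ↦ F (t, q.2)) q.1 : E) =
      (mfderiv 𝓘(ℝ, ℝ × P) 𝓘(ℝ, E) F q : ℝ × P →L[ℝ] E) (1, 0) := by
  have hd : HasFDerivAt (fun t : ℝ ↦ (t, q.2)) (ContinuousLinearMap.inl ℝ ℝ P) q.1 :=
    hasFDerivAt_prodMk_left q.1 q.2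
  have h1 : HasMFDerivAt 𝓘(ℝ, ℝ) 𝓘(ℝ, ℝ × P) (fun t : ℝ ↦ (t, q.2)) q.1
    (ContinuousLinearMap.inl ℝ ℝ P) := hd.hasMFDerivAt
  have h2 := HasMFDerivAt.comp q.1 (g := F) (f := fun t : ℝ ↦ (t, q.2)) hF.hasMFDerivAt h1
  refine ⟨h2.mdifferentiableAt, ?_⟩
  have h3 := h2.mfderiv
  have h4 : (mfderiv 𝓘(ℝ, ℝ) 𝓘(ℝ, E) (fun t ↦ F (t, q.2)) q.1 : ℝ →L[ℝ] E) =
    (mfderiv 𝓘(ℝ, ℝ × P) 𝓘(ℝ, E) F q : ℝ × P →L[ℝ] E).comp (ContinuousLinearMap.inl ℝ ℝ P) := h3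
  have h5 : (velocity (fun t ↦ F (t, q.2)) q.1 : E) =
    (mfderiv 𝓘(ℝ, ℝ) 𝓘(ℝ, E) (fun t ↦ F (t, q.2)) q.1 : ℝ →L[ℝ] E) 1 := rfl
  rw [h5, h4]
  rfl

/-- The geodesic equation for a one-parameter family of geodesics, in a chart. -/
lemma geodesic_dt {F : ℝ × ℝ → M} {I K : Set ℝ} (hI : IsOpen I) (hK : IsOpen K)
    (hF : ContMDiffOn 𝓘(ℝ, ℝ × ℝ) 𝓘(ℝ, E) ∞ F (I ×ˢ K))
    (hgeo : ∀ u ∈ K, IsGeodesicOn g (fun t ↦ F (t, u)) I) {x₀ : M} {q : ℝ × ℝ} (hq : q ∈ I ×ˢ K)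
    (hx : F q ∈ (chartAt E x₀).source) (w : E) :
    g.inChart x₀ (extChartAt 𝓘(ℝ, E) x₀ (F q))
        (dt (dt fun q ↦ extChartAt 𝓘(ℝ, E) x₀ (F q)) q) w
      + christoffel (g.inChart x₀) (extChartAt 𝓘(ℝ, E) x₀ (F q))
          (dt (fun q ↦ extChartAt 𝓘(ℝ, E) x₀ (F q)) q)
          (dt (fun q ↦ extChartAt 𝓘(ℝ, E) x₀ (F q)) q) w = 0 := by
  set y : ℝ × ℝ → E := fun q ↦ extChartAt 𝓘(ℝ, E) x₀ (F q) with hy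
  have hR := isOpen_inter_preimage_source (hI.prod hK) hF x₀
  have hys := contDiffOn_coord hF x₀
  have h := (hgeo q.2 hq.2).2 x₀ q.1 hq.1 hx w
  have e1 : ∀ r ∈ (I ×ˢ K) ∩ F ⁻¹' (chartAt E x₀).source,
      deriv (fun t ↦ y (t, r.2)) r.1 = dt y r := fun r hr ↦
    (hasDerivAt_dt (p := r) (differentiableAt_of_contDiffOn hR hys hr)).deriv
  have e2 : deriv (fun t ↦ y (t, q.2)) =ᶠ[𝓝 q.1] fun t ↦ dt y (t, q.2) := by
    have hc : ContinuousAt (fun t : ℝ ↦ (t, q.2)) q.1 := by fun_prop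
    filter_upwards [hc.eventually (hR.mem_nhds (x := (q.1, q.2)) ⟨hq, hx⟩)] with t ht
    exact e1 _ ht
  have e3 : deriv (deriv fun t ↦ y (t, q.2)) q.1 = dt (dt y) q := by
    rw [e2.deriv_eq]
    exact (hasDerivAt_dt (p := q)
      (differentiableAt_of_contDiffOn hR (contDiffOn_dt hR hys) ⟨hq, hx⟩)).deriv
  have h' : g.inChart x₀ (y q) (deriv (deriv fun t ↦ y (t, q.2)) q.1) w +
    christoffel (g.inChart x₀) (y q) (deriv (fun t ↦ y (t, q.2)) q.1)
      (deriv (fun t ↦ y (t, q.2)) q.1) w = 0 := h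
  rwa [e3, e1 q ⟨hq, hx⟩] at h'

/-- The Gauss lemma: in a one-parameter family of geodesics of the same speed, the product of the
velocity and the variation field is constant along each geodesic. -/
lemma gauss [FiniteDimensional ℝ E] {F : ℝ × ℝ → M} {I K : Set ℝ} (hI : IsOpen I)
    (hI' : I.OrdConnected) (hK : IsOpen K)
    (hF : ContMDiffOn 𝓘(ℝ, ℝ × ℝ) 𝓘(ℝ, E) ∞ F (I ×ˢ K))
    (hgeo : ∀ u ∈ K, IsGeodesicOn g (fun t ↦ F (t, u)) I) {a κ : ℝ} (ha : a ∈ I)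
    (hκ : ∀ u ∈ K, g.form (F (a, u)) ((mfderiv 𝓘(ℝ, ℝ × ℝ) 𝓘(ℝ, E) F (a, u) : ℝ × ℝ →L[ℝ] E) (1, 0))
      ((mfderiv 𝓘(ℝ, ℝ × ℝ) 𝓘(ℝ, E) F (a, u) : ℝ × ℝ →L[ℝ] E) (1, 0)) = κ) {t u : ℝ} (ht : t ∈ I)
    (hu : u ∈ K) :
    g.form (F (t, u)) ((mfderiv 𝓘(ℝ, ℝ × ℝ) 𝓘(ℝ, E) F (t, u) : ℝ × ℝ →L[ℝ] E) (0, 1))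
      ((mfderiv 𝓘(ℝ, ℝ × ℝ) 𝓘(ℝ, E) F (t, u) : ℝ × ℝ →L[ℝ] E) (1, 0)) =
    g.form (F (a, u)) ((mfderiv 𝓘(ℝ, ℝ × ℝ) 𝓘(ℝ, E) F (a, u) : ℝ × ℝ →L[ℝ] E) (0, 1))
      ((mfderiv 𝓘(ℝ, ℝ × ℝ) 𝓘(ℝ, E) F (a, u) : ℝ × ℝ →L[ℝ] E) (1, 0)) := by
  have hmd : ∀ q ∈ I ×ˢ K, MDifferentiableAt 𝓘(ℝ, ℝ × ℝ) 𝓘(ℝ, E) F q := fun q hq ↦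
    mdifferentiableAt_of_contMDiffOn (hI.prod hK) hF hq
  have hκ' : ∀ q ∈ I ×ˢ K, g.form (F q) ((mfderiv 𝓘(ℝ, ℝ × ℝ) 𝓘(ℝ, E) F q : ℝ × ℝ →L[ℝ] E) (1, 0))
      ((mfderiv 𝓘(ℝ, ℝ × ℝ) 𝓘(ℝ, E) F q : ℝ × ℝ →L[ℝ] E) (1, 0)) = κ := by
    rintro ⟨r, v⟩ hq
    rw [← hκ v hq.2, ← (velocity_slice (hmd (r, v) hq)).2,
      ← (velocity_slice (hmd (a, v) ⟨ha, hq.2⟩)).2]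
    exact form_velocity_eq hI hI' (hgeo v hq.2) hq.1 ha
  refine eq_of_hasDerivAt_zero (f := fun t ↦ g.form (F (t, u))
    ((mfderiv 𝓘(ℝ, ℝ × ℝ) 𝓘(ℝ, E) F (t, u) : ℝ × ℝ →L[ℝ] E) (0, 1))
    ((mfderiv 𝓘(ℝ, ℝ × ℝ) 𝓘(ℝ, E) F (t, u) : ℝ × ℝ →L[ℝ] E) (1, 0))) hI hI' (fun r hr ↦ ?_) ht ha
  have hx : F (r, u) ∈ (chartAt E (F (r, u))).source := mem_chart_source E _
  set x₀ := F (r, u)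
  set y : ℝ × ℝ → E := fun q ↦ extChartAt 𝓘(ℝ, E) x₀ (F q) with hy
  have hR := isOpen_inter_preimage_source (hI.prod hK) hF x₀
  have hys := contDiffOn_coord hF x₀
  have hq : (r, u) ∈ (I ×ˢ K) ∩ F ⁻¹' (chartAt E x₀).source := ⟨⟨hr, hu⟩, hx⟩
  have hyt : y (r, u) ∈ (extChartAt 𝓘(ℝ, E) x₀).target :=
    (extChartAt 𝓘(ℝ, E) x₀).map_source (mem_source_iff.2 hx)
  have d1 := differentiableAt_of_contDiffOn hR hys hq
  have d2 := differentiableAt_of_contDiffOn hR (contDiffOn_dt hR hys) hq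
  have d3 := differentiableAt_of_contDiffOn hR (contDiffOn_du hR hys) hq
  have h3 := hasDerivAt_metric_geodesic (isOpen_target x₀) (contDiffOn_inChart g x₀)
    (fun z _ ↦ inChart_symm g x₀ z) (c := fun t ↦ y (t, u)) (T := fun t ↦ dt y (t, u))
    (X := fun t ↦ du y (t, u)) (t := r) hyt (hasDerivAt_dt (p := (r, u)) d1)
    (hasDerivAt_dt (p := (r, u)) d2) (hasDerivAt_dt (p := (r, u)) d3)
    (geodesic_dt hI hK hF hgeo hq.1 hx)
  refine (h3.congr_of_eventuallyEq ?_).congr_deriv ?_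
  · have hc : ContinuousAt (fun t : ℝ ↦ (t, u)) r := by fun_prop
    filter_upwards [hc.eventually (hR.mem_nhds hq)] with t ht
    exact form_mfderiv g (hmd _ ht.1) ht.2 (0, 1) (1, 0)
  · have h7 : HasDerivAt (fun v ↦ g.inChart x₀ (y (r, v)))
        (fderiv ℝ (g.inChart x₀) (y (r, u)) (du y (r, u))) u :=
      (differentiableAt_inChart (g := g) hyt).hasFDerivAt.comp_hasDerivAt (f := fun v ↦ y (r, v)) u
        (hasDerivAt_du (p := (r, u)) d1)
    have h4 := hasDerivAt_bilin_apply (B := fun v ↦ g.inChart x₀ (y (r, v)))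
      (a := fun v ↦ dt y (r, v)) (b := fun v ↦ dt y (r, v)) (t := u)
      h7 (hasDerivAt_du (p := (r, u)) d2) (hasDerivAt_du (p := (r, u)) d2)
    -- The speed does not depend on `u`, so the `u`-derivative of `⟨∂ₜ, ∂ₜ⟩` vanishes; it is twice
    -- the `t`-derivative of `⟨∂ᵤ, ∂ₜ⟩` found above.
    have h5 : (fun v ↦ g.inChart x₀ (y (r, v)) (dt y (r, v)) (dt y (r, v))) =ᶠ[𝓝 u] fun _ ↦ κ := by
      have hc : ContinuousAt (fun v : ℝ ↦ (r, v)) u := by fun_prop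
      filter_upwards [hc.eventually (hR.mem_nhds hq)] with v hv
      rw [← hκ' _ hv.1]
      exact (form_mfderiv g (hmd _ hv.1) hv.2 (1, 0) (1, 0)).symm
    have h6 := (h4.congr_of_eventuallyEq h5.symm).unique (hasDerivAt_const u κ)
    rw [inChart_symm g x₀ _ (dt y (r, u)) (du (dt y) (r, u)), ← dt_du_comm hR hys hq] at h6
    linarith

end Gauss

end

end LorentzGeom

namespace LorentzGeom

noncomputable section

/-! ### Smooth families of geodesics over long time intervals -/

section Families

variable {E : Type*} [NormedAddCommGroup E] [NormedSpace ℝ E]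
  {M : Type*} [TopologicalSpace M] [ChartedSpace E M] [IsManifold 𝓘(ℝ, E) ∞ M]

/-- `Y` is a smooth family of geodesics defined on the interval `I`, parametrized by their
positions and velocities at time `a`, in the chart at `x₀`. -/
structure IsGeodesicFamily (g : LorentzianMetric E M) (x₀ : M) (a : ℝ) (I : Set ℝ)
    (N : Set (E × E)) (Y : ℝ × (E × E) → M) : Prop where
  isOpen_time : IsOpen I
  ordConnected : I.OrdConnected
  mem_time : a ∈ I
  isOpen_param : IsOpen N
  smooth : ContMDiffOn 𝓘(ℝ, ℝ × (E × E)) 𝓘(ℝ, E) ∞ Y (I ×ˢ N)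
  geodesic : ∀ p ∈ N, IsGeodesicOn g (fun t ↦ Y (t, p)) I
  target : ∀ p ∈ N, p.1 ∈ (extChartAt 𝓘(ℝ, E) x₀).target
  initial : ∀ p ∈ N, Y (a, p) = (extChartAt 𝓘(ℝ, E) x₀).symm p.1
  velocity : ∀ p ∈ N, (velocity (fun t ↦ Y (t, p)) a : E) = chartFrame x₀ p.1 p.2

/-- The position and the velocity at time `T` of the geodesic with parameter `p`, in the chart
at `x₁`. -/
def phase (x₁ : M) (Y : ℝ × (E × E) → M) (T : ℝ) (p : E × E) : E × E :=
  (extChartAt 𝓘(ℝ, E) x₁ (Y (T, p)),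
    fderiv ℝ (fun q ↦ extChartAt 𝓘(ℝ, E) x₁ (Y q)) (T, p) (1, 0))

variable {g : LorentzianMetric E M} {x₀ : M} {a : ℝ} {I : Set ℝ} {N : Set (E × E)}
  {Y : ℝ × (E × E) → M}

namespace IsGeodesicFamily

variable (H : IsGeodesicFamily g x₀ a I N Y)
include H

lemma isOpen_prod : IsOpen (I ×ˢ N) := H.isOpen_time.prod H.isOpen_param

lemma mdifferentiableAt {q : ℝ × (E × E)} (hq : q ∈ I ×ˢ N) :
    MDifferentiableAt 𝓘(ℝ, ℝ × (E × E)) 𝓘(ℝ, E) Y q :=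
  mdifferentiableAt_of_contMDiffOn H.isOpen_prod H.smooth hq

lemma isOpen_phase_domain (x₁ : M) {T : ℝ} (hT : T ∈ I) :
    IsOpen {p ∈ N | Y (T, p) ∈ (chartAt E x₁).source} := by
  have h := (isOpen_inter_preimage_source H.isOpen_prod H.smooth x₁).preimage
    (f := fun p : E × E ↦ (T, p)) (by fun_prop)
  convert h using 1
  ext p
  simp [hT]

lemma contDiffOn_phase (x₁ : M) {T : ℝ} (hT : T ∈ I) :
    ContDiffOn ℝ ∞ (phase x₁ Y T) {p ∈ N | Y (T, p) ∈ (chartAt E x₁).source} := by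
  have ho := isOpen_inter_preimage_source H.isOpen_prod H.smooth x₁
  have h1 := contDiffOn_coord H.smooth x₁
  have h2 := h1.fderiv_of_isOpen ho (m := ∞) (by simp)
  have h3 : ContDiffOn ℝ ∞ (fun p : E × E ↦ (T, p)) {p ∈ N | Y (T, p) ∈ (chartAt E x₁).source} :=
    by fun_prop
  have hm : MapsTo (fun p : E × E ↦ (T, p)) {p ∈ N | Y (T, p) ∈ (chartAt E x₁).source}
    ((I ×ˢ N) ∩ Y ⁻¹' (chartAt E x₁).source) := fun p hp ↦ ⟨⟨hT, hp.1⟩, hp.2⟩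
  exact (h1.comp h3 hm).prodMk ((h2.comp h3 hm).clm_apply contDiffOn_const)

lemma phase_eq (x₁ : M) {T : ℝ} (hT : T ∈ I) {p : E × E} (hp : p ∈ N)
    (hx : Y (T, p) ∈ (chartAt E x₁).source) :
    (extChartAt 𝓘(ℝ, E) x₁).symm (phase x₁ Y T p).1 = Y (T, p) ∧
    chartFrame x₁ (phase x₁ Y T p).1 (phase x₁ Y T p).2 =
      (LorentzGeom.velocity (fun t ↦ Y (t, p)) T : E) := by
  refine ⟨(extChartAt 𝓘(ℝ, E) x₁).left_inv (mem_source_iff.2 hx), ?_⟩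
  have hq : (T, p) ∈ I ×ˢ N := ⟨hT, hp⟩
  rw [(velocity_slice (H.mdifferentiableAt hq)).2,
    mfderiv_eq_chartFrame (H.mdifferentiableAt hq) hx]
  rfl

lemma phase_self {p : E × E} (hp : p ∈ N) : phase x₀ Y a p = p := by
  have hsrc : Y (a, p) ∈ (chartAt E x₀).source := by
    rw [H.initial p hp]
    exact mem_source_iff.1 ((extChartAt 𝓘(ℝ, E) x₀).map_target (H.target p hp))
  have h := H.phase_eq x₀ H.mem_time hp hsrc
  have h1 : (phase x₀ Y a p).1 = p.1 := by
    simp only [phase]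
    rw [H.initial p hp, (extChartAt 𝓘(ℝ, E) x₀).right_inv (H.target p hp)]
  refine Prod.ext h1 ((chartFrame_isInvertible (H.target p hp)).injective ?_)
  rw [← H.velocity p hp, ← h.2, h1]

variable [FiniteDimensional ℝ E] [T2Space M]

/-- The geodesics of two families agree where both are defined. -/
lemma eqOn {x₁ : M} {T : ℝ} {I' : Set ℝ} {N' : Set (E × E)} {Z : ℝ × (E × E) → M}
    (H' : IsGeodesicFamily g x₁ T I' N' Z) (hT : T ∈ I) {p : E × E} (hp : p ∈ N)
    (hx : Y (T, p) ∈ (chartAt E x₁).source) (hp' : phase x₁ Y T p ∈ N') :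
    EqOn (fun t ↦ Y (t, p)) (fun t ↦ Z (t, phase x₁ Y T p)) (I ∩ I') := by
  obtain ⟨h1, h2⟩ := H.phase_eq x₁ hT hp hx
  refine eqOn_of_velocity_eq (H.isOpen_time.inter H'.isOpen_time)
    (H.ordConnected.inter H'.ordConnected) ((H.geodesic p hp).mono inter_subset_left)
    ((H'.geodesic _ hp').mono inter_subset_right) ⟨hT, H'.mem_time⟩ ?_ ?_
  · rw [H'.initial _ hp', h1]
  · rw [H'.velocity _ hp', h2]

open Classical in
/-- Extension of a family of geodesics in time. -/
lemma extend {x₁ : M} {T : ℝ} {I' : Set ℝ} {N' : Set (E × E)} {Z : ℝ × (E × E) → M}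
    (H' : IsGeodesicFamily g x₁ T I' N' Z) (hT : T ∈ I) {p₀ : E × E} (hp₀ : p₀ ∈ N)
    (hx : Y (T, p₀) ∈ (chartAt E x₁).source) (hp₀' : phase x₁ Y T p₀ ∈ N') :
    ∃ N₂ Y₂, p₀ ∈ N₂ ∧ IsGeodesicFamily g x₀ a (I ∪ I') N₂ Y₂ := by
  set D := {p ∈ N | Y (T, p) ∈ (chartAt E x₁).source} with hD
  set N₂ := D ∩ phase x₁ Y T ⁻¹' N' with hN₂
  have hDo : IsOpen D := H.isOpen_phase_domain x₁ hT
  have hN₂o : IsOpen N₂ :=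
    (H.contDiffOn_phase x₁ hT).continuousOn.isOpen_inter_preimage hDo H'.isOpen_param
  have hN₂N : N₂ ⊆ N := fun p hp ↦ hp.1.1
  -- Outside `I` the geodesic is restarted from its position and velocity at time `T`. Agreement on
  -- the overlap of the time intervals makes `Y₂` locally equal to one of two smooth maps, while the
  -- parameters remain those at time `a`.
  set Y₂ : ℝ × (E × E) → M := fun q ↦ if q.1 ∈ I then Y q else Z (q.1, phase x₁ Y T q.2) with hY₂
  have e1 : ∀ q, q.1 ∈ I → Y₂ q = Y q := fun q hq ↦ if_pos hq
  have e2 : ∀ q, q.1 ∈ I' → q.2 ∈ N₂ → Y₂ q = Z (q.1, phase x₁ Y T q.2) := by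
    rintro ⟨t, p⟩ ht hp
    by_cases h : t ∈ I
    · rw [e1 _ h]
      exact H.eqOn H' hT hp.1.1 hp.1.2 hp.2 ⟨h, ht⟩
    · exact if_neg h
  have hloc1 : ∀ q ∈ I ×ˢ N₂, Y₂ =ᶠ[𝓝 q] Y := fun q hq ↦ by
    filter_upwards [(H.isOpen_time.prod hN₂o).mem_nhds hq] with r hr using e1 r hr.1
  have hloc2 : ∀ q ∈ I' ×ˢ N₂, Y₂ =ᶠ[𝓝 q] fun q ↦ Z (q.1, phase x₁ Y T q.2) := fun q hq ↦ by
    filter_upwards [(H'.isOpen_time.prod hN₂o).mem_nhds hq] with r hr using e2 r hr.1 hr.2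
  have hZ : ContMDiffOn 𝓘(ℝ, ℝ × (E × E)) 𝓘(ℝ, E) ∞ (fun q ↦ Z (q.1, phase x₁ Y T q.2))
      (I' ×ˢ N₂) := by
    have h1 : ContDiffOn ℝ ∞ (fun q : ℝ × (E × E) ↦ (q.1, phase x₁ Y T q.2)) (I' ×ˢ N₂) :=
      contDiffOn_fst.prodMk ((H.contDiffOn_phase x₁ hT).comp contDiffOn_snd fun q hq ↦ hq.2.1)
    exact H'.smooth.comp h1.contMDiffOn fun q hq ↦ ⟨hq.1, hq.2.2⟩
  have hline : ∀ (t : ℝ) (p : E × E), Tendsto (fun r : ℝ ↦ (r, p)) (𝓝 t) (𝓝 (t, p)) := fun t p ↦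
    ContinuousAt.tendsto (f := fun r : ℝ ↦ (r, p)) (by fun_prop)
  refine ⟨N₂, Y₂, ⟨⟨hp₀, hx⟩, hp₀'⟩, ⟨H.isOpen_time.union H'.isOpen_time, ?_, Or.inl H.mem_time,
    hN₂o, ?_, ?_, fun p hp ↦ H.target p (hN₂N hp), ?_, ?_⟩⟩
  · exact (H.ordConnected.isPreconnected.union T hT H'.mem_time
      H'.ordConnected.isPreconnected).ordConnected
  · rintro q ⟨hq | hq, hq2⟩
    · exact ((H.smooth.contMDiffAt (H.isOpen_prod.mem_nhds ⟨hq, hN₂N hq2⟩)).congr_of_eventuallyEq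
        (hloc1 q ⟨hq, hq2⟩)).contMDiffWithinAt
    · exact ((hZ.contMDiffAt ((H'.isOpen_time.prod hN₂o).mem_nhds ⟨hq, hq2⟩)).congr_of_eventuallyEq
        (hloc2 q ⟨hq, hq2⟩)).contMDiffWithinAt
  · intro p hp
    refine isGeodesicOn_of_local ?_
    rintro t (ht | ht)
    · exact ⟨_, I, H.isOpen_time.mem_nhds ht, H.geodesic p (hN₂N hp),
        (hline t p).eventually (hloc1 (t, p) ⟨ht, hp⟩)⟩
    · exact ⟨_, I', H'.isOpen_time.mem_nhds ht, H'.geodesic _ hp.2,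
        (hline t p).eventually (hloc2 (t, p) ⟨ht, hp⟩)⟩
  · intro p hp
    rw [e1 _ H.mem_time, H.initial p (hN₂N hp)]
  · intro p hp
    rw [← H.velocity p (hN₂N hp)]
    exact velocity_congr ((hline a p).eventually (hloc1 (a, p) ⟨H.mem_time, hp⟩))

end IsGeodesicFamily

/-- The geodesic flow is autonomous, so one `ε` and one `N` serve every starting time `a`. The
continuation argument needs this uniformity to step across a limit time. -/
lemma exists_local_geodesicFamily [FiniteDimensional ℝ E] (g : LorentzianMetric E M) (x₀ : M)
    {p₀ : E × E} (hp₀ : p₀.1 ∈ (extChartAt 𝓘(ℝ, E) x₀).target) :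
    ∃ ε > 0, ∃ N, p₀ ∈ N ∧ ∃ Z : ℝ × (E × E) → M, ∀ a : ℝ,
      IsGeodesicFamily g x₀ a (Ioo (a - ε) (a + ε)) N fun q ↦ Z (q.1 - a, q.2) := by
  obtain ⟨ε, hε, N, hN, hpN, φ, hφ, hφ0, hφd⟩ := exists_smooth_local_flow
    ((isOpen_target x₀).prod isOpen_univ) (contDiffOn_spray_inChart g x₀)
    (x₀ := p₀) ⟨hp₀, mem_univ _⟩
  refine ⟨ε, hε, N, hpN, fun q ↦ (extChartAt 𝓘(ℝ, E) x₀).symm (φ q).1, fun a ↦ ?_⟩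
  have hI : ∀ {t}, t ∈ Ioo (a - ε) (a + ε) → t - a ∈ Ioo (-ε) ε := fun ht ↦
    ⟨by linarith [ht.1], by linarith [ht.2]⟩
  have ha : a ∈ Ioo (a - ε) (a + ε) := ⟨by linarith, by linarith⟩
  have hsm : ContDiffOn ℝ ∞ (fun q : ℝ × (E × E) ↦ φ (q.1 - a, q.2)) (Ioo (a - ε) (a + ε) ×ˢ N) :=
    hφ.comp (by fun_prop) fun q hq ↦ ⟨hI hq.1, hq.2⟩
  have hgeo : ∀ p ∈ N, _ := fun p hp ↦ isGeodesicOn_of_spray (g := g) (x₀ := x₀)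
    (φ := fun t ↦ φ (t - a, p)) (J := Ioo (a - ε) (a + ε)) isOpen_Ioo
    (hsm.comp (f := fun t : ℝ ↦ (t, p)) (by fun_prop) fun t ht ↦ ⟨ht, hp⟩)
    (fun t ht ↦ (hφd _ (hI ht) p hp).1.1)
    (fun t ht ↦ HasDerivAt.comp_sub_const (f := fun r ↦ φ (r, p)) t a (hφd _ (hI ht) p hp).2)
  refine ⟨isOpen_Ioo, ordConnected_Ioo, ha, hN, ?_, fun p hp ↦ (hgeo p hp).1, fun p hp ↦ ?_,
    fun p hp ↦ ?_, fun p hp ↦ ?_⟩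
  · exact contMDiffOn_of_coord (contDiff_fst.comp_contDiffOn hsm)
      fun q hq ↦ (hφd _ (hI hq.1) _ hq.2).1.1
  · have := (hφd 0 ⟨by linarith, hε⟩ p hp).1.1
    rwa [hφ0 p hp] at this
  · simp only [sub_self]
    rw [hφ0 p hp]
  · refine ((hgeo p hp).2 a ha).trans ?_
    simp only [sub_self]
    rw [hφ0 p hp]

/-- A geodesic belongs to a smooth family of geodesics defined on a given compact interval. -/
theorem exists_geodesicFamily [FiniteDimensional ℝ E] [T2Space M] {c : ℝ → M} {J : Set ℝ}
    (hJ : IsOpen J) (hJ' : J.OrdConnected) (hc : IsGeodesicOn g c J) {a s : ℝ} (ha : a ∈ J)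
    (hs : s ∈ J) (hx : c a ∈ (chartAt E x₀).source) :
    ∃ I N Y, s ∈ I ∧ (coord x₀ c a, deriv (coord (E := E) x₀ c) a) ∈ N ∧
      IsGeodesicFamily g x₀ a I N Y ∧
      EqOn (fun t ↦ Y (t, (coord x₀ c a, deriv (coord (E := E) x₀ c) a))) c (I ∩ J) := by
  set p₀ : E × E := (coord x₀ c a, deriv (coord (E := E) x₀ c) a) with hp₀
  have hEq : ∀ {I N Y}, p₀ ∈ N → IsGeodesicFamily g x₀ a I N Y →
      EqOn (fun t ↦ Y (t, p₀)) c (I ∩ J) := by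
    intro I N Y hpN H
    refine eqOn_of_velocity_eq (H.isOpen_time.inter hJ) (H.ordConnected.inter hJ')
      ((H.geodesic p₀ hpN).mono inter_subset_left) (hc.mono inter_subset_right)
      ⟨H.mem_time, ha⟩ ?_ ?_
    · rw [H.initial p₀ hpN]
      exact (extChartAt 𝓘(ℝ, E) x₀).left_inv (mem_source_iff.2 hx)
    · rw [H.velocity p₀ hpN, velocity_eq_chartFrame (mdifferentiableAt_of_contMDiffOn hJ hc.1 ha) hx]
  set A : Set ℝ := {s | ∃ I N Y, s ∈ I ∧ p₀ ∈ N ∧ IsGeodesicFamily g x₀ a I N Y} with hA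
  suffices h : J ⊆ A by
    obtain ⟨I, N, Y, hsI, hpN, H⟩ := h hs
    exact ⟨I, N, Y, hsI, hpN, H, hEq hpN H⟩
  -- The times reachable by some family around `c` form an open set containing `a`; it remains to
  -- see that it is closed in `J`.
  refine hJ'.isPreconnected.subset_of_closure_inter_subset ?_ ?_ ?_
  · rw [isOpen_iff_mem_nhds]
    rintro t ⟨I, N, Y, htI, hpN, H⟩
    filter_upwards [H.isOpen_time.mem_nhds htI] with r hr
    exact ⟨I, N, Y, hr, hpN, H⟩
  · have hy : p₀.1 ∈ (extChartAt 𝓘(ℝ, E) x₀).target :=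
      (extChartAt 𝓘(ℝ, E) x₀).map_source (mem_source_iff.2 hx)
    obtain ⟨ε, hε, N, hN, Z, hZ⟩ := exists_local_geodesicFamily g x₀ hy
    exact ⟨a, ha, _, _, _, (hZ a).mem_time, hN, hZ a⟩
  · rintro T ⟨hTA, hT⟩
    set x₁ := c T
    have hxT : c T ∈ (chartAt E x₁).source := mem_chart_source E _
    have hy : coord (E := E) x₁ c T ∈ (extChartAt 𝓘(ℝ, E) x₁).target :=
      (extChartAt 𝓘(ℝ, E) x₁).map_source (mem_source_iff.2 hxT)
    obtain ⟨ε, hε, N', hN', Z, hZ⟩ := exists_local_geodesicFamily g x₁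
      (p₀ := (coord x₁ c T, deriv (coord (E := E) x₁ c) T)) hy
    obtain ⟨h1, h2⟩ := coord_derivs (E := E) hJ hc.1 hT hxT
    -- For `r` close to the limit time `T`, the position and velocity of `c` at `r` are admissible
    -- parameters of the local family at `c T`, and its interval around `r` contains `T`. A
    -- reachable such `r` allows an extension past `T`.
    have hev : ∀ᶠ r in 𝓝 T, r ∈ J ∧ c r ∈ (chartAt E x₁).source ∧
        (coord x₁ c r, deriv (coord (E := E) x₁ c) r) ∈ N' ∧ T ∈ Ioo (r - ε) (r + ε) := by
      filter_upwards [(isOpen_inter_preimage_source hJ hc.1 x₁).mem_nhds ⟨hT, hxT⟩,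
        (h1.continuousAt.prodMk h2.continuousAt).eventually ((hZ 0).isOpen_param.mem_nhds hN'),
        Ioo_mem_nhds (show T - ε < T by linarith) (show T < T + ε by linarith)] with r hr hr2 hr3
      exact ⟨hr.1, hr.2, hr2, by linarith [hr3.2], by linarith [hr3.1]⟩
    obtain ⟨T₁, ⟨I, N, Y, hT₁, hpN, H⟩, hT₁J, hT₁x, hT₁N, hT₁ε⟩ :=
      ((mem_closure_iff_frequently.1 hTA).and_eventually hev).exists
    have heq := hEq hpN H
    have heq1 : Y (T₁, p₀) = c T₁ := heq ⟨hT₁, hT₁J⟩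
    have hx1 : Y (T₁, p₀) ∈ (chartAt E x₁).source := by rw [heq1]; exact hT₁x
    have hph : phase x₁ Y T₁ p₀ = (coord x₁ c T₁, deriv (coord (E := E) x₁ c) T₁) := by
      have h3 := H.phase_eq x₁ hT₁ hpN hx1
      have h4 : (phase x₁ Y T₁ p₀).1 = coord x₁ c T₁ := by simp only [phase, coord, heq1]
      refine Prod.ext h4 ((chartFrame_isInvertible
        ((extChartAt 𝓘(ℝ, E) x₁).map_source (mem_source_iff.2 hT₁x))).injective ?_)
      have h5 := velocity_eq_chartFrame (mdifferentiableAt_of_contMDiffOn hJ hc.1 hT₁J) hT₁x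
      have h6 := h3.2
      rw [h4] at h6
      have h7 : (velocity (fun t ↦ Y (t, p₀)) T₁ : E) = velocity c T₁ := by
        refine velocity_congr ?_
        filter_upwards [(H.isOpen_time.inter hJ).mem_nhds ⟨hT₁, hT₁J⟩] with r hr using heq hr
      exact h6.trans (h7.trans h5)
    obtain ⟨N₂, Y₂, hpN₂, H₂⟩ := H.extend (hZ T₁) hT₁ hpN hx1 (by rw [hph]; exact hT₁N)
    exact ⟨_, N₂, Y₂, Or.inr hT₁ε, hpN₂, H₂⟩

end Families

end

end LorentzGeom

namespace LorentzGeom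

noncomputable section

/-! ### Time functions and the unit normal field -/

section TimeFunction

variable {E : Type*} [NormedAddCommGroup E] [NormedSpace ℝ E]
  {M : Type*} [TopologicalSpace M] [ChartedSpace E M] [IsManifold 𝓘(ℝ, E) ∞ M]
  {g : LorentzianMetric E M} {τ : M → ℝ}

/-- The differential as a linear form on the model space. -/
def differentialForm (E : Type*) [NormedAddCommGroup E] [NormedSpace ℝ E] {M : Type*}
    [TopologicalSpace M] [ChartedSpace E M] (f : M → ℝ) (x : M) : E →L[ℝ] ℝ :=
  differential (E := E) f x

/-- A real function in the chart at `x₀`. -/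
def readInChart (E : Type*) [NormedAddCommGroup E] [NormedSpace ℝ E] {M : Type*}
    [TopologicalSpace M] [ChartedSpace E M] (x₀ : M) (f : M → ℝ) (z : E) : ℝ :=
  f ((extChartAt 𝓘(ℝ, E) x₀).symm z)

lemma contDiffOn_readInChart {f : M → ℝ} (hf : ContMDiff 𝓘(ℝ, E) 𝓘(ℝ, ℝ) ∞ f) (x₀ : M) :
    ContDiffOn ℝ ∞ (readInChart E x₀ f) (extChartAt 𝓘(ℝ, E) x₀).target := by
  rw [← contMDiffOn_iff_contDiffOn]
  exact hf.comp_contMDiffOn (contMDiffOn_extChartAt_symm (n := ∞) x₀)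

lemma differentialForm_chartFrame {f : M → ℝ} (hf : ContMDiff 𝓘(ℝ, E) 𝓘(ℝ, ℝ) ∞ f) {x₀ : M}
    {z : E} (hz : z ∈ (extChartAt 𝓘(ℝ, E) x₀).target) (w : E) :
    differentialForm E f ((extChartAt 𝓘(ℝ, E) x₀).symm z) (chartFrame x₀ z w) =
      fderiv ℝ (readInChart E x₀ f) z w := by
  have h1 := (hf.mdifferentiable (by simp) ((extChartAt 𝓘(ℝ, E) x₀).symm z)).hasMFDerivAt.comp z
    (mdifferentiableAt_ext_symm hz).hasMFDerivAt
  have h2 : (mfderiv 𝓘(ℝ, E) 𝓘(ℝ, ℝ) (readInChart E x₀ f) z : E →L[ℝ] ℝ) =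
    (differentialForm E f ((extChartAt 𝓘(ℝ, E) x₀).symm z)).comp (chartFrame x₀ z) := h1.mfderiv
  rw [mfderiv_eq_fderiv] at h2
  have h3 : fderiv ℝ (readInChart E x₀ f) z =
    (differentialForm E f ((extChartAt 𝓘(ℝ, E) x₀).symm z)).comp (chartFrame x₀ z) := h2
  rw [h3]
  rfl

lemma exists_gradient (hτ : IsTimeFunction g τ) (x : M) :
    ∃ v : E, (∀ w, g.form x v w = differentialForm E τ x w) ∧ g.form x v v < 0 := hτ.2 x

/-- The kernel of `dτ` is the orthogonal complement of the timelike gradient, so its nonzero vectors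
are spacelike. -/
lemma differentialForm_ne_zero_of_timelike (hτ : IsTimeFunction g τ) {x : M} {v : E}
    (hv : g.form x v v < 0) : differentialForm E τ x v ≠ 0 := by
  intro h
  obtain ⟨u, hu, hu0⟩ := exists_gradient hτ x
  have hv0 : v ≠ 0 := by rintro rfl; simp at hv
  have := form_pos_of_orthogonal hu0 ((hu v).trans h) hv0
  linarith

lemma isFutureUnitNormal_iff {x : M} {v : E} : IsFutureUnitNormal g τ x v ↔ g.form x v v = -1 ∧
    (∀ w : E, differentialForm E τ x w = 0 → g.form x v w = 0) ∧ 0 < differentialForm E τ x v :=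
  Iff.rfl

/-- A vector orthogonal to a time slice is a multiple of the unit normal. -/
lemma eq_smul_of_isOrthogonalToSlice {x : M} {n v : E} (hn : IsFutureUnitNormal g τ x n)
    (hv : IsOrthogonalToSlice g τ x v) :
    v = (differentialForm E τ x v / differentialForm E τ x n) • n := by
  obtain ⟨hn1, hn2, hn3⟩ := hn
  have hn1' : g.form x n n = -1 := hn1
  have hn3' : 0 < differentialForm E τ x n := hn3
  set μ := differentialForm E τ x v / differentialForm E τ x n with hμ
  -- The difference `v - μ • n` is tangent to the slice, hence orthogonal to `n` and to `v`, hence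
  -- to itself. A nonzero vector orthogonal to the timelike `n` would have positive square.
  have hw : differentialForm E τ x (v - μ • n) = 0 := by
    rw [map_sub, map_smul, smul_eq_mul, hμ, div_mul_cancel₀ _ hn3'.ne', sub_self]
  have h1 : g.form x n (v - μ • n) = 0 := hn2 _ hw
  have h2 : g.form x v (v - μ • n) = 0 := hv _ hw
  by_contra hne
  have h3 := form_pos_of_orthogonal (by rw [hn1']; norm_num) h1 (sub_ne_zero.2 hne)
  have h4 : g.form x (v - μ • n) (v - μ • n) = 0 := by
    rw [map_sub (g.form x), sub_apply, h2, map_smul, smul_apply, h1]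
    simp
  linarith

lemma isFutureUnitNormal_unique {x : M} {n v : E} (hn : IsFutureUnitNormal g τ x n)
    (hv : IsFutureUnitNormal g τ x v) : v = n := by
  have h := eq_smul_of_isOrthogonalToSlice hn hv.2.1
  have hn1 : g.form x n n = -1 := hn.1
  have hv1 : g.form x v v = -1 := hv.1
  have hn3 : 0 < differentialForm E τ x n := hn.2.2
  have hv3 : 0 < differentialForm E τ x v := hv.2.2
  set μ := differentialForm E τ x v / differentialForm E τ x n
  have hμ : 0 < μ := div_pos hv3 hn3
  rw [h] at hv1
  simp only [map_smul, smul_apply, smul_eq_mul, hn1] at hv1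
  have : μ = 1 := by nlinarith
  rw [h, this, one_smul]

end TimeFunction

section NormalField

variable {E : Type*} [NormedAddCommGroup E] [NormedSpace ℝ E] [FiniteDimensional ℝ E]
  {M : Type*} [TopologicalSpace M] [ChartedSpace E M] [IsManifold 𝓘(ℝ, E) ∞ M]
  {g : LorentzianMetric E M} {τ : M → ℝ}

/-- The gradient of `τ` in the chart at `x₀`. -/
def gradient (g : LorentzianMetric E M) (τ : M → ℝ) (x₀ : M) (z : E) : E :=
  raiseIndex (g.inChart x₀) z (fderiv ℝ (readInChart E x₀ τ) z)

/-- The future-pointing unit normal of the slices of `τ`, in the chart at `x₀`. -/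
def normalField (g : LorentzianMetric E M) (τ : M → ℝ) (x₀ : M) (z : E) : E :=
  (-(√(-g.inChart x₀ z (gradient g τ x₀ z) (gradient g τ x₀ z)))⁻¹) • gradient g τ x₀ z

lemma inChart_gradient {x₀ : M} {z : E} (hz : z ∈ (extChartAt 𝓘(ℝ, E) x₀).target) (w : E) :
    g.inChart x₀ z (gradient g τ x₀ z) w = fderiv ℝ (readInChart E x₀ τ) z w := by
  rw [gradient, apply_raiseIndex (inChart_isInvertible hz)]

lemma inChart_gradient_neg (hτ : IsTimeFunction g τ) {x₀ : M} {z : E}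
    (hz : z ∈ (extChartAt 𝓘(ℝ, E) x₀).target) :
    g.inChart x₀ z (gradient g τ x₀ z) (gradient g τ x₀ z) < 0 := by
  obtain ⟨v, hv, hv0⟩ := exists_gradient hτ ((extChartAt 𝓘(ℝ, E) x₀).symm z)
  obtain ⟨v', rfl⟩ := (chartFrame_isInvertible hz).surjective v
  have : v' = gradient g τ x₀ z := by
    rw [gradient, eq_raiseIndex_iff (inChart_isInvertible hz)]
    intro w
    rw [inChart_apply, hv, differentialForm_chartFrame hτ.1 hz]
  rw [← this]
  exact hv0

lemma contDiffOn_normalField (hτ : IsTimeFunction g τ) (x₀ : M) :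
    ContDiffOn ℝ ∞ (normalField g τ x₀) (extChartAt 𝓘(ℝ, E) x₀).target := by
  have hG := contDiffOn_inChart g x₀
  have h1 : ContDiffOn ℝ ∞ (gradient g τ x₀) (extChartAt 𝓘(ℝ, E) x₀).target :=
    (contDiffOn_raiseIndex hG fun _ hy ↦ inChart_isInvertible hy).clm_apply
      ((contDiffOn_readInChart hτ.1 x₀).fderiv_of_isOpen (isOpen_target x₀) (by simp))
  have h2 := ((hG.clm_apply h1).clm_apply h1).neg
  have h3 := h2.sqrt fun z hz ↦ (neg_pos.2 (inChart_gradient_neg hτ hz)).ne'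
  exact (h3.inv fun z hz ↦
    (Real.sqrt_pos.2 (neg_pos.2 (inChart_gradient_neg hτ hz))).ne').neg.smul h1

lemma fderiv_normalField_pos (hτ : IsTimeFunction g τ) {x₀ : M} {z : E}
    (hz : z ∈ (extChartAt 𝓘(ℝ, E) x₀).target) :
    0 < fderiv ℝ (readInChart E x₀ τ) z (normalField g τ x₀ z) := by
  have h := inChart_gradient_neg hτ hz
  have hs := Real.sqrt_pos.2 (neg_pos.2 h)
  rw [normalField, map_smul, ← inChart_gradient (g := g) hz, smul_eq_mul, neg_mul]
  exact neg_pos.2 (mul_neg_of_pos_of_neg (inv_pos.2 hs) h)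

lemma inChart_normalField_eq_zero {x₀ : M} {z : E}
    (hz : z ∈ (extChartAt 𝓘(ℝ, E) x₀).target) {w : E}
    (hw : fderiv ℝ (readInChart E x₀ τ) z w = 0) :
    g.inChart x₀ z (normalField g τ x₀ z) w = 0 := by
  have h := (inChart_gradient (g := g) (τ := τ) hz w).trans hw
  rw [normalField, map_smul, smul_apply, h, smul_zero]

lemma inChart_normalField_self (hτ : IsTimeFunction g τ) {x₀ : M} {z : E}
    (hz : z ∈ (extChartAt 𝓘(ℝ, E) x₀).target) :
    g.inChart x₀ z (normalField g τ x₀ z) (normalField g τ x₀ z) = -1 := by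
  have h := inChart_gradient_neg hτ hz
  have hs := Real.sqrt_pos.2 (neg_pos.2 h)
  have hsq := Real.sq_sqrt (neg_pos.2 h).le
  set A := g.inChart x₀ z (gradient g τ x₀ z) (gradient g τ x₀ z) with hA
  simp only [normalField, map_smul, smul_apply, smul_eq_mul, ← hA]
  field_simp
  linarith

lemma isFutureUnitNormal_normalField (hτ : IsTimeFunction g τ) {x₀ : M} {z : E}
    (hz : z ∈ (extChartAt 𝓘(ℝ, E) x₀).target) :
    IsFutureUnitNormal g τ ((extChartAt 𝓘(ℝ, E) x₀).symm z)
      (chartFrame x₀ z (normalField g τ x₀ z)) := by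
  refine isFutureUnitNormal_iff.2 ⟨?_, fun w hw ↦ ?_, ?_⟩
  · rw [← inChart_apply]
    exact inChart_normalField_self hτ hz
  · obtain ⟨w', rfl⟩ := (chartFrame_isInvertible hz).surjective w
    rw [differentialForm_chartFrame hτ.1 hz] at hw
    rw [← inChart_apply]
    exact inChart_normalField_eq_zero hz hw
  · rw [differentialForm_chartFrame hτ.1 hz]
    exact fderiv_normalField_pos hτ hz

end NormalField

/-! ### Curves in level sets and kernels of non-surjective maps -/

section LevelSets

/-- A tangent vector of a regular level set is the velocity of a curve in the level set. -/
lemma exists_curve_in_level {E : Type*} [NormedAddCommGroup E] [NormedSpace ℝ E]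
    [FiniteDimensional ℝ E] {U : Set E} (hU : IsOpen U) {f : E → ℝ} (hf : ContDiffOn ℝ ∞ f U)
    {n : E → E} (hn : ContDiffOn ℝ ∞ n U) (hfn : ∀ z ∈ U, fderiv ℝ f z (n z) ≠ 0) {z₀ v : E}
    (hz₀ : z₀ ∈ U) (hv : fderiv ℝ f z₀ v = 0) :
    ∃ η > 0, ∃ p : ℝ → E, ContDiffOn ℝ ∞ p (Ioo (-η) η) ∧ MapsTo p (Ioo (-η) η) U ∧ p 0 = z₀ ∧
      HasDerivAt p v 0 ∧ (∀ u ∈ Ioo (-η) η, f (p u) = f z₀) ∧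
      ∀ u ∈ Ioo (-η) η, fderiv ℝ f (p u) (deriv p u) = 0 := by
  have hdf := hf.fderiv_of_isOpen hU (m := ∞) (by simp)
  -- The constant field `v` is corrected along `n` so that it is annihilated by the differential of
  -- `f`; its integral curves stay in level sets. At `z₀` the correction is zero, so the initial
  -- velocity is `v`.
  have hX : ContDiffOn ℝ ∞
      (fun z ↦ v - (fderiv ℝ f z v / fderiv ℝ f z (n z)) • n z) U :=
    contDiffOn_const.sub (((hdf.clm_apply contDiffOn_const).div (hdf.clm_apply hn) hfn).smul hn)
  obtain ⟨η, hη, N, hN, hzN, φ, hφ, hφ0, hφd⟩ := exists_smooth_local_flow hU hX hz₀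
  have h0 : (0 : ℝ) ∈ Ioo (-η) η := ⟨by linarith, hη⟩
  have hzero : ∀ u ∈ Ioo (-η) η, fderiv ℝ f (φ (u, z₀)) (v - (fderiv ℝ f (φ (u, z₀)) v /
      fderiv ℝ f (φ (u, z₀)) (n (φ (u, z₀)))) • n (φ (u, z₀))) = 0 := fun u hu ↦ by
    rw [map_sub, map_smul, smul_eq_mul, div_mul_cancel₀ _ (hfn _ (hφd u hu z₀ hzN).1), sub_self]
  refine ⟨η, hη, fun u ↦ φ (u, z₀), hφ.comp (by fun_prop) fun u hu ↦ ⟨hu, hzN⟩,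
    fun u hu ↦ (hφd u hu z₀ hzN).1, hφ0 z₀ hzN, ?_, fun u hu ↦ ?_, fun u hu ↦ ?_⟩
  · have h := (hφd 0 h0 z₀ hzN).2
    rw [hφ0 z₀ hzN] at h
    simpa [hv] using h
  · have hd : ∀ u ∈ Ioo (-η) η, HasDerivAt (fun u ↦ f (φ (u, z₀))) 0 u := fun u hu ↦ by
      rw [← hzero u hu]
      exact (differentiableAt_of_contDiffOn hU hf (hφd u hu z₀ hzN).1).hasFDerivAt.comp_hasDerivAt
        (f := fun u ↦ φ (u, z₀)) u (hφd u hu z₀ hzN).2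
    have := eq_of_hasDerivAt_zero isOpen_Ioo ordConnected_Ioo hd hu h0
    rwa [hφ0 z₀ hzN] at this
  · rw [(hφd u hu z₀ hzN).2.deriv]
    exact hzero u hu

/-- A linear map on `ℝ × ker α` with values in `E` that is not surjective is not injective. -/
lemma exists_kernel_of_not_surjective {E : Type*} [NormedAddCommGroup E] [NormedSpace ℝ E]
    [FiniteDimensional ℝ E] {α : E →L[ℝ] ℝ} (hα : α ≠ 0) (D : ℝ × E →L[ℝ] E)
    (h : ¬ ∀ u, ∃ (σ : ℝ) (v : E), α v = 0 ∧ D (σ, v) = u) :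
    ∃ (σ : ℝ) (v : E), (σ, v) ≠ 0 ∧ α v = 0 ∧ D (σ, v) = 0 := by
  by_contra! hne
  refine h ?_
  set K : Submodule ℝ E := LinearMap.ker (α : E →ₗ[ℝ] ℝ)
  set L : ℝ × K →ₗ[ℝ] E := (D : ℝ × E →ₗ[ℝ] E) ∘ₗ LinearMap.prodMap LinearMap.id K.subtype
  have hL : ∀ q : ℝ × K, L q = D (q.1, (q.2 : E)) := fun q ↦ rfl
  have hinj : Function.Injective L := by
    rw [injective_iff_map_eq_zero]
    rintro ⟨σ, v⟩ hq
    by_contra hne'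
    refine hne σ v (fun h0 ↦ hne' ?_) v.2 (by rw [← hq, hL])
    rw [Prod.mk_eq_zero] at h0 ⊢
    exact ⟨h0.1, Subtype.ext h0.2⟩
  have hdim : Module.finrank ℝ (ℝ × K) = Module.finrank ℝ E := by
    have := Module.Dual.finrank_ker_add_one_of_ne_zero (f := (α : E →ₗ[ℝ] ℝ))
      (fun h0 ↦ hα (ContinuousLinearMap.coe_injective h0))
    rw [Module.finrank_prod, Module.finrank_self, add_comm]
    exact this
  have hsurj := (LinearMap.injective_iff_surjective_of_finrank_eq_finrank hdim).1 hinj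
  intro u
  obtain ⟨⟨σ, v⟩, hq⟩ := hsurj u
  exact ⟨σ, v, v.2, hq⟩

end LevelSets

/-! ### Injectivity of the differential of the geodesic flow -/

section PhaseInjective

variable {E : Type*} [NormedAddCommGroup E] [NormedSpace ℝ E]
  {M : Type*} [TopologicalSpace M] [ChartedSpace E M] [IsManifold 𝓘(ℝ, E) ∞ M]
  {g : LorentzianMetric E M} {x₀ : M} {a : ℝ} {I : Set ℝ} {N : Set (E × E)}
  {Y : ℝ × (E × E) → M}

lemma IsGeodesicFamily.phase_eq_coord (H : IsGeodesicFamily g x₀ a I N Y) {x₁ : M} {T : ℝ}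
    (hT : T ∈ I) {p : E × E} (hp : p ∈ N) (hx : Y (T, p) ∈ (chartAt E x₁).source) {d : ℝ → M}
    (hd : (fun t ↦ Y (t, p)) =ᶠ[𝓝 T] d) :
    phase x₁ Y T p = (coord x₁ d T, deriv (coord (E := E) x₁ d) T) := by
  have h1 : coord (E := E) x₁ (fun t ↦ Y (t, p)) =ᶠ[𝓝 T] coord x₁ d :=
    hd.fun_comp (extChartAt 𝓘(ℝ, E) x₁)
  refine Prod.ext h1.self_of_nhds ?_
  have hR := isOpen_inter_preimage_source H.isOpen_prod H.smooth x₁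
  have h2 := (differentiableAt_of_contDiffOn hR (contDiffOn_coord H.smooth x₁)
    (x := (T, p)) ⟨⟨hT, hp⟩, hx⟩).hasFDerivAt
  have h3 : HasDerivAt (coord (E := E) x₁ (fun t ↦ Y (t, p))) (phase x₁ Y T p).2 T :=
    h2.comp_hasDerivAt (f := fun t : ℝ ↦ (t, p)) T ((hasDerivAt_id T).prodMk (hasDerivAt_const T p))
  rw [← h1.deriv_eq, h3.deriv]

/-- The derivative of the geodesic flow is injective. -/
lemma IsGeodesicFamily.fderiv_phase_injective [FiniteDimensional ℝ E] [T2Space M]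
    (H : IsGeodesicFamily g x₀ a I N Y) {T : ℝ} (hT : T ∈ I) {p : E × E} (hp : p ∈ N) {x₁ : M}
    (hx : Y (T, p) ∈ (chartAt E x₁).source) :
    Function.Injective (fderiv ℝ (phase x₁ Y T) p) := by
  -- The same geodesic, parametrized at time `T`, lies in a second family that reaches back to `a`.
  -- Flowing back is a differentiable left inverse of the phase map near `p`, and the chain rule
  -- gives injectivity.
  obtain ⟨I', N', Z, haI', hN', H', -⟩ := exists_geodesicFamily H.isOpen_time H.ordConnected
    (H.geodesic p hp) hT H.mem_time hx
  rw [← H.phase_eq_coord hT hp hx (EventuallyEq.refl _ _)] at hN'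
  have hD := H.isOpen_phase_domain x₁ hT
  have hsm := H.contDiffOn_phase x₁ hT
  have hpD : p ∈ {p ∈ N | Y (T, p) ∈ (chartAt E x₁).source} := ⟨hp, hx⟩
  have h1 := differentiableAt_of_contDiffOn hD hsm hpD
  have key : ∀ q ∈ N, Y (T, q) ∈ (chartAt E x₁).source → phase x₁ Y T q ∈ N' →
      Z (a, phase x₁ Y T q) ∈ (chartAt E x₀).source ∧ phase x₀ Z a (phase x₁ Y T q) = q := by
    intro q hq hqx hqN
    have heq := H.eqOn H' hT hq hqx hqN
    have hsrc : Y (a, q) ∈ (chartAt E x₀).source := by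
      rw [H.initial q hq]
      exact mem_source_iff.1 ((extChartAt 𝓘(ℝ, E) x₀).map_target (H.target q hq))
    have e1 : Y (a, q) = Z (a, phase x₁ Y T q) := heq ⟨H.mem_time, haI'⟩
    refine ⟨e1 ▸ hsrc, ?_⟩
    have e2 : (fun t ↦ Z (t, phase x₁ Y T q)) =ᶠ[𝓝 a] fun t ↦ Y (t, q) := by
      filter_upwards [(H.isOpen_time.inter H'.isOpen_time).mem_nhds ⟨H.mem_time, haI'⟩] with t ht
      exact (heq ht).symm
    rw [H'.phase_eq_coord haI' hqN (e1 ▸ hsrc) e2,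
      ← H.phase_eq_coord H.mem_time hq hsrc (EventuallyEq.refl _ _), H.phase_self hq]
  have h2 := differentiableAt_of_contDiffOn (H'.isOpen_phase_domain x₀ haI')
    (H'.contDiffOn_phase x₀ haI') (x := phase x₁ Y T p) ⟨hN', (key p hp hx hN').1⟩
  have h3 := h2.hasFDerivAt.comp p h1.hasFDerivAt
  have h4 : phase x₀ Z a ∘ phase x₁ Y T =ᶠ[𝓝 p] id := by
    filter_upwards [hD.mem_nhds hpD, h1.continuousAt.eventually (H'.isOpen_param.mem_nhds hN')]
      with q hq hqN using (key q hq.1 hq.2 hqN).2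
  have h5 := (h3.congr_of_eventuallyEq h4.symm).unique (hasFDerivAt_id p)
  intro v w hvw
  have := congrArg (fderiv ℝ (phase x₀ Z a) (phase x₁ Y T p)) hvw
  rw [← ContinuousLinearMap.comp_apply, ← ContinuousLinearMap.comp_apply, h5] at this
  exact this

end PhaseInjective

end

end LorentzGeom

namespace LorentzGeom

noncomputable section

/-! ### The normal exponential map and its critical points -/

section ChainRule

variable {E : Type*} [NormedAddCommGroup E] [NormedSpace ℝ E]
  {M : Type*} [TopologicalSpace M] [ChartedSpace E M]
  {X W : Type*} [NormedAddCommGroup X] [NormedSpace ℝ X] [NormedAddCommGroup W] [NormedSpace ℝ W]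

lemma mfderiv_comp_vectorSpace {F : X → M} {f : W → X} {f' : W →L[ℝ] X} {w : W}
    (hF : MDifferentiableAt 𝓘(ℝ, X) 𝓘(ℝ, E) F (f w)) (hf : HasFDerivAt f f' w) (v : W) :
    (mfderiv 𝓘(ℝ, W) 𝓘(ℝ, E) (fun w ↦ F (f w)) w : W →L[ℝ] E) v =
      (mfderiv 𝓘(ℝ, X) 𝓘(ℝ, E) F (f w) : X →L[ℝ] E) (f' v) := by
  have h := HasMFDerivAt.comp w (g := F) (f := f) hF.hasMFDerivAt hf.hasMFDerivAt
  have h' : (mfderiv 𝓘(ℝ, W) 𝓘(ℝ, E) (fun w ↦ F (f w)) w : W →L[ℝ] E) =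
    (mfderiv 𝓘(ℝ, X) 𝓘(ℝ, E) F (f w) : X →L[ℝ] E).comp f' := h.mfderiv
  rw [h']
  rfl

omit [TopologicalSpace M] [ChartedSpace E M] in
lemma hasMFDerivAt_prodMk_space {H : Type*} [TopologicalSpace H] {I : ModelWithCorners ℝ E H}
    [TopologicalSpace M] [ChartedSpace H M] {f : M → X} {h : M → W} {x : M}
    {f' : TangentSpace I x →L[ℝ] X} {h' : TangentSpace I x →L[ℝ] W}
    (hf : HasMFDerivAt I 𝓘(ℝ, X) f x f') (hh : HasMFDerivAt I 𝓘(ℝ, W) h x h') :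
    HasMFDerivAt I 𝓘(ℝ, X × W) (fun x ↦ (f x, h x)) x (f'.prod h') :=
  ⟨hf.1.prodMk hh.1, hf.2.prodMk hh.2⟩

end ChainRule

section NormalGeodesics

lemma exists_Ioo_subset {I : Set ℝ} (hI : IsOpen I) (hI' : I.OrdConnected) {x y : ℝ} (hx : x ∈ I)
    (hy : y ∈ I) : ∃ α β, x ∈ Ioo α β ∧ y ∈ Ioo α β ∧ Ioo α β ⊆ I := by
  have key : ∀ z ∈ I, ∃ ε > 0, Icc (z - ε) (z + ε) ⊆ I := by
    intro z hz
    obtain ⟨ε, hε, h⟩ := Metric.isOpen_iff.1 hI z hz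
    refine ⟨ε / 2, by positivity, fun w hw ↦ h ?_⟩
    rw [Metric.mem_ball, Real.dist_eq, abs_lt]
    exact ⟨by linarith [hw.1], by linarith [hw.2]⟩
  obtain ⟨ε, hε, h1⟩ := key x hx
  obtain ⟨δ, hδ, h2⟩ := key y hy
  have hm : min (x - ε) (y - δ) ∈ I := by
    rcases min_choice (x - ε) (y - δ) with h | h <;> rw [h]
    · exact h1 ⟨le_rfl, by linarith⟩
    · exact h2 ⟨le_rfl, by linarith⟩
  have hM : max (x + ε) (y + δ) ∈ I := by
    rcases max_choice (x + ε) (y + δ) with h | h <;> rw [h]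
    · exact h1 ⟨by linarith, le_rfl⟩
    · exact h2 ⟨by linarith, le_rfl⟩
  refine ⟨min (x - ε) (y - δ), max (x + ε) (y + δ), ⟨?_, ?_⟩, ⟨?_, ?_⟩,
    fun t ht ↦ hI'.out hm hM ⟨ht.1.le, ht.2.le⟩⟩
  · exact (min_le_left _ _).trans_lt (by linarith)
  · exact lt_of_lt_of_le (by linarith) (le_max_left _ _)
  · exact (min_le_right _ _).trans_lt (by linarith)
  · exact lt_of_lt_of_le (by linarith) (le_max_right _ _)

variable {E : Type*} [NormedAddCommGroup E] [NormedSpace ℝ E]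
  {M : Type*} [TopologicalSpace M] [ChartedSpace E M] [IsManifold 𝓘(ℝ, E) ∞ M]
  {g : LorentzianMetric E M} {τ : M → ℝ}

lemma IsFutureUnitNormal.congr {x y : M} {v w : E} (h : IsFutureUnitNormal g τ x v) (hxy : x = y)
    (hvw : v = w) : IsFutureUnitNormal g τ y w := by
  subst hxy hvw
  exact h

open Classical in
lemma IsGeodesicOn.glue {c d : ℝ → M} {J K : Set ℝ} (hJ : IsOpen J) (hK : IsOpen K)
    (hc : IsGeodesicOn g c J) (hd : IsGeodesicOn g d K) (h : EqOn c d (J ∩ K)) :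
    ∃ e : ℝ → M, EqOn e c J ∧ EqOn e d K ∧ IsGeodesicOn g e (J ∪ K) := by
  set e : ℝ → M := fun t ↦ if t ∈ J then c t else d t
  have e1 : EqOn e c J := fun t ht ↦ if_pos ht
  have e2 : EqOn e d K := fun t ht ↦ by
    by_cases htJ : t ∈ J
    · exact (if_pos htJ).trans (h ⟨htJ, ht⟩)
    · exact if_neg htJ
  refine ⟨e, e1, e2, isGeodesicOn_of_local ?_⟩
  rintro t (ht | ht)
  · exact ⟨c, J, hJ.mem_nhds ht, hc, e1.eventuallyEq_of_mem (hJ.mem_nhds ht)⟩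
  · exact ⟨d, K, hK.mem_nhds ht, hd, e2.eventuallyEq_of_mem (hK.mem_nhds ht)⟩

/-- A time function is injective along timelike curves. -/
lemma injOn_timeFunction (hτ : IsTimeFunction g τ) {c : ℝ → M} {J : Set ℝ} (hJ : IsOpen J)
    (hJ' : J.OrdConnected) (hc : ContMDiffOn 𝓘(ℝ, ℝ) 𝓘(ℝ, E) ∞ c J)
    (hct : ∀ t ∈ J, g.form (c t) (velocity c t) (velocity c t) < 0) :
    InjOn (fun t ↦ τ (c t)) J := by
  have hd : ∀ t ∈ J, HasDerivAt (fun t ↦ τ (c t)) (differentialForm E τ (c t) (velocity c t)) t := by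
    intro t ht
    have h := HasMFDerivAt.comp t (g := τ) (f := c)
      (hτ.1.mdifferentiable (by simp) (c t)).hasMFDerivAt
      (mdifferentiableAt_of_contMDiffOn hJ hc ht).hasMFDerivAt
    have h' : HasFDerivAt (fun t ↦ τ (c t)) ((differentialForm E τ (c t)).comp
      (mfderiv 𝓘(ℝ, ℝ) 𝓘(ℝ, E) c t : ℝ →L[ℝ] E)) t := h.hasFDerivAt
    exact h'.hasDerivAt
  have key : ∀ t ∈ J, ∀ r ∈ J, t < r → τ (c t) ≠ τ (c r) := by
    intro t ht r hr htr heq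
    have hsub : Icc t r ⊆ J := hJ'.out ht hr
    obtain ⟨x, hx, hx0⟩ := exists_hasDerivAt_eq_zero htr
      (fun x hx ↦ (hd x (hsub hx)).continuousAt.continuousWithinAt) heq
      (fun x hx ↦ hd x (hsub (Ioo_subset_Icc_self hx)))
    exact differentialForm_ne_zero_of_timelike hτ (hct x (hsub (Ioo_subset_Icc_self hx))) hx0
  intro t ht r hr heq
  rcases lt_trichotomy t r with h | h | h
  · exact absurd heq (key t ht r hr h)
  · exact h
  · exact absurd heq.symm (key r hr t ht h)

variable [FiniteDimensional ℝ E] [T2Space M]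

/-- The value of `normalExp` comes from an arbitrarily chosen geodesic. Uniqueness of the unit
normal and of geodesics identifies it with any given normal geodesic on the common interval. -/
lemma IsNormalGeodesic.eq {t : ℝ} {x : M} {γ δ : ℝ → M} {I : Set ℝ} (hI : IsOpen I)
    (hI' : I.OrdConnected) (h0 : (0 : ℝ) ∈ I) (hγ : IsGeodesicOn g γ I) (hγ0 : γ 0 = x)
    (hγn : IsFutureUnitNormal g τ (γ 0) (velocity γ 0)) (hδ : IsNormalGeodesic g τ t x δ) :
    ∃ a b, 0 ∈ Ioo a b ∧ t ∈ Ioo a b ∧ IsGeodesicOn g δ (Ioo a b) ∧ EqOn γ δ (I ∩ Ioo a b) := by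
  obtain ⟨a, b, h0', ht, hgeo, hδ0, hδn⟩ := hδ
  refine ⟨a, b, h0', ht, hgeo, eqOn_of_velocity_eq (hI.inter isOpen_Ioo)
    (hI'.inter ordConnected_Ioo) (hγ.mono inter_subset_left) (hgeo.mono inter_subset_right)
    ⟨h0, h0'⟩ (hγ0.trans hδ0.symm) ?_⟩
  have h : IsFutureUnitNormal g τ (δ 0) (velocity γ 0 : E) :=
    IsFutureUnitNormal.congr (E := E) hγn (hγ0.trans hδ0.symm) rfl
  exact isFutureUnitNormal_unique (E := E) hδn h

/-- The value of the normal exponential map. -/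
lemma normalExp_eq {t : ℝ} {x : M} {γ : ℝ → M} {I : Set ℝ} (hI : IsOpen I)
    (hI' : I.OrdConnected) (h0 : (0 : ℝ) ∈ I) (ht : t ∈ I) (hγ : IsGeodesicOn g γ I) (hγ0 : γ 0 = x)
    (hγn : IsFutureUnitNormal g τ (γ 0) (velocity γ 0)) : normalExp g τ (t, x) = γ t := by
  obtain ⟨α, β, h0', ht', hsub⟩ := exists_Ioo_subset hI hI' h0 ht
  have hex : ∃ γ : ℝ → M, IsNormalGeodesic g τ t x γ :=
    ⟨γ, α, β, h0', ht', hγ.mono hsub, hγ0, hγn⟩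
  have h1 : normalExp g τ (t, x) = hex.choose t := dif_pos hex
  obtain ⟨a, b, -, htab, -, heq⟩ := IsNormalGeodesic.eq hI hI' h0 hγ hγ0 hγn hex.choose_spec
  rw [h1]
  exact (heq ⟨ht, htab⟩).symm

/-- A point on a normal geodesic is attained by the normal exponential map only once. -/
lemma eq_of_normalExp_eq (hτ : IsTimeFunction g τ) {t r : ℝ} {x : M} {γ : ℝ → M} {I : Set ℝ}
    (hI : IsOpen I) (hI' : I.OrdConnected) (h0 : (0 : ℝ) ∈ I) (hr : r ∈ I)
    (hγ : IsGeodesicOn g γ I) (hγ0 : γ 0 = x)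
    (hγn : IsFutureUnitNormal g τ (γ 0) (velocity γ 0)) (ht : (t, x) ∈ normalExpDomain g τ)
    (htr : normalExp g τ (t, x) = γ r) : t = r := by
  obtain ⟨δ, hδ⟩ := ht
  obtain ⟨a, b, h0', htab, hδgeo, heq⟩ := IsNormalGeodesic.eq hI hI' h0 hγ hγ0 hγn hδ
  obtain ⟨a', b', h0'', htab', hδgeo', hδ0, hδn⟩ := id hδ
  have h1 : normalExp g τ (t, x) = δ t :=
    normalExp_eq isOpen_Ioo ordConnected_Ioo h0'' htab' hδgeo' hδ0 hδn
  -- The two geodesics may have different domains. Glued together they form one timelike geodesic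
  -- containing both parameters, on which the time function is injective.
  obtain ⟨e, he1, he2, he⟩ := hγ.glue hI isOpen_Ioo hδgeo heq
  have hU : (I ∪ Ioo a b).OrdConnected :=
    (hI'.isPreconnected.union 0 h0 h0' ordConnected_Ioo.isPreconnected).ordConnected
  have hUo : IsOpen (I ∪ Ioo a b) := hI.union isOpen_Ioo
  refine injOn_timeFunction hτ hUo hU he.1 (fun q hq ↦ ?_) (Or.inr htab) (Or.inl hr) ?_
  · rw [form_velocity_eq hUo hU he hq (Or.inl h0)]
    have hv : (velocity e 0 : E) = velocity γ 0 :=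
      velocity_congr (he1.eventuallyEq_of_mem (hI.mem_nhds h0))
    have hn1 : g.form (γ 0) (velocity γ 0) (velocity γ 0) = -1 := hγn.1
    rw [he1 h0, hv, hn1]
    norm_num
  · simp only
    rw [he2 htab, he1 hr, ← h1, htr]

end NormalGeodesics

section CriticalPoints

variable {E : Type*} [NormedAddCommGroup E] [NormedSpace ℝ E] [FiniteDimensional ℝ E]
  {M : Type*} [TopologicalSpace M] [T2Space M] [ChartedSpace E M] [IsManifold 𝓘(ℝ, E) ∞ M]
  {g : LorentzianMetric E M} {τ : M → ℝ} {x₀ : M} {a : ℝ} {I : Set ℝ} {N : Set (E × E)}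
  {Y : ℝ × (E × E) → M}

omit [T2Space M] in
/-- The members of a family of geodesics that are normal to the slices of `τ`, parametrized by
arc length. -/
lemma IsGeodesicFamily.normal (H : IsGeodesicFamily g x₀ a I N Y) (hτ : IsTimeFunction g τ)
    {lam : ℝ} (hlam : lam ≠ 0) {z : E} (hz : (z, lam • normalField g τ x₀ z) ∈ N) :
    IsOpen {r | a + lam⁻¹ * r ∈ I} ∧ {r | a + lam⁻¹ * r ∈ I}.OrdConnected ∧
    (0 : ℝ) ∈ {r | a + lam⁻¹ * r ∈ I} ∧
    IsGeodesicOn g (fun r ↦ Y (a + lam⁻¹ * r, (z, lam • normalField g τ x₀ z)))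
      {r | a + lam⁻¹ * r ∈ I} ∧
    Y (a + lam⁻¹ * 0, (z, lam • normalField g τ x₀ z)) = (extChartAt 𝓘(ℝ, E) x₀).symm z ∧
    IsFutureUnitNormal g τ (Y (a + lam⁻¹ * 0, (z, lam • normalField g τ x₀ z)))
      (LorentzGeom.velocity (fun r ↦ Y (a + lam⁻¹ * r, (z, lam • normalField g τ x₀ z))) 0) := by
  set γ : ℝ → M := fun t ↦ Y (t, (z, lam • normalField g τ x₀ z)) with hγ
  have hgeo : IsGeodesicOn g γ I := H.geodesic _ hz
  have h0 : a + lam⁻¹ * 0 = a := by ring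
  have hγ0 : γ (a + lam⁻¹ * 0) = (extChartAt 𝓘(ℝ, E) x₀).symm z := by
    rw [h0]
    exact H.initial _ hz
  refine ⟨H.isOpen_time.preimage (f := fun r : ℝ ↦ a + lam⁻¹ * r) (by fun_prop), ?_, ?_,
    hgeo.comp_affine a lam⁻¹, hγ0, ?_⟩
  · constructor
    intro p hp q hq r hr
    rcases le_total 0 lam⁻¹ with h | h
    · exact H.ordConnected.out hp hq ⟨by nlinarith [hr.1], by nlinarith [hr.2]⟩
    · exact H.ordConnected.out hq hp ⟨by nlinarith [hr.2], by nlinarith [hr.1]⟩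
  · simpa using H.mem_time
  · have hmd : MDifferentiableAt 𝓘(ℝ, ℝ) 𝓘(ℝ, E) γ (a + lam⁻¹ * 0) := by
      rw [h0]
      exact mdifferentiableAt_of_contMDiffOn H.isOpen_time hgeo.1 H.mem_time
    have hv : (LorentzGeom.velocity (fun r ↦ γ (a + lam⁻¹ * r)) 0 : E) =
        chartFrame x₀ z (normalField g τ x₀ z) := by
      have h1 : (LorentzGeom.velocity γ a : E) = lam • chartFrame x₀ z (normalField g τ x₀ z) :=
        (H.velocity _ hz).trans (map_smul _ _ _)
      have h2 : (LorentzGeom.velocity (fun r ↦ γ (a + lam⁻¹ * r)) 0 : E) =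
        lam⁻¹ • (LorentzGeom.velocity γ (a + lam⁻¹ * 0) : E) := velocity_comp_affine hmd
      rw [h0] at h2
      have h3 : (LorentzGeom.velocity (fun r ↦ γ (a + lam⁻¹ * r)) 0 : E) =
          lam⁻¹ • lam • chartFrame x₀ z (normalField g τ x₀ z) :=
        h2.trans (congrArg (fun v : E ↦ lam⁻¹ • v) h1)
      exact h3.trans (inv_smul_smul₀ hlam _)
    exact IsFutureUnitNormal.congr (E := E)
      (isFutureUnitNormal_normalField (g := g) hτ (H.target _ hz)) hγ0.symm hv.symm

/-- This replaces a map defined by choice by a smooth expression. The factor `lam⁻¹` converts arc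
length, the parameter of `normalExp`, into the parameter of `c`. -/
lemma normalExp_eq_family (H : IsGeodesicFamily g x₀ a I N Y) (hτ : IsTimeFunction g τ)
    {lam : ℝ} (hlam : lam ≠ 0) {r : ℝ} (hr : a + lam⁻¹ * r ∈ I) {z : E}
    (hz : (z, lam • normalField g τ x₀ z) ∈ N) :
    normalExp g τ (r, (extChartAt 𝓘(ℝ, E) x₀).symm z) =
      Y (a + lam⁻¹ * r, (z, lam • normalField g τ x₀ z)) := by
  obtain ⟨h1, h2, h3, h4, h5, h6⟩ := H.normal hτ hlam hz
  exact normalExp_eq h1 h2 h3 hr h4 h5 h6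

/-- At a critical point of the normal exponential map there is a kernel vector. -/
lemma exists_kernel_of_isCriticalPoint (H : IsGeodesicFamily g x₀ a I N Y)
    (hτ : IsTimeFunction g τ) {lam : ℝ} (hlam : lam ≠ 0) {s : ℝ} (hs : s ∈ I)
    (hp : (extChartAt 𝓘(ℝ, E) x₀ x₀,
      lam • normalField g τ x₀ (extChartAt 𝓘(ℝ, E) x₀ x₀)) ∈ N)
    (hcrit : IsCriticalPoint g τ (lam * (s - a)) x₀) :
    ∃ (σ : ℝ) (v : E), (σ, v) ≠ 0 ∧
      fderiv ℝ (readInChart E x₀ τ) (extChartAt 𝓘(ℝ, E) x₀ x₀) v = 0 ∧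
      (mfderiv 𝓘(ℝ, ℝ × (E × E)) 𝓘(ℝ, E) Y (s, (extChartAt 𝓘(ℝ, E) x₀ x₀,
        lam • normalField g τ x₀ (extChartAt 𝓘(ℝ, E) x₀ x₀))) : ℝ × (E × E) →L[ℝ] E)
        (lam⁻¹ * σ, (v, lam • fderiv ℝ (normalField g τ x₀) (extChartAt 𝓘(ℝ, E) x₀ x₀) v)) = 0 := by
  have i1 : IsManifold 𝓘(ℝ, E) 1 M := IsManifold.of_le (n := ∞) (by norm_cast)
  set n := normalField g τ x₀ with hn
  set z₀ := extChartAt 𝓘(ℝ, E) x₀ x₀ with hz₀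
  set r := lam * (s - a) with hr
  set A : E →L[ℝ] E := mfderiv 𝓘(ℝ, E) 𝓘(ℝ, E) (extChartAt 𝓘(ℝ, E) x₀) x₀ with hA
  have hx₀ : x₀ ∈ (chartAt E x₀).source := mem_chart_source E x₀
  have hz₀t : z₀ ∈ (extChartAt 𝓘(ℝ, E) x₀).target :=
    (extChartAt 𝓘(ℝ, E) x₀).map_source (mem_source_iff.2 hx₀)
  have hsymm : (extChartAt 𝓘(ℝ, E) x₀).symm z₀ = x₀ :=
    (extChartAt 𝓘(ℝ, E) x₀).left_inv (mem_source_iff.2 hx₀)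
  have hrs : a + lam⁻¹ * r = s := by rw [hr]; field_simp; ring
  have hext : MDifferentiableAt 𝓘(ℝ, E) 𝓘(ℝ, E) (extChartAt 𝓘(ℝ, E) x₀) x₀ :=
    mdifferentiableAt_extChartAt hx₀
  have hAinv : A.IsInvertible := isInvertible_mfderiv_extChartAt (mem_source_iff.2 hx₀)
  have hnd : DifferentiableAt ℝ n z₀ :=
    differentiableAt_of_contDiffOn (isOpen_target x₀) (contDiffOn_normalField hτ x₀) hz₀t
  have hnc := (contDiffOn_normalField (g := g) hτ x₀).continuousOn
  have hτA : ∀ v, differentialForm E τ x₀ v = fderiv ℝ (readInChart E x₀ τ) z₀ (A v) := by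
    intro v
    have h1 : DifferentiableAt ℝ (readInChart E x₀ τ) z₀ :=
      differentiableAt_of_contDiffOn (isOpen_target x₀) (contDiffOn_readInChart hτ.1 x₀) hz₀t
    have h2 := HasMFDerivAt.comp x₀ (g := readInChart E x₀ τ) (f := extChartAt 𝓘(ℝ, E) x₀)
      h1.hasFDerivAt.hasMFDerivAt hext.hasMFDerivAt
    have h3 : τ =ᶠ[𝓝 x₀] readInChart E x₀ τ ∘ extChartAt 𝓘(ℝ, E) x₀ := by
      filter_upwards [(isOpen_extChartAt_source (I := 𝓘(ℝ, E)) x₀).mem_nhds (mem_source_iff.2 hx₀)]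
        with x hx
      simp only [Function.comp, readInChart, (extChartAt 𝓘(ℝ, E) x₀).left_inv hx]
    have h4 : differentialForm E τ x₀ = (fderiv ℝ (readInChart E x₀ τ) z₀).comp A :=
      (h2.congr_of_eventuallyEq h3).mfderiv
    rw [h4]
    rfl
  have hY := H.mdifferentiableAt (q := (s, (z₀, lam • n z₀))) ⟨hs, hp⟩
  set D : ℝ × (E × E) →L[ℝ] E :=
    mfderiv 𝓘(ℝ, ℝ × (E × E)) 𝓘(ℝ, E) Y (s, (z₀, lam • n z₀)) with hD
  set B : ℝ × E →L[ℝ] ℝ × (E × E) :=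
    (lam⁻¹ • ContinuousLinearMap.fst ℝ ℝ E).prod ((ContinuousLinearMap.snd ℝ ℝ E).prod
      ((lam • fderiv ℝ n z₀).comp (ContinuousLinearMap.snd ℝ ℝ E))) with hB
  have hf : HasFDerivAt (fun q : ℝ × E ↦ (a + lam⁻¹ * q.1, (q.2, lam • n q.2))) B (r, z₀) := by
    have h1 : HasFDerivAt (fun q : ℝ × E ↦ q.1) (ContinuousLinearMap.fst ℝ ℝ E) (r, z₀) :=
      hasFDerivAt_fst
    have h2 : HasFDerivAt (fun q : ℝ × E ↦ q.2) (ContinuousLinearMap.snd ℝ ℝ E) (r, z₀) :=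
      hasFDerivAt_snd
    have h3 : HasFDerivAt (fun q : ℝ × E ↦ lam • n q.2)
        ((lam • fderiv ℝ n z₀).comp (ContinuousLinearMap.snd ℝ ℝ E)) (r, z₀) :=
      HasFDerivAt.comp (g := fun z ↦ lam • n z) (r, z₀) (hnd.hasFDerivAt.const_smul lam) h2
    exact ((h1.const_mul lam⁻¹).const_add a).prodMk (h2.prodMk h3)
  have hq : HasMFDerivAt (𝓘(ℝ, ℝ).prod 𝓘(ℝ, E)) 𝓘(ℝ, ℝ × E)
      (fun q : ℝ × M ↦ (q.1, extChartAt 𝓘(ℝ, E) x₀ q.2)) (r, x₀)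
      ((ContinuousLinearMap.fst ℝ ℝ E).prod (A.comp (ContinuousLinearMap.snd ℝ ℝ E))) :=
    hasMFDerivAt_prodMk_space (hasMFDerivAt_fst (r, x₀))
      (HasMFDerivAt.comp (r, x₀) (g := extChartAt 𝓘(ℝ, E) x₀) hext.hasMFDerivAt
        (hasMFDerivAt_snd (r, x₀)))
  have hcomp : HasMFDerivAt (𝓘(ℝ, ℝ).prod 𝓘(ℝ, E)) 𝓘(ℝ, E)
      (fun q : ℝ × M ↦ Y (a + lam⁻¹ * q.1, (extChartAt 𝓘(ℝ, E) x₀ q.2,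
        lam • n (extChartAt 𝓘(ℝ, E) x₀ q.2)))) (r, x₀)
      ((D.comp B).comp ((ContinuousLinearMap.fst ℝ ℝ E).prod
        (A.comp (ContinuousLinearMap.snd ℝ ℝ E)))) := by
    have hY' : HasMFDerivAt 𝓘(ℝ, ℝ × (E × E)) 𝓘(ℝ, E) Y (a + lam⁻¹ * r, (z₀, lam • n z₀)) D := by
      rw [hrs]
      exact hY.hasMFDerivAt
    exact (HasMFDerivAt.comp (r, z₀) (g := Y) hY' hf.hasMFDerivAt).comp (r, x₀)
      (g := fun q : ℝ × E ↦ Y (a + lam⁻¹ * q.1, (q.2, lam • n q.2))) hq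
  -- The identity holds also for base points off the slice, since the normal field belongs to all
  -- slices at once; so the full differential can be compared.
  have hev : normalExp g τ =ᶠ[𝓝 (r, x₀)] fun q : ℝ × M ↦ Y (a + lam⁻¹ * q.1,
      (extChartAt 𝓘(ℝ, E) x₀ q.2, lam • n (extChartAt 𝓘(ℝ, E) x₀ q.2))) := by
    have c1 : ∀ᶠ q : ℝ × M in 𝓝 (r, x₀), a + lam⁻¹ * q.1 ∈ I := by
      have : ContinuousAt (fun q : ℝ × M ↦ a + lam⁻¹ * q.1) (r, x₀) := by fun_prop
      exact this.eventually (H.isOpen_time.mem_nhds (by simpa only [hrs] using hs))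
    have c2 : ∀ᶠ q : ℝ × M in 𝓝 (r, x₀), q.2 ∈ (extChartAt 𝓘(ℝ, E) x₀).source :=
      continuousAt_snd.eventually ((isOpen_extChartAt_source x₀).mem_nhds (mem_source_iff.2 hx₀))
    have c3 : ∀ᶠ q : ℝ × M in 𝓝 (r, x₀), (extChartAt 𝓘(ℝ, E) x₀ q.2,
        lam • n (extChartAt 𝓘(ℝ, E) x₀ q.2)) ∈ N := by
      have h1 : ContinuousAt (fun q : ℝ × M ↦ extChartAt 𝓘(ℝ, E) x₀ q.2) (r, x₀) :=
        ContinuousAt.comp (x := (r, x₀)) (continuousAt_extChartAt x₀) continuousAt_snd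
      have h2 : ContinuousAt (fun q : ℝ × M ↦ lam • n (extChartAt 𝓘(ℝ, E) x₀ q.2)) (r, x₀) :=
        ContinuousAt.comp (x := (r, x₀)) (g := fun z ↦ lam • n z)
          (hnd.continuousAt.const_smul lam) h1
      exact (h1.prodMk h2).eventually (H.isOpen_param.mem_nhds hp)
    filter_upwards [c1, c2, c3] with q h1 h2 h3
    have := normalExp_eq_family H hτ hlam h1 h3
    rw [(extChartAt 𝓘(ℝ, E) x₀).left_inv h2] at this
    exact this
  have hder : ∀ (σ : ℝ) (v : E), (normalExpDeriv g τ r x₀ (σ, v) : E) = D (B (σ, A v)) := by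
    intro σ v
    have h1 : (normalExpDeriv g τ r x₀ : ℝ × E →L[ℝ] E) =
      (D.comp B).comp ((ContinuousLinearMap.fst ℝ ℝ E).prod
        (A.comp (ContinuousLinearMap.snd ℝ ℝ E))) := (hcomp.congr_of_eventuallyEq hev).mfderiv
    exact congrArg (fun L : ℝ × E →L[ℝ] E ↦ L (σ, v)) h1
  have hα : fderiv ℝ (readInChart E x₀ τ) z₀ ≠ 0 := by
    intro h0
    have := fderiv_normalField_pos (g := g) hτ hz₀t
    rw [h0] at this
    exact lt_irrefl _ this
  -- Surjectivity of the coordinate expression would pass to `normalExp`, because the chart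
  -- differential `A` is invertible and matches the two kernels of `dτ`.
  obtain ⟨σ, v, hne, hv, hσv⟩ := exists_kernel_of_not_surjective hα (D.comp B) (by
    intro h
    refine hcrit.2 fun u ↦ ?_
    obtain ⟨σ, v', hv', hu⟩ := h u
    obtain ⟨v, rfl⟩ := hAinv.surjective v'
    exact ⟨σ, v, (hτA v).trans hv', (hder σ v).trans hu⟩)
  exact ⟨σ, v, hne, hv, hσv⟩

end CriticalPoints

end

end LorentzGeom

namespace LorentzGeom

noncomputable section

/-! ### The variation produced by a conjugate point -/

section NormalVariation

variable {E : Type*} [NormedAddCommGroup E] [NormedSpace ℝ E]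
  {M : Type*} [TopologicalSpace M] [ChartedSpace E M] [IsManifold 𝓘(ℝ, E) ∞ M]

/-- A variation `F` of the geodesic `c` through geodesics of the same speed, normal to the slice of
`τ` through `c a`, whose variation field vanishes at `s` to first order only. -/
structure IsNormalVariation (g : LorentzianMetric E M) (τ : M → ℝ) (c : ℝ → M) (J : Set ℝ)
    (a s κ η : ℝ) (I : Set ℝ) (F : ℝ × ℝ → M) : Prop where
  isOpen : IsOpen I
  ordConnected : I.OrdConnected
  mem_left : a ∈ I
  mem_focal : s ∈ I
  eta_pos : 0 < η
  kappa_pos : 0 < κ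
  smooth : ContMDiffOn 𝓘(ℝ, ℝ × ℝ) 𝓘(ℝ, E) ∞ F (I ×ˢ Ioo (-η) η)
  geodesic : ∀ u ∈ Ioo (-η) η, IsGeodesicOn g (fun t ↦ F (t, u)) I
  axis : EqOn (fun t ↦ F (t, 0)) c (I ∩ J)
  slice : ∀ u ∈ Ioo (-η) η, τ (F (a, u)) = τ (c a)
  speed : ∀ q ∈ I ×ˢ Ioo (-η) η,
    g.form (F q) ((mfderiv 𝓘(ℝ, ℝ × ℝ) 𝓘(ℝ, E) F q : ℝ × ℝ →L[ℝ] E) (1, 0))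
      ((mfderiv 𝓘(ℝ, ℝ × ℝ) 𝓘(ℝ, E) F q : ℝ × ℝ →L[ℝ] E) (1, 0)) = -κ
  orthogonal : ∀ q ∈ I ×ˢ Ioo (-η) η,
    g.form (F q) ((mfderiv 𝓘(ℝ, ℝ × ℝ) 𝓘(ℝ, E) F q : ℝ × ℝ →L[ℝ] E) (0, 1))
      ((mfderiv 𝓘(ℝ, ℝ × ℝ) 𝓘(ℝ, E) F q : ℝ × ℝ →L[ℝ] E) (1, 0)) = 0
  focal : du (fun q ↦ extChartAt 𝓘(ℝ, E) (c s) (F q)) (s, 0) = 0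
  first_order : dt (du fun q ↦ extChartAt 𝓘(ℝ, E) (c s) (F q)) (s, 0) ≠ 0

variable [FiniteDimensional ℝ E] [T2Space M] {g : LorentzianMetric E M} {τ : M → ℝ}

omit [T2Space M] in
/-- A timelike vector orthogonal to a slice is a multiple of the unit normal, in a chart. -/
lemma exists_eq_smul_normalField (hτ : IsTimeFunction g τ) {x₀ : M} {z w : E}
    (hz : z ∈ (extChartAt 𝓘(ℝ, E) x₀).target) (hw : g.inChart x₀ z w w < 0)
    (hort : ∀ v, fderiv ℝ (readInChart E x₀ τ) z v = 0 → g.inChart x₀ z w v = 0) :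
    ∃ lam : ℝ, lam ≠ 0 ∧ w = lam • normalField g τ x₀ z := by
  have hn := isFutureUnitNormal_normalField (g := g) hτ hz
  have hw' : IsOrthogonalToSlice g τ ((extChartAt 𝓘(ℝ, E) x₀).symm z) (chartFrame x₀ z w) := by
    intro v hv
    obtain ⟨v', rfl⟩ := (chartFrame_isInvertible hz).surjective (v : E)
    exact hort v' ((differentialForm_chartFrame hτ.1 hz v').symm.trans hv)
  have h := eq_smul_of_isOrthogonalToSlice hn hw'
  rw [← map_smul] at h
  have h' := (chartFrame_isInvertible hz).injective h
  refine ⟨_, fun h0 ↦ ?_, h'⟩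
  rw [h0, zero_smul] at h'
  rw [h'] at hw
  simp at hw

theorem exists_normalVariation (hτ : IsTimeFunction g τ) {c : ℝ → M} {J : Set ℝ} (hJ : IsOpen J)
    (hJ' : J.OrdConnected) (hc : IsGeodesicOn g c J)
    (hct : ∀ t ∈ J, g.form (c t) (velocity c t) (velocity c t) < 0) {a s : ℝ} (ha : a ∈ J)
    (hs : s ∈ J) (hort : IsOrthogonalToSlice g τ (c a) (velocity c a))
    (hconj : IsConjugatePointAlong g τ (c a) (c s)) :
    ∃ κ η I F, IsNormalVariation g τ c J a s κ η I F := by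
  have hxa : c a ∈ (chartAt E (c a)).source := mem_chart_source E _
  have hz : extChartAt 𝓘(ℝ, E) (c a) (c a) ∈ (extChartAt 𝓘(ℝ, E) (c a)).target :=
    (extChartAt 𝓘(ℝ, E) (c a)).map_source (mem_source_iff.2 hxa)
  have hsymm : (extChartAt 𝓘(ℝ, E) (c a)).symm (extChartAt 𝓘(ℝ, E) (c a) (c a)) = c a :=
    (extChartAt 𝓘(ℝ, E) (c a)).left_inv (mem_source_iff.2 hxa)
  have hmd := mdifferentiableAt_of_contMDiffOn hJ hc.1 ha
  have hvel := velocity_eq_chartFrame hmd hxa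
  -- The geodesic `c` need be neither of unit speed nor future-directed; `lam` records both its
  -- speed and its direction and may be negative.
  obtain ⟨lam, hlam, hw⟩ : ∃ lam : ℝ, lam ≠ 0 ∧ deriv (coord (E := E) (c a) c) a =
      lam • normalField g τ (c a) (extChartAt 𝓘(ℝ, E) (c a) (c a)) := by
    refine exists_eq_smul_normalField hτ hz ?_ fun v hv ↦ ?_
    · have := hct a ha
      rwa [form_velocity g hmd hxa] at this
    · have h1 : g.form (c a) (velocity c a) (chartFrame (c a) (extChartAt 𝓘(ℝ, E) (c a) (c a)) v)
          = 0 := by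
        refine hort _ ?_
        have h2 := differentialForm_chartFrame hτ.1 hz v
        rw [hsymm] at h2
        exact h2.trans hv
      have h3 : (velocity c a : E) = chartFrame (c a) (extChartAt 𝓘(ℝ, E) (c a) (c a))
        (deriv (coord (E := E) (c a) c) a) := hvel
      rw [h3] at h1
      rw [inChart_apply, hsymm]
      exact h1
  obtain ⟨I, N, Y, hsI, hpN, H, hYc⟩ := exists_geodesicFamily hJ hJ' hc ha hs hxa
  set x₀ := c a with hx₀
  set z₀ := extChartAt 𝓘(ℝ, E) x₀ x₀ with hz₀
  set n := normalField g τ x₀ with hn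
  have hco : coord (E := E) x₀ c a = z₀ := rfl
  rw [hw, hco] at hpN hYc
  obtain ⟨t, hcrit, htc⟩ := hconj
  have hYs : Y (s, (z₀, lam • n z₀)) = c s := hYc ⟨hsI, hs⟩
  have has : a + lam⁻¹ * (lam * (s - a)) = s := by field_simp; ring
  -- Conjugacy supplies some `t` with `normalExp g τ (t, c a) = c s`; criticality is needed at the
  -- arc length parameter of `s`, and these are the same.
  have ht : t = lam * (s - a) := by
    obtain ⟨h1, h2, h3, h4, h5, h6⟩ := H.normal hτ hlam hpN
    refine eq_of_normalExp_eq hτ h1 h2 h3 (r := lam * (s - a)) ?_ h4 (h5.trans hsymm) h6 hcrit.1 ?_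
    · simpa only [mem_ofPred_eq, has] using hsI
    · simp only [has]
      rw [htc, hYs]
  rw [ht] at hcrit
  obtain ⟨σ, v, hne, hv, hker⟩ := exists_kernel_of_isCriticalPoint H hτ hlam hsI hpN hcrit
  have hnsm := contDiffOn_normalField (g := g) hτ x₀
  obtain ⟨η₁, hη₁, p, hp, hpm, hp0, hpd, hplev, hptan⟩ := exists_curve_in_level (isOpen_target x₀)
    (contDiffOn_readInChart hτ.1 x₀) hnsm (fun z hz ↦ (fderiv_normalField_pos hτ hz).ne') hz hv
  -- Initial data along a curve in the slice with velocity `v`: the geodesics leave its points along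
  -- the unit normal, scaled to the velocity of `c`.
  set P : ℝ → E × E := fun u ↦ (p u, lam • n (p u)) with hP
  have hPsm : ContDiffOn ℝ ∞ P (Ioo (-η₁) η₁) :=
    hp.prodMk ((hnsm.comp hp hpm).const_smul lam)
  have hP0 : P 0 = (z₀, lam • n z₀) := by simp only [hP, hp0]
  have h00 : (0 : ℝ) ∈ Ioo (-η₁) η₁ := ⟨by linarith, hη₁⟩
  obtain ⟨η, hη, hηη, hPN⟩ : ∃ η > 0, η ≤ η₁ ∧ ∀ u ∈ Ioo (-η) η, P u ∈ N := by
    have h1 : ∀ᶠ u in 𝓝 (0 : ℝ), P u ∈ N :=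
      (hPsm.continuousOn.continuousAt (isOpen_Ioo.mem_nhds h00)).eventually
        (H.isOpen_param.mem_nhds (by rw [hP0]; exact hpN))
    obtain ⟨r, hr, h2⟩ := Metric.eventually_nhds_iff_ball.1 h1
    refine ⟨min r η₁, lt_min hr hη₁, min_le_right _ _, fun u hu ↦ h2 u ?_⟩
    rw [Real.ball_eq_Ioo, zero_sub, zero_add]
    exact ⟨by linarith [hu.1, min_le_left r η₁], hu.2.trans_le (min_le_left _ _)⟩
  have hsub : Ioo (-η) η ⊆ Ioo (-η₁) η₁ := Ioo_subset_Ioo (by linarith) hηη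
  set K := Ioo (-η) η with hK
  have hKo : IsOpen K := isOpen_Ioo
  have h0K : (0 : ℝ) ∈ K := ⟨by linarith, hη⟩
  set F : ℝ × ℝ → M := fun q ↦ Y (q.1, P q.2) with hF
  have hFsm : ContMDiffOn 𝓘(ℝ, ℝ × ℝ) 𝓘(ℝ, E) ∞ F (I ×ˢ K) := by
    have h1 : ContDiffOn ℝ ∞ (fun q : ℝ × ℝ ↦ (q.1, P q.2)) (I ×ˢ K) :=
      contDiffOn_fst.prodMk (hPsm.comp contDiffOn_snd fun q hq ↦ hsub hq.2)
    exact H.smooth.comp h1.contMDiffOn fun q hq ↦ ⟨hq.1, hPN _ hq.2⟩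
  have hFgeo : ∀ u ∈ K, IsGeodesicOn g (fun t ↦ F (t, u)) I := fun u hu ↦ H.geodesic _ (hPN u hu)
  have hFmd : ∀ q ∈ I ×ˢ K, MDifferentiableAt 𝓘(ℝ, ℝ × ℝ) 𝓘(ℝ, E) F q := fun q hq ↦
    mdifferentiableAt_of_contMDiffOn (H.isOpen_time.prod hKo) hFsm hq
  have hptarget : ∀ u ∈ K, p u ∈ (extChartAt 𝓘(ℝ, E) x₀).target := fun u hu ↦ hpm (hsub hu)
  have hFa : ∀ u ∈ K, F (a, u) = (extChartAt 𝓘(ℝ, E) x₀).symm (p u) := fun u hu ↦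
    H.initial _ (hPN u hu)
  have hFt : ∀ u ∈ K, (mfderiv 𝓘(ℝ, ℝ × ℝ) 𝓘(ℝ, E) F (a, u) : ℝ × ℝ →L[ℝ] E) (1, 0) =
      chartFrame x₀ (p u) (lam • n (p u)) := fun u hu ↦ by
    rw [← (velocity_slice (hFmd (a, u) ⟨H.mem_time, hu⟩)).2]
    exact H.velocity _ (hPN u hu)
  have hFu : ∀ u ∈ K, (mfderiv 𝓘(ℝ, ℝ × ℝ) 𝓘(ℝ, E) F (a, u) : ℝ × ℝ →L[ℝ] E) (0, 1) =
      chartFrame x₀ (p u) (deriv p u) := fun u hu ↦ by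
    have e1 := mfderiv_comp_vectorSpace (f := fun w : ℝ ↦ (a, w)) (hFmd (a, u) ⟨H.mem_time, hu⟩)
      (hasFDerivAt_prodMk_right a u) 1
    have hpu : HasDerivAt p (deriv p u) u :=
      (differentiableAt_of_contDiffOn isOpen_Ioo hp (hsub hu)).hasDerivAt
    have e2 := mfderiv_comp_vectorSpace (f := p) (mdifferentiableAt_ext_symm (hptarget u hu))
      hpu.hasFDerivAt 1
    have e3 : (fun w ↦ F (a, w)) =ᶠ[𝓝 u] fun w ↦ (extChartAt 𝓘(ℝ, E) x₀).symm (p w) :=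
      eventually_of_mem (hKo.mem_nhds hu) hFa
    have e4 : (mfderiv 𝓘(ℝ, ℝ) 𝓘(ℝ, E) (fun w ↦ F (a, w)) u : ℝ →L[ℝ] E) =
      (mfderiv 𝓘(ℝ, ℝ) 𝓘(ℝ, E) (fun w ↦ (extChartAt 𝓘(ℝ, E) x₀).symm (p w)) u : ℝ →L[ℝ] E) :=
      e3.mfderiv_eq
    rw [e4] at e1
    have e5 := e1.symm.trans e2
    simp only [ContinuousLinearMap.inr_apply] at e5
    refine e5.trans ?_
    simp only [ContinuousLinearMap.toSpanSingleton_apply, one_smul]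
    rfl
  have hκ : ∀ u ∈ K, g.form (F (a, u))
      ((mfderiv 𝓘(ℝ, ℝ × ℝ) 𝓘(ℝ, E) F (a, u) : ℝ × ℝ →L[ℝ] E) (1, 0))
      ((mfderiv 𝓘(ℝ, ℝ × ℝ) 𝓘(ℝ, E) F (a, u) : ℝ × ℝ →L[ℝ] E) (1, 0)) = -lam ^ 2 := fun u hu ↦ by
    rw [hFt u hu, hFa u hu, ← inChart_apply]
    simp only [map_smul, smul_apply, smul_eq_mul, inChart_normalField_self hτ (hptarget u hu), hn]
    ring
  have hspeed : ∀ q ∈ I ×ˢ K, g.form (F q)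
      ((mfderiv 𝓘(ℝ, ℝ × ℝ) 𝓘(ℝ, E) F q : ℝ × ℝ →L[ℝ] E) (1, 0))
      ((mfderiv 𝓘(ℝ, ℝ × ℝ) 𝓘(ℝ, E) F q : ℝ × ℝ →L[ℝ] E) (1, 0)) = -lam ^ 2 := by
    rintro ⟨r, w⟩ hq
    rw [← hκ w hq.2, ← (velocity_slice (hFmd (r, w) hq)).2,
      ← (velocity_slice (hFmd (a, w) ⟨H.mem_time, hq.2⟩)).2]
    exact form_velocity_eq H.isOpen_time H.ordConnected (hFgeo w hq.2) hq.1 H.mem_time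
  have horth : ∀ q ∈ I ×ˢ K, g.form (F q)
      ((mfderiv 𝓘(ℝ, ℝ × ℝ) 𝓘(ℝ, E) F q : ℝ × ℝ →L[ℝ] E) (0, 1))
      ((mfderiv 𝓘(ℝ, ℝ × ℝ) 𝓘(ℝ, E) F q : ℝ × ℝ →L[ℝ] E) (1, 0)) = 0 := by
    rintro ⟨r, w⟩ hq
    -- At time `a` the variation field is tangent to the slice and the velocity is normal to it; the
    -- Gauss lemma carries this orthogonality along the geodesics.
    rw [gauss H.isOpen_time H.ordConnected hKo hFsm hFgeo H.mem_time hκ hq.1 hq.2,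
      hFu w hq.2, hFt w hq.2, hFa w hq.2, ← inChart_apply, map_smul, inChart_symm,
      inChart_normalField_eq_zero (hptarget w hq.2) (hptan w (hsub hq.2)), smul_zero]
  have hs0 : (s, (0 : ℝ)) ∈ I ×ˢ K := ⟨hsI, h0K⟩
  have hP' : HasDerivAt P (v, lam • fderiv ℝ n z₀ v) 0 := by
    have h1 : HasFDerivAt n (fderiv ℝ n z₀) (p 0) := by
      rw [hp0]
      exact (differentiableAt_of_contDiffOn (isOpen_target x₀) hnsm hz).hasFDerivAt
    exact hpd.prodMk ((h1.comp_hasDerivAt (0 : ℝ) hpd).const_smul lam)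
  have hYmd := H.mdifferentiableAt (q := (s, P 0)) ⟨hsI, hPN 0 h0K⟩
  have hDF : ∀ α β : ℝ, (mfderiv 𝓘(ℝ, ℝ × ℝ) 𝓘(ℝ, E) F (s, 0) : ℝ × ℝ →L[ℝ] E) (α, β) =
      (mfderiv 𝓘(ℝ, ℝ × (E × E)) 𝓘(ℝ, E) Y (s, P 0) : ℝ × (E × E) →L[ℝ] E)
        (α, β • (v, lam • fderiv ℝ n z₀ v)) := by
    intro α β
    have h1 : HasFDerivAt (fun q : ℝ × ℝ ↦ (q.1, P q.2)) ((ContinuousLinearMap.fst ℝ ℝ ℝ).prod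
        ((ContinuousLinearMap.toSpanSingleton ℝ (v, lam • fderiv ℝ n z₀ v)).comp
          (ContinuousLinearMap.snd ℝ ℝ ℝ))) (s, 0) :=
      hasFDerivAt_fst.prodMk (HasFDerivAt.comp (g := P) (s, (0 : ℝ)) hP'.hasFDerivAt hasFDerivAt_snd)
    exact mfderiv_comp_vectorSpace (F := Y) (f := fun q : ℝ × ℝ ↦ (q.1, P q.2)) hYmd h1 (α, β)
  set D : ℝ × ℝ →L[ℝ] E := mfderiv 𝓘(ℝ, ℝ × ℝ) 𝓘(ℝ, E) F (s, 0) with hD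
  have hker' : D (lam⁻¹ * σ, 1) = 0 := by
    refine (hDF _ _).trans ?_
    rw [hP0, one_smul]
    exact hker
  have hsplit : D (lam⁻¹ * σ, 1) = (lam⁻¹ * σ) • D (1, 0) + D (0, 1) := by
    rw [← map_smul, ← map_add]
    simp
  -- The kernel relation reads `(lam⁻¹ * σ) • T + J s = 0`. Its product with the timelike `T`
  -- removes `J s` and leaves a nonzero multiple of `σ`.
  have hσ : σ = 0 := by
    have h1 : g.form (F (s, 0)) ((lam⁻¹ * σ) • D (1, 0) + D (0, 1)) (D (1, 0)) = 0 := by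
      rw [← hsplit, hker', map_zero, zero_apply]
    have h2 : g.form (F (s, 0)) (D (1, 0)) (D (1, 0)) = -lam ^ 2 := hspeed _ hs0
    have h3 : g.form (F (s, 0)) (D (0, 1)) (D (1, 0)) = 0 := horth _ hs0
    rw [map_add, add_apply, map_smul, smul_apply, h2, h3, smul_eq_mul, add_zero] at h1
    have h4 : lam * σ = 0 := by
      field_simp at h1
      linarith
    exact (mul_eq_zero.1 h4).resolve_left hlam
  have hD0 : D (0, 1) = 0 := by
    rw [hsplit, hσ, mul_zero, zero_smul, zero_add] at hker'
    exact hker'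
  have hv0 : v ≠ 0 := fun h ↦ hne (by rw [hσ, h]; rfl)
  have hFs : F (s, 0) = c s := by
    simp only [hF, hP0]
    exact hYs
  have hxs : F (s, 0) ∈ (chartAt E (c s)).source := hFs ▸ mem_chart_source E _
  set y : ℝ × ℝ → E := fun q ↦ extChartAt 𝓘(ℝ, E) (c s) (F q) with hy
  have hR := isOpen_inter_preimage_source (H.isOpen_time.prod hKo) hFsm (c s)
  have hys := contDiffOn_coord hFsm (c s)
  have hsR : (s, (0 : ℝ)) ∈ (I ×ˢ K) ∩ F ⁻¹' (chartAt E (c s)).source := ⟨hs0, hxs⟩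
  have hfocal : du y (s, 0) = 0 := by
    refine (chartFrame_isInvertible (x₀ := c s) (y := extChartAt 𝓘(ℝ, E) (c s) (F (s, 0)))
      ((extChartAt 𝓘(ℝ, E) (c s)).map_source (mem_source_iff.2 hxs))).injective ?_
    rw [map_zero, ← hD0]
    exact (mfderiv_eq_chartFrame (hFmd _ hs0) hxs (0, 1)).symm
  -- If `J` and `J'` both vanished at `s`, the differential of the phase map would annihilate the
  -- initial data of `J`, whose first component is `v ≠ 0`.
  have hfirst : dt (du y) (s, 0) ≠ 0 := by
    intro h0
    rw [dt_du_comm hR hys hsR] at h0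
    have e1 : HasDerivAt (fun u ↦ (y (s, u), dt y (s, u))) (0 : E × E) 0 := by
      have h1 := hasDerivAt_du (p := (s, (0 : ℝ))) (differentiableAt_of_contDiffOn hR hys hsR)
      have h2 := hasDerivAt_du (p := (s, (0 : ℝ)))
        (differentiableAt_of_contDiffOn hR (contDiffOn_dt hR hys) hsR)
      rw [hfocal] at h1
      rw [h0] at h2
      exact h1.prodMk h2
    have hPx : Y (s, P 0) ∈ (chartAt E (c s)).source := hxs
    have e2 : HasDerivAt (fun u ↦ phase (c s) Y s (P u))
        (fderiv ℝ (phase (c s) Y s) (P 0) (v, lam • fderiv ℝ n z₀ v)) 0 :=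
      (differentiableAt_of_contDiffOn (H.isOpen_phase_domain (c s) hsI)
        (H.contDiffOn_phase (c s) hsI) (x := P 0) ⟨hPN 0 h0K, hPx⟩).hasFDerivAt.comp_hasDerivAt
        (0 : ℝ) hP'
    have e3 : (fun u ↦ phase (c s) Y s (P u)) =ᶠ[𝓝 0] fun u ↦ (y (s, u), dt y (s, u)) := by
      have hcont : ContinuousAt (fun u : ℝ ↦ (s, u)) 0 := by fun_prop
      filter_upwards [hcont.eventually (hR.mem_nhds hsR)] with u hu
      rw [H.phase_eq_coord hsI (hPN u hu.1.2) hu.2 (EventuallyEq.refl _ _)]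
      refine Prod.ext rfl ?_
      exact (hasDerivAt_dt (p := (s, u)) (differentiableAt_of_contDiffOn hR hys hu)).deriv
    have e4 := (e1.congr_of_eventuallyEq e3).unique e2
    have e5 := H.fderiv_phase_injective hsI (hPN 0 h0K) hPx (e4.symm.trans (map_zero _).symm)
    exact hv0 (Prod.ext_iff.1 e5).1
  refine ⟨lam ^ 2, η, I, F, ⟨H.isOpen_time, H.ordConnected, H.mem_time, hsI, hη, by positivity,
    hFsm, hFgeo, fun t ht ↦ ?_, fun u hu ↦ ?_, hspeed, horth, hfocal, hfirst⟩⟩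
  · simp only [hF, hP0]
    exact hYc ht
  · rw [hFa u hu]
    have := hplev u (hsub hu)
    simp only [readInChart] at this
    rw [this, hsymm]

end NormalVariation

end

end LorentzGeom

namespace LorentzGeom

noncomputable section

/-! ### Assembling the longer curve -/

section Length

/-- Only open intervals matter, so the speed of the assembled curve need not be compared with its
pieces at the junctions. -/
lemma intervalIntegral_congr_Ioo {f h : ℝ → ℝ} {a b : ℝ} (hab : a ≤ b)
    (hh : ContinuousOn h (Icc a b)) (hfh : ∀ t ∈ Ioo a b, f t = h t) :
    IntervalIntegrable f MeasureTheory.volume a b ∧ ∫ t in a..b, f t = ∫ t in a..b, h t := by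
  constructor
  · have h1 : IntervalIntegrable h MeasureTheory.volume a b :=
      ContinuousOn.intervalIntegrable (by rwa [uIcc_of_le hab])
    rw [intervalIntegrable_iff_integrableOn_Ioo_of_le hab] at h1 ⊢
    exact h1.congr_fun (fun t ht ↦ (hfh t ht).symm) measurableSet_Ioo
  · exact intervalIntegral.integral_congr_Ioo_of_le hab hfh

variable {E : Type*} [NormedAddCommGroup E] [NormedSpace ℝ E]
  {M : Type*} [TopologicalSpace M] [ChartedSpace E M]

lemma velocityWithin_eq_velocity {c : ℝ → M} {a b t : ℝ} (hab : a < b) (ht : t ∈ Icc a b)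
    (hc : MDifferentiableAt 𝓘(ℝ, ℝ) 𝓘(ℝ, E) c t) :
    (velocityWithin c (Icc a b) t : E) = (velocity c t : E) := by
  have h : (mfderivWithin 𝓘(ℝ, ℝ) 𝓘(ℝ, E) c (Icc a b) t : ℝ →L[ℝ] E) =
      (mfderiv 𝓘(ℝ, ℝ) 𝓘(ℝ, E) c t : ℝ →L[ℝ] E) :=
    mfderivWithin_eq_mfderiv ((uniqueDiffOn_Icc hab).uniqueMDiffOn t ht) hc
  exact congrArg (fun L : ℝ →L[ℝ] E ↦ L 1) h

variable [IsManifold 𝓘(ℝ, E) ∞ M] {g : LorentzianMetric E M}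

lemma length_eq {c : ℝ → M} {a b : ℝ} (hab : a < b)
    (hc : ∀ t ∈ Icc a b, MDifferentiableAt 𝓘(ℝ, ℝ) 𝓘(ℝ, E) c t) :
    length g c a b = ∫ t in a..b, √|g.form (c t) (velocity c t) (velocity c t)| := by
  refine intervalIntegral.integral_congr fun t ht ↦ ?_
  rw [uIcc_of_le hab.le] at ht
  have h := velocityWithin_eq_velocity hab ht (hc t ht)
  have h' : g.form (c t) (velocityWithin c (Icc a b) t) (velocityWithin c (Icc a b) t) =
      g.form (c t) (velocity c t) (velocity c t) := congrArg (fun v : E ↦ g.form (c t) v v) h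
  exact congrArg (fun r ↦ √|r|) h'

end Length

section Main

variable {E : Type*} [NormedAddCommGroup E] [NormedSpace ℝ E] [FiniteDimensional ℝ E]
  {M : Type*} [TopologicalSpace M] [ChartedSpace E M] [IsManifold 𝓘(ℝ, E) ∞ M]
  {g : LorentzianMetric E M} {τ : M → ℝ} {c : ℝ → M} {J : Set ℝ} {a s κ η : ℝ} {I : Set ℝ}
  {F : ℝ × ℝ → M}

namespace IsNormalVariation

variable (V : IsNormalVariation g τ c J a s κ η I F)
include V

omit [FiniteDimensional ℝ E] in
lemma isOpen_prod : IsOpen (I ×ˢ Ioo (-η) η) := V.isOpen.prod isOpen_Ioo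

omit [FiniteDimensional ℝ E] in
lemma mdifferentiableAt {q : ℝ × ℝ} (hq : q ∈ I ×ˢ Ioo (-η) η) :
    MDifferentiableAt 𝓘(ℝ, ℝ × ℝ) 𝓘(ℝ, E) F q :=
  mdifferentiableAt_of_contMDiffOn V.isOpen_prod V.smooth hq

omit [FiniteDimensional ℝ E] in
lemma zero_mem : (0 : ℝ) ∈ Ioo (-η) η := ⟨neg_lt_zero.2 V.eta_pos, V.eta_pos⟩

omit [FiniteDimensional ℝ E] in
lemma form_velocity {t u : ℝ} (ht : t ∈ I) (hu : u ∈ Ioo (-η) η) :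
    g.form (F (t, u)) (velocity (fun r ↦ F (r, u)) t) (velocity (fun r ↦ F (r, u)) t) = -κ := by
  have h := (velocity_slice (V.mdifferentiableAt (q := (t, u)) ⟨ht, hu⟩)).2
  exact (congrArg (fun v : E ↦ g.form (F (t, u)) v v) h).trans (V.speed (t, u) ⟨ht, hu⟩)

/-- Everything but `spacelike` is a translation into the chart at `c s`. For that condition,
differentiating `⟨J, T⟩ = 0` at the zero of `J` shows that `J' s` is orthogonal to the timelike
velocity; it is nonzero by `first_order`. -/
lemma isFocalVariation {δ η' : ℝ} (hδ : 0 < δ) (hη' : 0 < η')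
    (hbox : box s δ η' ⊆ (I ×ˢ Ioo (-η) η) ∩ F ⁻¹' (chartAt E (c s)).source) :
    IsFocalVariation (g.inChart (c s)) (extChartAt 𝓘(ℝ, E) (c s)).target
      (fun q ↦ extChartAt 𝓘(ℝ, E) (c s) (F q)) s δ η' κ := by
  have hax : ∀ t ∈ Ioo (s - δ) (s + δ), (t, (0 : ℝ)) ∈ box s δ η' := fun t ht ↦
    ⟨ht, neg_lt_zero.2 hη', hη'⟩
  have hs0 : (s, (0 : ℝ)) ∈ box s δ η' := hax s ⟨by linarith, by linarith⟩
  have hR := isOpen_inter_preimage_source V.isOpen_prod V.smooth (c s)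
  have hys := contDiffOn_coord V.smooth (c s)
  have hm : ∀ q ∈ box s δ η', extChartAt 𝓘(ℝ, E) (c s) (F q) ∈ (extChartAt 𝓘(ℝ, E) (c s)).target :=
    fun q hq ↦ (extChartAt 𝓘(ℝ, E) (c s)).map_source (mem_source_iff.2 (hbox hq).2)
  have hform : ∀ q ∈ box s δ η', ∀ v w : ℝ × ℝ, g.inChart (c s) (extChartAt 𝓘(ℝ, E) (c s) (F q))
      (fderiv ℝ (fun q ↦ extChartAt 𝓘(ℝ, E) (c s) (F q)) q v)
      (fderiv ℝ (fun q ↦ extChartAt 𝓘(ℝ, E) (c s) (F q)) q w) =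
      g.form (F q) ((mfderiv 𝓘(ℝ, ℝ × ℝ) 𝓘(ℝ, E) F q : ℝ × ℝ →L[ℝ] E) v)
        ((mfderiv 𝓘(ℝ, ℝ × ℝ) 𝓘(ℝ, E) F q : ℝ × ℝ →L[ℝ] E) w) := fun q hq v w ↦
    (form_mfderiv g (V.mdifferentiableAt (hbox hq).1) (hbox hq).2 v w).symm
  have hspeed : ∀ q ∈ box s δ η', _ := fun q hq ↦
    (hform q hq (1, 0) (1, 0)).trans (V.speed q (hbox hq).1)
  have horth : ∀ q ∈ box s δ η', _ := fun q hq ↦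
    (hform q hq (0, 1) (1, 0)).trans (V.orthogonal q (hbox hq).1)
  have hgeo : ∀ q ∈ box s δ η', ∀ w, _ := fun q hq w ↦
    geodesic_dt V.isOpen isOpen_Ioo V.smooth V.geodesic (hbox hq).1 (hbox hq).2 w
  refine ⟨isOpen_target _, contDiffOn_inChart g _, fun z _ ↦ inChart_symm g _ z, hδ, hη',
    V.kappa_pos, hys.mono hbox, hm, fun t ht w ↦ hgeo _ (hax t ht) w,
    fun t ht ↦ hspeed _ (hax t ht), horth, V.focal, ?_⟩
  set y : ℝ × ℝ → E := fun q ↦ extChartAt 𝓘(ℝ, E) (c s) (F q)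
  refine inChart_pos_of_orthogonal (T := dt y (s, 0)) (hm _ hs0) ?_ ?_ V.first_order
  · have h := hspeed _ hs0
    have hk := V.kappa_pos
    change g.inChart (c s) (y (s, 0)) (dt y (s, 0)) (dt y (s, 0)) = -κ at h
    linarith
  · have d1 := differentiableAt_of_contDiffOn hR hys (hbox hs0)
    have d2 := differentiableAt_of_contDiffOn hR (contDiffOn_dt hR hys) (hbox hs0)
    have d3 := differentiableAt_of_contDiffOn hR (contDiffOn_du hR hys) (hbox hs0)
    have h3 := hasDerivAt_metric_geodesic (isOpen_target (c s)) (contDiffOn_inChart g (c s))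
      (fun z _ ↦ inChart_symm g (c s) z) (c := fun t ↦ y (t, 0)) (T := fun t ↦ dt y (t, 0))
      (X := fun t ↦ du y (t, 0)) (t := s) (hm _ hs0) (hasDerivAt_dt (p := (s, 0)) d1)
      (hasDerivAt_dt (p := (s, 0)) d2) (hasDerivAt_dt (p := (s, 0)) d3) (hgeo _ hs0)
    have h4 : (fun t ↦ g.inChart (c s) (y (t, 0)) (du y (t, 0)) (dt y (t, 0))) =ᶠ[𝓝 s]
        fun _ ↦ 0 := by
      filter_upwards [Ioo_mem_nhds (show s - δ < s by linarith) (show s < s + δ by linarith)]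
        with t ht using horth _ (hax t ht)
    have h5 := (h3.congr_of_eventuallyEq h4.symm).unique (hasDerivAt_const s (0 : ℝ))
    have hf : du y (s, 0) = 0 := V.focal
    simp only [hf, map_zero, zero_apply, zero_div, add_zero] at h5
    rw [inChart_symm]
    exact h5

/-- A timelike geodesic normal to a slice does not maximize length beyond a focal point. -/
theorem not_maximizesLength {b : ℝ} (hJ : IsOpen J) (hJ' : J.OrdConnected)
    (hc : IsGeodesicOn g c J) (ha : a ∈ J) (hb : b ∈ J) (has : a < s) (hsb : s < b) {S : Set M}
    (hS : ∀ x, τ x = τ (c a) → x ∈ S) : ¬ MaximizesLength g S (c b) c a b := by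
  intro hmax
  have hab : a < b := has.trans hsb
  have hIJ : Icc a b ⊆ J := hJ'.out ha hb
  have hsJ : s ∈ J := hIJ ⟨has.le, hsb.le⟩
  have hκ := V.kappa_pos
  have h0η := V.zero_mem
  have hFs : F (s, 0) = c s := V.axis ⟨V.mem_focal, hsJ⟩
  obtain ⟨r, hr, hbox⟩ := Metric.isOpen_iff.1
    (isOpen_inter_preimage_source V.isOpen_prod V.smooth (c s)) (s, 0)
    ⟨⟨V.mem_focal, h0η⟩, by rw [mem_preimage, hFs]; exact mem_chart_source E _⟩
  rw [← ball_prod_same, Real.ball_eq_Ioo, Real.ball_eq_Ioo, zero_sub, zero_add] at hbox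
  -- The bounds `s - a` and `b - s` keep the window of the smoothing inside `(a, b)`, so neither end
  -- of the curve is touched.
  set δ := min r (min (s - a) (b - s)) with hδ
  have hδ0 : 0 < δ := lt_min hr (lt_min (by linarith) (by linarith))
  have hδr : δ ≤ r := min_le_left _ _
  have hδa : δ ≤ s - a := (min_le_right _ _).trans (min_le_left _ _)
  have hδb : δ ≤ b - s := (min_le_right _ _).trans (min_le_right _ _)
  have hbox' : box s δ r ⊆ (I ×ˢ Ioo (-η) η) ∩ F ⁻¹' (chartAt E (c s)).source :=
    (Set.prod_mono (Ioo_subset_Ioo (by linarith) (by linarith)) Subset.rfl).trans hbox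
  have HV := V.isFocalVariation hδ0 hr hbox'
  obtain ⟨ε, ⟨hε0, hεδ⟩, Γ, hΓ, hΓl, hΓr, hev⟩ := HV.exists_longer
  obtain ⟨u, hmid, hlonger⟩ := hev.exists
  have hur : u ∈ Ioo (-r) r := (hmid s ⟨by linarith, by linarith⟩).1.2
  have hline : ∀ {t}, t ∈ Ioo (s - δ) (s + δ) → (t, u) ∈ box s δ r := fun ht ↦ ⟨ht, hur⟩
  have haxis : ∀ {t}, t ∈ Ioo (s - δ) (s + δ) → (t, (0 : ℝ)) ∈ box s δ r := fun ht ↦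
    ⟨ht, neg_lt_zero.2 hr, hr⟩
  have huη : u ∈ Ioo (-η) η := (hbox' (hline (t := s) ⟨by linarith, by linarith⟩)).1.2
  set x₁ := c s
  set y : ℝ × ℝ → E := fun q ↦ extChartAt 𝓘(ℝ, E) x₁ (F q) with hy
  set m : ℝ → M := fun t ↦ (extChartAt 𝓘(ℝ, E) x₁).symm (Γ (t, u)) with hm
  -- A neighbouring normal geodesic, the smoothed piece, then `c`. As `ε < δ`, the smoothed piece
  -- agrees with its neighbours on overlaps of positive length, so `γ` is smooth across the
  -- junctions.
  set γ : ℝ → M := fun t ↦ if t ≤ s - ε then F (t, u) else if t < s + ε then m t else c t with hγ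
  have hΓt : ∀ t ∈ Ioo (s - δ) (s + δ), Γ (t, u) ∈ (extChartAt 𝓘(ℝ, E) x₁).target := by
    intro t ht
    rcases le_or_gt t (s - ε) with h | h
    · rw [hΓl (t, u) h]
      exact HV.mapsTo (hline ht)
    rcases le_or_gt (s + ε) t with h' | h'
    · rw [hΓr (t, u) h']
      exact HV.mapsTo (haxis ht)
    · exact (hmid t ⟨h.le, h'.le⟩).2.1
  have hγm : ∀ t ∈ Ioo (s - δ) (s + δ), γ t = m t := by
    intro t ht
    rcases le_or_gt t (s - ε) with h | h
    · simp only [hγ, if_pos h, hm]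
      rw [hΓl (t, u) h]
      exact ((extChartAt 𝓘(ℝ, E) x₁).left_inv (mem_source_iff.2 (hbox' (hline ht)).2)).symm
    rcases le_or_gt (s + ε) t with h' | h'
    · simp only [hγ, if_neg h.not_ge, if_neg h'.not_gt, hm]
      rw [hΓr (t, u) h', ← V.axis ⟨(hbox' (haxis ht)).1.1, hIJ ⟨by linarith [ht.1], by linarith [ht.2]⟩⟩]
      exact ((extChartAt 𝓘(ℝ, E) x₁).left_inv (mem_source_iff.2 (hbox' (haxis ht)).2)).symm
    · simp only [hγ, if_neg h.not_ge, if_pos h']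
  have hγF : ∀ t ≤ s - ε, γ t = F (t, u) := fun t ht ↦ if_pos ht
  have hγc : ∀ t, s + ε ≤ t → γ t = c t := fun t ht ↦ by
    simp only [hγ]
    rw [if_neg (by linarith), if_neg (by linarith)]
  have hIcc : ∀ t ∈ Icc a s, t ∈ I := fun t ht ↦ V.ordConnected.out V.mem_left V.mem_focal ht
  -- the three open pieces of the curve
  have p1 : ∀ t ∈ I, t < s - ε → γ =ᶠ[𝓝 t] fun t ↦ F (t, u) := fun t _ h ↦ by
    filter_upwards [Iio_mem_nhds h] with r hr using hγF r (le_of_lt hr)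
  have p2 : ∀ t ∈ Ioo (s - δ) (s + δ), γ =ᶠ[𝓝 t] m := fun t ht ↦
    eventually_of_mem (isOpen_Ioo.mem_nhds ht) hγm
  have p3 : ∀ t, s + ε < t → γ =ᶠ[𝓝 t] c := fun t h ↦ by
    filter_upwards [Ioi_mem_nhds h] with r hr using hγc r (le_of_lt hr)
  have hmsm : ContMDiffOn 𝓘(ℝ, ℝ) 𝓘(ℝ, E) ∞ m (Ioo (s - δ) (s + δ)) :=
    contMDiffOn_of_coord (hΓ.comp (f := fun t : ℝ ↦ (t, u)) (by fun_prop) fun t ht ↦ hline ht) hΓt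
  have hcases : ∀ t ∈ Icc a b, (t ∈ I ∧ t < s - ε) ∨ t ∈ Ioo (s - δ) (s + δ) ∨
      (t ∈ J ∧ s + ε < t) := by
    intro t ht
    rcases lt_or_ge t (s - ε) with h | h
    · exact Or.inl ⟨hIcc t ⟨ht.1, by linarith⟩, h⟩
    rcases lt_or_ge (s + ε) t with h' | h'
    · exact Or.inr (Or.inr ⟨hIJ ht, h'⟩)
    · exact Or.inr (Or.inl ⟨by linarith, by linarith⟩)
  have hγsm : ∀ t ∈ Icc a b, ContMDiffAt 𝓘(ℝ, ℝ) 𝓘(ℝ, E) ∞ γ t := by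
    intro t ht
    rcases hcases t ht with ⟨h, h'⟩ | h | ⟨h, h'⟩
    · exact ((V.geodesic u huη).1.contMDiffAt (V.isOpen.mem_nhds h)).congr_of_eventuallyEq (p1 t h h')
    · exact (hmsm.contMDiffAt (isOpen_Ioo.mem_nhds h)).congr_of_eventuallyEq (p2 t h)
    · exact (hc.1.contMDiffAt (hJ.mem_nhds h)).congr_of_eventuallyEq (p3 t h')
  have hcongr : ∀ {d : ℝ → M} {t : ℝ}, γ =ᶠ[𝓝 t] d →
      g.form (γ t) (velocity γ t) (velocity γ t) = g.form (d t) (velocity d t) (velocity d t) := by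
    intro d t h
    have h1 : (velocity γ t : E) = velocity d t := velocity_congr h
    rw [h.self_of_nhds]
    exact congrArg (fun v : E ↦ g.form (d t) v v) h1
  have hcκ : ∀ t ∈ J, g.form (c t) (velocity c t) (velocity c t) = -κ := by
    intro t ht
    rw [form_velocity_eq hJ hJ' hc ht hsJ, ← V.form_velocity V.mem_focal h0η]
    have h1 : (fun t ↦ F (t, 0)) =ᶠ[𝓝 s] c :=
      eventually_of_mem ((V.isOpen.inter hJ).mem_nhds ⟨V.mem_focal, hsJ⟩) V.axis
    have h2 : (velocity c s : E) = velocity (fun t ↦ F (t, 0)) s := velocity_congr h1.symm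
    rw [hFs]
    exact congrArg (fun v : E ↦ g.form (c s) v v) h2
  have q1 : ∀ t ∈ I, t < s - ε → g.form (γ t) (velocity γ t) (velocity γ t) = -κ := fun t ht h ↦
    (hcongr (p1 t ht h)).trans (V.form_velocity ht huη)
  have q2 : ∀ t ∈ Ioo (s - δ) (s + δ), g.form (γ t) (velocity γ t) (velocity γ t) =
      g.inChart x₁ (Γ (t, u)) (dt Γ (t, u)) (dt Γ (t, u)) := by
    intro t ht
    have hmt : m t ∈ (chartAt E x₁).source :=
      mem_source_iff.1 ((extChartAt 𝓘(ℝ, E) x₁).map_target (hΓt t ht))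
    have h1 : coord (E := E) x₁ m =ᶠ[𝓝 t] fun t ↦ Γ (t, u) :=
      eventually_of_mem (isOpen_Ioo.mem_nhds ht) fun r hr ↦
        (extChartAt 𝓘(ℝ, E) x₁).right_inv (hΓt r hr)
    have h2 := (hasDerivAt_dt (p := (t, u))
      (differentiableAt_of_contDiffOn (isOpen_box s δ r) hΓ (hline ht))).deriv
    have h3 : deriv (coord (E := E) x₁ m) t = dt Γ (t, u) := h1.deriv_eq.trans h2
    rw [hcongr (p2 t ht), LorentzGeom.form_velocity g
      (mdifferentiableAt_of_contMDiffOn isOpen_Ioo hmsm ht) hmt, h3, h1.self_of_nhds]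
  have q3 : ∀ t ∈ J, s + ε < t → g.form (γ t) (velocity γ t) (velocity γ t) = -κ := fun t ht h ↦
    (hcongr (p3 t h)).trans (hcκ t ht)
  have hγmd : ∀ t ∈ Icc a b, MDifferentiableAt 𝓘(ℝ, ℝ) 𝓘(ℝ, E) γ t := fun t ht ↦
    (hγsm t ht).mdifferentiableAt (by simp)
  have htimelike : IsTimelikeCurve g γ a b := by
    refine ⟨hab, fun t ht ↦ (hγsm t ht).contMDiffWithinAt, fun t ht ↦ ?_⟩
    have h1 : g.form (γ t) (velocity γ t) (velocity γ t) < 0 := by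
      rcases lt_or_ge t (s - ε) with h | h
      · rw [q1 t (hIcc t ⟨ht.1, by linarith⟩) h]
        linarith
      rcases lt_or_ge (s + ε) t with h' | h'
      · rw [q3 t (hIJ ht) h']
        linarith
      · rw [q2 t ⟨by linarith, by linarith⟩]
        exact (hmid t ⟨h, h'⟩).2.2
    have h2 := velocityWithin_eq_velocity hab ht (hγmd t ht)
    exact (congrArg (fun v : E ↦ g.form (γ t) v v) h2).trans_lt h1
  have hlen := hmax γ a b htimelike
    (hS _ (by rw [hγF a (by linarith)]; exact V.slice u huη)) (hγc b (by linarith))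
  rw [length_eq hab hγmd,
    length_eq hab fun t ht ↦ mdifferentiableAt_of_contMDiffOn hJ hc.1 (hIJ ht)] at hlen
  have hsqrt : √|-κ| = √κ := by rw [abs_neg, abs_of_pos hκ]
  have lc : ∫ t in a..b, √|g.form (c t) (velocity c t) (velocity c t)| = (b - a) * √κ := by
    rw [(intervalIntegral_congr_Ioo hab.le (continuousOn_const (c := √κ)) fun t ht ↦ by
      rw [hcκ t (hIJ (Ioo_subset_Icc_self ht)), hsqrt]).2]
    simp
  obtain ⟨i1, l1⟩ := intervalIntegral_congr_Ioo
    (f := fun t ↦ √|g.form (γ t) (velocity γ t) (velocity γ t)|) (show a ≤ s - ε by linarith)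
    (continuousOn_const (c := √κ)) fun t ht ↦ by
      rw [q1 t (hIcc t ⟨ht.1.le, by linarith [ht.2]⟩) ht.2, hsqrt]
  obtain ⟨i3, l3⟩ := intervalIntegral_congr_Ioo
    (f := fun t ↦ √|g.form (γ t) (velocity γ t) (velocity γ t)|) (show s + ε ≤ b by linarith)
    (continuousOn_const (c := √κ)) fun t ht ↦ by
      rw [q3 t (hIJ ⟨by linarith [ht.1], ht.2.le⟩) ht.1, hsqrt]
  have hcont : ContinuousOn (fun t ↦ √(-(g.inChart x₁ (Γ (t, u)) (dt Γ (t, u)) (dt Γ (t, u)))))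
      (Icc (s - ε) (s + ε)) := by
    have hsub : Icc (s - ε) (s + ε) ⊆ Ioo (s - δ) (s + δ) := fun t ht ↦
      ⟨by linarith [ht.1], by linarith [ht.2]⟩
    have c0 : ContinuousOn (fun t : ℝ ↦ (t, u)) (Icc (s - ε) (s + ε)) := by fun_prop
    have c1 : ContinuousOn (fun t ↦ Γ (t, u)) (Icc (s - ε) (s + ε)) :=
      hΓ.continuousOn.comp c0 fun t ht ↦ hline (hsub ht)
    have c2 : ContinuousOn (fun t ↦ dt Γ (t, u)) (Icc (s - ε) (s + ε)) :=
      (contDiffOn_dt (isOpen_box s δ r) hΓ).continuousOn.comp c0 fun t ht ↦ hline (hsub ht)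
    have c3 : ContinuousOn (fun t ↦ g.inChart x₁ (Γ (t, u))) (Icc (s - ε) (s + ε)) :=
      (contDiffOn_inChart g x₁).continuousOn.comp c1 fun t ht ↦ hΓt t (hsub ht)
    exact Real.continuous_sqrt.comp_continuousOn ((c3.clm_apply c2).clm_apply c2).neg
  obtain ⟨i2, l2⟩ := intervalIntegral_congr_Ioo
    (f := fun t ↦ √|g.form (γ t) (velocity γ t) (velocity γ t)|)
    (show s - ε ≤ s + ε by linarith) hcont fun t ht ↦ by
      rw [q2 t ⟨by linarith [ht.1], by linarith [ht.2]⟩,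
        abs_of_neg (hmid t ⟨ht.1.le, ht.2.le⟩).2.2]
  -- All pieces keep the parameter of `c`, and the outer ones have its speed `√κ`; the comparison
  -- thus reduces to the window, where the integral exceeds `2 * ε * √κ`.
  have hsplit := intervalIntegral.integral_add_adjacent_intervals (i1.trans i2) i3
  rw [← intervalIntegral.integral_add_adjacent_intervals i1 i2, l1, l2, l3] at hsplit
  rw [lc, ← hsplit] at hlen
  simp only [intervalIntegral.integral_const, smul_eq_mul] at hlen
  linarith

end IsNormalVariation

end Main

end

end LorentzGeom

theorem mainTheorem5 {E : Type*} [NormedAddCommGroup E] [NormedSpace ℝ E] [FiniteDimensional ℝ E]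
    {M : Type*} [TopologicalSpace M] [T2Space M] [SecondCountableTopology M] [ChartedSpace E M]
    [IsManifold 𝓘(ℝ, E) ∞ M]
    (g : LorentzGeom.LorentzianMetric E M)
    (hM : LorentzGeom.IsGloballyHyperbolic g)
    (τ : M → ℝ) (hτ : LorentzGeom.IsTimeFunction g τ)
    (S : Set M) (hS : LorentzGeom.IsTimeSlice τ S)
    (p : M) (c : ℝ → M) (J : Set ℝ) (hJ : IsOpen J) (hJ' : J.OrdConnected)
    (hc : LorentzGeom.IsGeodesicOn g c J)
    (hct : ∀ t ∈ J, g.val (c t) (LorentzGeom.velocity c t) (LorentzGeom.velocity c t) < 0)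
    (a b : ℝ) (hab : a < b) (ha : a ∈ J) (hb : b ∈ J)
    (hca : c a ∈ S)
    (hort : LorentzGeom.IsOrthogonalToSlice g τ (c a) (LorentzGeom.velocity c a))
    (hcb : c b = p)
    (hconj : ∃ s ∈ Set.Ioo a b, LorentzGeom.IsConjugatePointAlong g τ (c a) (c s)) :
    ¬ LorentzGeom.MaximizesLength g S p c a b := by
  obtain ⟨s, hs, hcs⟩ := hconj
  have hsJ : s ∈ J := hJ'.out ha hb ⟨hs.1.le, hs.2.le⟩
  obtain ⟨κ, η, I, F, V⟩ :=
    LorentzGeom.exists_normalVariation hτ hJ hJ' hc hct ha hsJ hort hcs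
  obtain ⟨-, r, rfl⟩ := hS
  rw [← hcb]
  exact V.not_maximizesLength hJ hJ' hc ha hb hs.1 hs.2 fun x hx ↦ hx.trans hca
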